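/- Let $\gamma\subset\mathbb R^3$ be a smooth, compact, connected surface without boundary, the boundary of a bounded open set (its interior). Let $d$ be its signed distance function ($d<0$ in the interior), $\nu=\nabla d$, $p(x)=x-d(x)\nu(x)$ the closest point projection onto $\gamma$. Fix a sufficiently small $\delta>0$, depending only on $\gamma$, such that $d$ is smooth and $p$ is well defined on the tube $U=\{x:\operatorname{dist}(x,\gamma)\le\delta\}$. Let $\Gamma_h\subset U$ be a polyhedral surface with a conforming triangulation $\mathcal T_h$ into planar triangles, $h=\max_{K\in\mathcal T_h}\operatorname{diam}K$, and constant unit normals $\nu_h|_K=\nu_K$. Assume, with constants $M,c>0$: $p:\Gamma_h\to\gamma$ is a bijection; $|d|\le Mh^2$, $|\nu\circ p-\nu_h|\le Mh$ and $\nu\cdot\nu_h\ge c$ on $\Gamma_h$; for each $K\in\mathcal T_h$ the circumradius is at most $M$ times the inradius, and $h\le M\operatorname{diam}K$. For a surface piece $S$ with unit normal $n$ and $\Pi=I-n\otimes n$, let $H^1_T(S)$ be the space of tangential fields in $L_2(S)^3$ whose components have weak surface gradients in $L_2(S)$; write $\nabla v\,\Pi$ for the matrix whose $i$-th row is the weak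 surface gradient of $v_i$, $\nabla_S v=\Pi(\nabla v\,\Pi)$ for the covariant derivative, and ${\rm Def}_S v=\frac12(\nabla_S v+(\nabla_S v)^{\intercal})$. Let $\mu_h$ be the area ratio, $\mu_h\,d\sigma_h=d\sigma\circ p$, where $\sigma_h,\sigma$ are the surface measures of $\Gamma_h,\gamma$. Define the Piola transform $\mathcal P_p v$ by $(\mathcal P_p v)\circ p=\mu_h^{-1}\,Dp\,v$. Then there is a constant $C>0$, depending only on $\gamma$, $\delta$, $M$, $c$ (in particular not on $h$, $\Gamma_h$, $K$ or $v$), such that for every such $\Gamma_h$, every $K\in\mathcal T_h$ with image $K^\gamma=p(K)$, and every $v\in H^1_T(K)$, the field $\hat v=\mathcal P_p v$ belongs to $H^1_T(K^\gamma)$ and, almost everywhere on $K^\gamma$, $$\big|{\rm Def}_\gamma \hat v-({\rm Def}_{\Gamma_h}v)\circ p^{-1}\big|\le C\,h\,\big(|(\nabla_{\Gamma_h}v)\circ p^{-1}|+|v\circ p^{-1}|\big).$$ Consequently, $$\|{\rm Def}_\gamma\hat v\|_{L_2(K^\gamma)}\le C\Big(\|{\rm Def}_{\Gamma_h}v\|_{L_2(K)}+h\big(\|\nabla_{\Gamma_h}v\|_{L_2(K)}+\|v\|_{L_2(K)}\big)\Big).$$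 -/

import Mathlib

open MeasureTheory Set
open scoped ContDiff Topology RealInnerProductSpace

noncomputable section

/-- Three-dimensional Euclidean space. -/
abbrev E3 : Type := EuclideanSpace ℝ (Fin 3)

/-- Matrices act as linear maps of Euclidean space, `|A|` is the operator norm. -/
abbrev Mat3 : Type := E3 →L[ℝ] E3

/-! ### The smooth surface, its signed distance function and the closest point projection -/

/-- The surface `γ = frontier Ω` is a smooth, compact, connected surface without boundary in `ℝ³`
and `Ω` is its interior: near each of its points, `Ω` is the set where a smooth function with
nonvanishing differential is negative. -/
structure BoundsSmoothSurface (Ω : Set E3) : Prop where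
  isOpen : IsOpen Ω
  isBounded : Bornology.IsBounded Ω
  isConnected : IsConnected (frontier Ω)
  smooth : ∀ x ∈ frontier Ω, ∃ f : E3 → ℝ, ContDiff ℝ ∞ f ∧ fderiv ℝ f x ≠ 0 ∧
    ∀ᶠ y in 𝓝 x, (y ∈ Ω ↔ f y < 0)

open Classical in
/-- The signed distance function `d` of `γ = frontier Ω`, negative in the interior `Ω`. -/
def sdist (Ω : Set E3) (x : E3) : ℝ :=
  if x ∈ Ω then -Metric.infDist x (frontier Ω) else Metric.infDist x (frontier Ω)

/-- The field `ν = ∇ d`; on `γ` it is the outward unit normal. -/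
def nu (Ω : Set E3) (x : E3) : E3 := gradient (sdist Ω) x

/-- The closest point projection `p(x) = x - d(x) ν(x)`. -/
def proj (Ω : Set E3) (x : E3) : E3 := x - sdist Ω x • nu Ω x

/-- The closed tubular region `U = {x : dist(x, γ) ≤ δ}`. -/
def tube (Ω : Set E3) (δ : ℝ) : Set E3 := {x | Metric.infDist x (frontier Ω) ≤ δ}

/-- The width `δ` is so small that on the tubular region `U` the signed distance function is smooth
and the closest point projection is well defined. -/
structure IsTubularWidth (Ω : Set E3) (δ : ℝ) : Prop where
  pos : 0 < δ
  smooth : ∀ x ∈ tube Ω δ, ContDiffAt ℝ ∞ (sdist Ω) x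
  proj_mem : ∀ x ∈ tube Ω δ, proj Ω x ∈ frontier Ω
  dist_proj : ∀ x ∈ tube Ω δ, dist x (proj Ω x) = Metric.infDist x (frontier Ω)
  unique : ∀ x ∈ tube Ω δ, ∀ y ∈ frontier Ω,
    dist x y = Metric.infDist x (frontier Ω) → y = proj Ω x

/-! ### Polyhedral surfaces -/

/-- A finite conforming collection of (nondegenerate) triangles in `ℝ³`, each with a choice of a
unit normal vector. -/
structure PolyhedralSurface where
  numFaces : ℕ
  face : Fin numFaces → Affine.Triangle ℝ E3
  /-- Different faces have different vertex sets. -/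
  distinct : ∀ i j, range (face i).points = range (face j).points → i = j
  /-- Two faces meet exactly in the convex hull of their common vertices: a common edge, a common
  vertex or nothing. -/
  conforming : ∀ i j, (face i).closedInterior ∩ (face j).closedInterior =
    convexHull ℝ (range (face i).points ∩ range (face j).points)
  normal : Fin numFaces → E3
  norm_normal : ∀ i, ‖normal i‖ = 1
  normal_orth : ∀ i j k, ⟪normal i, (face i).points j - (face i).points k⟫ = 0

namespace PolyhedralSurface

/-- The union `Γ_h` of the closed faces. -/
def carrier (Γ : PolyhedralSurface) : Set E3 := ⋃ i, (Γ.face i).closedInterior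

/-- The mesh size `h`, the largest diameter of a face. -/
def meshSize (Γ : PolyhedralSurface) : ℝ := ⨆ i, Metric.diam (Γ.face i).closedInterior

end PolyhedralSurface

/-- The standing assumptions on the polyhedral approximation `Γ` of `γ = frontier Ω`, with the
constants in them made explicit. The closest point projection maps `Γ` one-to-one onto `γ`, which
makes `Γ` a closed surface; `le_inner_normal` orients the normals of `Γ` outwards. -/
structure IsPolyhedralApprox (Ω : Set E3) (δ M c : ℝ) (Γ : PolyhedralSurface) : Prop where
  subset_tube : Γ.carrier ⊆ tube Ω δ
  bijOn_proj : BijOn (proj Ω) Γ.carrier (frontier Ω)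
  abs_sdist_le : ∀ x ∈ Γ.carrier, |sdist Ω x| ≤ M * Γ.meshSize ^ 2
  normal_close : ∀ i, ∀ x ∈ (Γ.face i).closedInterior,
    ‖nu Ω (proj Ω x) - Γ.normal i‖ ≤ M * Γ.meshSize
  le_inner_normal : ∀ i, ∀ x ∈ (Γ.face i).closedInterior, c ≤ ⟪nu Ω x, Γ.normal i⟫
  shape_regular : ∀ i, (Γ.face i).circumradius ≤ M * (Γ.face i).inradius
  quasi_uniform : ∀ i, Γ.meshSize ≤ M * Metric.diam (Γ.face i).closedInterior

/-! ### Piola transform -/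

/-- The area ratio `μ` with `μ dσ₀ = dσ₁` of a bijection `Φ : S₀ → S₁` with inverse `Ψ`: the density
with respect to the surface measure of `S₀` of the surface measure of `S₁` carried over to `S₀`
by `Ψ`. -/
def areaRatio (S₀ S₁ : Set E3) (Ψ : E3 → E3) (x : E3) : ℝ :=
  ((Measure.map Ψ (μHE[2].restrict S₁)).rnDeriv (μHE[2].restrict S₀) x).toReal

/-- The Piola transform with respect to `Φ : S₀ → S₁` with inverse `Ψ` of a tangential field `v`:
`(𝒫 v)(Φ x) = μ(x)⁻¹ DΦ(x) v(x)`. -/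
def piola (S₀ S₁ : Set E3) (Φ Ψ : E3 → E3) (v : E3 → E3) (y : E3) : E3 :=
  (areaRatio S₀ S₁ Ψ (Ψ y))⁻¹ • fderiv ℝ Φ (Ψ y) (v (Ψ y))

/-- The inverse `p⁻¹ : γ → Γ_h` of the closest point projection restricted to `Γ_h`. -/
def projInv (Ω : Set E3) (Γ : PolyhedralSurface) : E3 → E3 :=
  Function.invFunOn (proj Ω) Γ.carrier

/-- The Piola transform `𝒫_p v` of a field on `Γ_h` to `γ`. -/
def liftPiola (Ω : Set E3) (Γ : PolyhedralSurface) (v : E3 → E3) : E3 → E3 :=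
  piola Γ.carrier (frontier Ω) (proj Ω) (projInv Ω Γ) v

/-! ### Surface derivatives

In this part `S` is a piece of a surface, relatively open in it, and `n` is a unit normal field
of the surface. -/

/-- The tangential projection `I - n ⊗ n`. -/
def tangProj (n : E3) : Mat3 :=
  ContinuousLinearMap.id ℝ E3 - (innerSL ℝ n).smulRight n

/-- The tangential surface gradient (covariant derivative) `Π A Π`, where `A` is a Jacobian. -/
def covGrad (n : E3 → E3) (A : E3 → Mat3) (x : E3) : Mat3 :=
  tangProj (n x) ∘L A x ∘L tangProj (n x)

/-- The deformation tensor, the symmetric part of the tangential surface gradient. -/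
def deform (n : E3 → E3) (A : E3 → Mat3) (x : E3) : Mat3 :=
  (1 / 2 : ℝ) • (covGrad n A x + ContinuousLinearMap.adjoint (covGrad n A x))

/-- The surface divergence `tr (Π Dφ Π)` of a smooth field. -/
def surfDiv (n : E3 → E3) (φ : E3 → E3) (x : E3) : ℝ :=
  LinearMap.trace ℝ E3 (covGrad n (fderiv ℝ φ) x).toLinearMap

/-- Smooth fields, tangential on `S`, whose restriction to `S` has compact support in `S`. -/
structure IsTestField (S : Set E3) (n : E3 → E3) (φ : E3 → E3) : Prop where
  smooth : ContDiff ℝ ∞ φ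
  compact : HasCompactSupport φ
  support : tsupport φ ∩ closure S ⊆ S
  tangential : ∀ x ∈ S, ⟪φ x, n x⟫ = 0

/-- The field `v` is in `H¹_T(S)` and the matrix field `A` is its weak surface Jacobian `∇v Π`, whose
`i`-th row is the weak surface gradient of the component `v_i`. That is, `v` and `A` are square
integrable, `v` is tangential, the rows of `A` are tangential, and
`∫_S v_i div_S φ = - ∫_S (∇_S v_i) ⬝ φ` for `i = 1, 2, 3` and all tangential test fields `φ`. -/
structure IsH1Tangential (S : Set E3) (n : E3 → E3) (v : E3 → E3) (A : E3 → Mat3) : Prop where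
  memLp : MemLp v 2 (μHE[2].restrict S)
  memLp_grad : MemLp A 2 (μHE[2].restrict S)
  tangential : ∀ᵐ x ∂(μHE[2].restrict S), ⟪v x, n x⟫ = 0
  grad_normal : ∀ᵐ x ∂(μHE[2].restrict S), A x (n x) = 0
  weak : ∀ φ : E3 → E3, IsTestField S n φ →
    ∫ x in S, surfDiv n φ x • v x ∂μHE[2] = - ∫ x in S, A x (φ x) ∂μHE[2]

end

/-!
On a planar face with unit normal `n`, the projection `p` is `O(h)`-close to the identity in `C²`,
as far as tangential derivatives are concerned. Indeed `Dp = I - ν ⊗ ν - d Dν` with `d = O(h²)` and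
`ν - n = O(h)`, and every term of `D²p` contains `d`, or `ν` evaluated against a tangent vector of
the face, or takes values in the direction `ν` itself, where the final projection onto the tangent
plane kills it. So the Piola matrix `F = μ⁻¹ Dp` is `O(h)`-close to the tangential projection and
the tangential part of its derivative is `O(h)`.

The transform `w = (F v) ∘ p⁻¹` has the weak Jacobian `B` with `B ∘ p = (DF[·] v + F A) (Dp|_T)⁻¹`,
where `A` is the weak Jacobian of `v` and `T` is the plane of the face. To see this, a test field on
the curved piece is pulled back to the flat one by the cofactor of `Dp|_T`, and the Piola identity
turns surface divergence into flat divergence. Comparing `B ∘ p` with `A` through the two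
`O(h)`-estimates gives the pointwise bound, and the area formula turns it into the `L²` bound.
-/

/-! ### Vector algebra and frames -/

namespace E3

theorem inner_eq (a b : E3) : ⟪a, b⟫ = a 0 * b 0 + a 1 * b 1 + a 2 * b 2 := by
  simp [PiLp.inner_apply, Fin.sum_univ_three, mul_comm]

theorem norm_sq_eq (a : E3) : ‖a‖ ^ 2 = a 0 ^ 2 + a 1 ^ 2 + a 2 ^ 2 := by
  rw [← real_inner_self_eq_norm_sq, inner_eq]
  ring

theorem ext_coords {a b : E3} (h0 : a 0 = b 0) (h1 : a 1 = b 1) (h2 : a 2 = b 2) : a = b := by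
  ext i
  fin_cases i <;> assumption

theorem map_apply_eq (L : Mat3) (a : E3) (i : Fin 3) :
    L a i = a 0 * L (EuclideanSpace.single 0 1) i + a 1 * L (EuclideanSpace.single 1 1) i +
      a 2 * L (EuclideanSpace.single 2 1) i := by
  have ha : a = a 0 • EuclideanSpace.single 0 1 + a 1 • EuclideanSpace.single 1 1 +
      a 2 • EuclideanSpace.single (2 : Fin 3) (1 : ℝ) := by
    apply ext_coords <;> simp
  conv_lhs => rw [ha]
  simp

theorem trace_eq (L : Mat3) : LinearMap.trace ℝ E3 L.toLinearMap =
    L (EuclideanSpace.single 0 1) 0 + L (EuclideanSpace.single 1 1) 1 +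
      L (EuclideanSpace.single 2 1) 2 := by
  rw [LinearMap.trace_eq_sum_inner _ (EuclideanSpace.basisFun (Fin 3) ℝ), Fin.sum_univ_three]
  simp [EuclideanSpace.inner_single_left]

theorem det_eq (L : Mat3) : L.det =
    (Matrix.of fun i j => L (EuclideanSpace.single j 1) i : Matrix (Fin 3) (Fin 3) ℝ).det := by
  rw [ContinuousLinearMap.det,
    ← LinearMap.det_toMatrix (EuclideanSpace.basisFun (Fin 3) ℝ).toBasis]
  rfl

end E3

/-- The cross product of Mathlib, carried over from `Fin 3 → ℝ` to `E3`. -/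
noncomputable def crossProd (a b : E3) : E3 := WithLp.toLp 2 (crossProduct a.ofLp b.ofLp)

@[simp] theorem crossProd_apply_zero (a b : E3) : crossProd a b 0 = a 1 * b 2 - a 2 * b 1 := by
  simp [crossProd, cross_apply]

@[simp] theorem crossProd_apply_one (a b : E3) : crossProd a b 1 = a 2 * b 0 - a 0 * b 2 := by
  simp [crossProd, cross_apply]

@[simp] theorem crossProd_apply_two (a b : E3) : crossProd a b 2 = a 0 * b 1 - a 1 * b 0 := by
  simp [crossProd, cross_apply]

theorem crossProd_swap (a b : E3) : crossProd a b = -crossProd b a := by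
  simp [crossProd, ← WithLp.toLp_neg]

theorem crossProd_crossProd (a b c : E3) :
    crossProd a (crossProd b c) = ⟪a, c⟫ • b - ⟪a, b⟫ • c := by
  apply E3.ext_coords <;> simp [E3.inner_eq] <;> ring

theorem norm_crossProd_sq (a b : E3) :
    ‖crossProd a b‖ ^ 2 = ‖a‖ ^ 2 * ‖b‖ ^ 2 - ⟪a, b⟫ ^ 2 := by
  simp only [E3.norm_sq_eq, E3.inner_eq, crossProd_apply_zero, crossProd_apply_one,
    crossProd_apply_two]
  ring

theorem norm_crossProd_le (a b : E3) : ‖crossProd a b‖ ≤ ‖a‖ * ‖b‖ := by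
  refine le_of_sq_le_sq ?_ (by positivity)
  rw [norm_crossProd_sq, mul_pow]
  exact sub_le_self _ (sq_nonneg _)

/-- The cross product as a continuous bilinear map. -/
noncomputable def crossProdL : E3 →L[ℝ] E3 →L[ℝ] E3 :=
  LinearMap.mkContinuous₂
    (LinearMap.mk₂ ℝ crossProd (by simp [crossProd]) (by simp [crossProd]) (by simp [crossProd])
      (by simp [crossProd])) 1
    (fun a b => (norm_crossProd_le a b).trans_eq (by rw [one_mul]))

@[simp] theorem crossProdL_apply (a b : E3) : crossProdL a b = crossProd a b := rfl

/-- The scalar triple product `(a × b) ⬝ c`, the determinant of the matrix with columns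
`a, b, c`. -/
noncomputable def tripleProd (a b c : E3) : ℝ := ⟪crossProd a b, c⟫

theorem tripleProd_eq (a b c : E3) : tripleProd a b c = (a 1 * b 2 - a 2 * b 1) * c 0 +
    (a 2 * b 0 - a 0 * b 2) * c 1 + (a 0 * b 1 - a 1 * b 0) * c 2 := by
  rw [tripleProd, E3.inner_eq, crossProd_apply_zero, crossProd_apply_one, crossProd_apply_two]

theorem tripleProd_rotate (a b c : E3) : tripleProd a b c = tripleProd b c a := by
  rw [tripleProd_eq, tripleProd_eq]
  ring

theorem tripleProd_swap (a b c : E3) : tripleProd a b c = -tripleProd b a c := by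
  rw [tripleProd_eq, tripleProd_eq]
  ring

theorem tripleProd_sub_left (a a' b c : E3) :
    tripleProd (a - a') b c = tripleProd a b c - tripleProd a' b c := by
  simp only [tripleProd_eq, PiLp.sub_apply]
  ring

theorem tripleProd_smul_left (r : ℝ) (a b c : E3) :
    tripleProd (r • a) b c = r * tripleProd a b c := by
  simp only [tripleProd_eq, PiLp.smul_apply, smul_eq_mul]
  ring

theorem tripleProd_sub_middle (a b b' c : E3) :
    tripleProd a (b - b') c = tripleProd a b c - tripleProd a b' c := by
  simp only [tripleProd_eq, PiLp.sub_apply]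
  ring

theorem tripleProd_smul_middle (r : ℝ) (a b c : E3) :
    tripleProd a (r • b) c = r * tripleProd a b c := by
  simp only [tripleProd_eq, PiLp.smul_apply, smul_eq_mul]
  ring

theorem tripleProd_sub_right (a b c c' : E3) :
    tripleProd a b (c - c') = tripleProd a b c - tripleProd a b c' :=
  inner_sub_right _ _ _

@[simp] theorem tripleProd_self_right (a b : E3) : tripleProd a b b = 0 := by
  rw [tripleProd_eq]
  ring

@[simp] theorem tripleProd_self_outer (a b : E3) : tripleProd a b a = 0 := by
  rw [tripleProd_eq]
  ring

theorem inner_crossProd_left (a b w : E3) : ⟪crossProd a b, w⟫ = tripleProd w a b := by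
  rw [← tripleProd, tripleProd_rotate, tripleProd_rotate]

theorem abs_tripleProd_le (a b c : E3) : |tripleProd a b c| ≤ ‖a‖ * ‖b‖ * ‖c‖ :=
  (abs_real_inner_le_norm _ _).trans (by gcongr; exact norm_crossProd_le a b)

theorem tripleProd_smul_eq_sum (a b c w : E3) : tripleProd a b c • w =
    tripleProd w b c • a + tripleProd a w c • b + tripleProd a b w • c := by
  apply E3.ext_coords <;>
    simp only [PiLp.add_apply, PiLp.smul_apply, smul_eq_mul, tripleProd_eq] <;> ring

theorem tripleProd_eq_zero_of_inner_eq_zero {a b c n : E3} (hn : n ≠ 0) (ha : ⟪a, n⟫ = 0)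
    (hb : ⟪b, n⟫ = 0) (hc : ⟪c, n⟫ = 0) : tripleProd a b c = 0 := by
  have h : ⟪tripleProd a b c • n, n⟫ = 0 := by
    rw [tripleProd_smul_eq_sum]
    simp only [inner_add_left, real_inner_smul_left, ha, hb, hc, mul_zero, add_zero]
  simpa [real_inner_smul_left, hn] using h

theorem tripleProd_map (L : Mat3) (a b c : E3) :
    tripleProd (L a) (L b) (L c) = L.det * tripleProd a b c := by
  rw [E3.det_eq, Matrix.det_fin_three]
  simp only [Matrix.of_apply, tripleProd_eq, E3.map_apply_eq L a, E3.map_apply_eq L b,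
    E3.map_apply_eq L c]
  ring

/-- Jacobi's formula: the trace is the derivative of the determinant at the identity. -/
theorem tripleProd_map_add_map_add_map (L : Mat3) (a b c : E3) :
    tripleProd (L a) b c + tripleProd a (L b) c + tripleProd a b (L c) =
      LinearMap.trace ℝ E3 L.toLinearMap * tripleProd a b c := by
  rw [E3.trace_eq]
  simp only [tripleProd_eq, E3.map_apply_eq L a, E3.map_apply_eq L b, E3.map_apply_eq L c]
  ring

theorem tangProj_apply (n w : E3) : tangProj n w = w - ⟪n, w⟫ • n := rfl

theorem inner_tangProj {n : E3} (hn : ‖n‖ = 1) (w : E3) : ⟪n, tangProj n w⟫ = 0 := by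
  rw [tangProj_apply, inner_sub_right, inner_smul_right, real_inner_self_eq_norm_sq, hn]
  ring

theorem tangProj_self {n : E3} (hn : ‖n‖ = 1) : tangProj n n = 0 := by
  rw [tangProj_apply, real_inner_self_eq_norm_sq, hn, one_pow, one_smul, sub_self]

theorem tangProj_of_inner_eq_zero {n w : E3} (h : ⟪n, w⟫ = 0) : tangProj n w = w := by
  rw [tangProj_apply, h, zero_smul, sub_zero]

theorem norm_tangProj_apply_le {n : E3} (hn : ‖n‖ = 1) (w : E3) : ‖tangProj n w‖ ≤ ‖w‖ := by
  refine le_of_sq_le_sq ?_ (norm_nonneg _)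
  rw [tangProj_apply, norm_sub_sq_real, inner_smul_right, norm_smul, hn, mul_one,
    Real.norm_eq_abs, sq_abs, real_inner_comm]
  nlinarith [sq_nonneg ⟪n, w⟫]

theorem tripleProd_map_tangent (L : Mat3) {a b n : E3} (hn : ‖n‖ = 1) (ha : ⟪n, a⟫ = 0)
    (hb : ⟪n, b⟫ = 0) : tripleProd (L a) b n + tripleProd a (L b) n =
      LinearMap.trace ℝ E3 (tangProj n ∘L L ∘L tangProj n).toLinearMap * tripleProd a b n := by
  have h0 : ∀ x y : E3, tripleProd x y 0 = 0 := fun x y => inner_zero_right _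
  rw [← tripleProd_map_add_map_add_map]
  simp only [ContinuousLinearMap.comp_apply, tangProj_self hn, tangProj_of_inner_eq_zero ha,
    tangProj_of_inner_eq_zero hb, map_zero, tangProj_apply, tripleProd_sub_left,
    tripleProd_smul_left, tripleProd_sub_middle, tripleProd_smul_middle, tripleProd_self_outer,
    tripleProd_self_right, h0, mul_zero, sub_zero, add_zero]

/-- A positively oriented orthonormal frame of `E3`, thought of as an orthonormal basis `e₁, e₂` of
the plane with unit normal `m`. -/
structure IsFrame (e₁ e₂ m : E3) : Prop where
  norm_fst : ‖e₁‖ = 1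
  norm_snd : ‖e₂‖ = 1
  norm_normal : ‖m‖ = 1
  inner_fst_snd : ⟪e₁, e₂⟫ = 0
  inner_normal_fst : ⟪m, e₁⟫ = 0
  inner_normal_snd : ⟪m, e₂⟫ = 0
  crossProd_fst_snd : crossProd e₁ e₂ = m

theorem exists_isFrame {m : E3} (hm : ‖m‖ = 1) : ∃ e₁ e₂, IsFrame e₁ e₂ m := by
  have : Fact (Module.finrank ℝ E3 = 2 + 1) := ⟨finrank_euclideanSpace_fin⟩
  let basis := OrthonormalBasis.fromOrthogonalSpanSingleton (𝕜 := ℝ) 2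
    (ne_zero_of_norm_ne_zero (hm.trans_ne one_ne_zero))
  obtain ⟨e₁, he₁, hme₁⟩ : ∃ e₁ : E3, ‖e₁‖ = 1 ∧ ⟪m, e₁⟫ = 0 :=
    ⟨basis 0, basis.orthonormal.1 0,
      Submodule.mem_orthogonal_singleton_iff_inner_right.1 (basis 0).2⟩
  have hnorm : ‖crossProd m e₁‖ ^ 2 = 1 := by
    rw [norm_crossProd_sq, hm, he₁, hme₁]
    norm_num
  refine ⟨e₁, crossProd m e₁, he₁, ?_, hm, ?_, hme₁, ?_, ?_⟩
  · exact (pow_eq_one_iff_of_nonneg (norm_nonneg _) two_ne_zero).1 hnorm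
  · rw [real_inner_comm]
    exact tripleProd_self_right m e₁
  · rw [real_inner_comm]
    exact tripleProd_self_outer m e₁
  · rw [crossProd_crossProd, real_inner_self_eq_norm_sq, he₁, real_inner_comm, hme₁]
    simp

namespace IsFrame

variable {e₁ e₂ m : E3} (hf : IsFrame e₁ e₂ m)
include hf

theorem tripleProd_eq_one : tripleProd e₁ e₂ m = 1 := by
  rw [tripleProd, hf.crossProd_fst_snd, real_inner_self_eq_norm_sq, hf.norm_normal, one_pow]

theorem crossProd_snd_normal : crossProd e₂ m = e₁ := by
  rw [← hf.crossProd_fst_snd, crossProd_crossProd, real_inner_self_eq_norm_sq, hf.norm_snd,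
    real_inner_comm, hf.inner_fst_snd]
  simp

theorem crossProd_normal_fst : crossProd m e₁ = e₂ := by
  rw [crossProd_swap, ← hf.crossProd_fst_snd, crossProd_crossProd, real_inner_self_eq_norm_sq,
    hf.norm_fst, hf.inner_fst_snd]
  simp

theorem tripleProd_apply_snd_normal (w : E3) : tripleProd w e₂ m = ⟪e₁, w⟫ := by
  rw [← inner_crossProd_left, hf.crossProd_snd_normal]

theorem tripleProd_fst_apply_normal (w : E3) : tripleProd e₁ w m = ⟪e₂, w⟫ := by
  rw [tripleProd_rotate, ← inner_crossProd_left, hf.crossProd_normal_fst]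

theorem eq_sum_inner_smul (w : E3) : w = ⟪e₁, w⟫ • e₁ + ⟪e₂, w⟫ • e₂ + ⟪m, w⟫ • m := by
  have cramer := tripleProd_smul_eq_sum e₁ e₂ m w
  rwa [hf.tripleProd_eq_one, one_smul, hf.tripleProd_apply_snd_normal,
    hf.tripleProd_fst_apply_normal, tripleProd, hf.crossProd_fst_snd] at cramer

theorem tangProj_eq (w : E3) : tangProj m w = ⟪e₁, w⟫ • e₁ + ⟪e₂, w⟫ • e₂ := by
  rw [tangProj_apply, sub_eq_iff_eq_add]
  exact hf.eq_sum_inner_smul w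

theorem trace_tangential (L : Mat3) :
    LinearMap.trace ℝ E3 (tangProj m ∘L L ∘L tangProj m).toLinearMap =
      ⟪e₁, L e₁⟫ + ⟪e₂, L e₂⟫ := by
  have h := tripleProd_map_tangent L hf.norm_normal hf.inner_normal_fst hf.inner_normal_snd
  rwa [hf.tripleProd_eq_one, mul_one, hf.tripleProd_apply_snd_normal,
    hf.tripleProd_fst_apply_normal, eq_comm] at h

end IsFrame

/-! ### The signed distance function -/

theorem exists_openPartialHomeomorph_contDiffAt_symm {E F : Type*} [NormedAddCommGroup E]
    [NormedSpace ℝ E] [CompleteSpace E] [NormedAddCommGroup F] [NormedSpace ℝ F] {n : ℕ∞ω}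
    {G : E → F} (hG : ContDiff ℝ n G) (hn : 1 ≤ n) {a : E} {e' : E ≃L[ℝ] F}
    (he' : (e' : E →L[ℝ] F) = fderiv ℝ G a) :
    ∃ e : OpenPartialHomeomorph E F, a ∈ e.source ∧ ⇑e = G ∧
      ∀ p ∈ e.target, ContDiffAt ℝ n e.symm p := by
  have hn0 : n ≠ 0 := (zero_lt_one.trans_le hn).ne'
  have hderiv (x : E) : HasFDerivAt G (fderiv ℝ G x) x := (hG.differentiable hn0 x).hasFDerivAt
  have hGa : HasFDerivAt G (e' : E →L[ℝ] F) a := he' ▸ hderiv a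
  have isOpen_regular : IsOpen {x | fderiv ℝ G x ∈ range ((↑) : (E ≃L[ℝ] F) → (E →L[ℝ] F))} :=
    ContinuousLinearEquiv.isOpen.preimage (hG.continuous_fderiv hn0)
  refine ⟨(hG.contDiffAt.toOpenPartialHomeomorph G hGa hn0).restrOpen _ isOpen_regular,
    ⟨hG.contDiffAt.mem_toOpenPartialHomeomorph_source hGa hn0, e', he'⟩, rfl, fun p hp => ?_⟩
  obtain ⟨e'', he''⟩ := (OpenPartialHomeomorph.map_target _ hp).2
  exact OpenPartialHomeomorph.contDiffAt_symm _ hp (he'' ▸ hderiv _) hG.contDiffAt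

section LevelSet

variable {F : Type*} [NormedAddCommGroup F]

theorem mem_frontier_iff_of_eventually_mem_iff [NormedSpace ℝ F] {s : Set F} (hs : IsOpen s)
    {f : F → ℝ} {z : F} (hf : ContinuousAt f z) (hdf : fderiv ℝ f z ≠ 0)
    (hloc : ∀ᶠ y in 𝓝 z, (y ∈ s ↔ f y < 0)) : z ∈ frontier s ↔ f z = 0 := by
  rw [hs.frontier_eq]
  constructor
  · rintro ⟨hc, hn⟩
    refine (le_of_not_gt fun hpos => ?_).antisymm (not_lt.1 (mt hloc.self_of_nhds.2 hn))
    have : ∀ᶠ y in 𝓝 z, y ∉ s := by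
      filter_upwards [hf.eventually (lt_mem_nhds hpos), hloc] with y hy hy'
      exact fun h => (hy'.1 h).not_gt hy
    exact mem_closure_iff_frequently.1 hc this
  · refine fun h0 => ⟨?_, fun h => (hloc.self_of_nhds.1 h).ne h0⟩
    by_contra hc
    rw [mem_closure_iff_frequently, Filter.not_frequently] at hc
    refine hdf (IsLocalMin.fderiv_eq_zero ?_)
    filter_upwards [hc, hloc] with y hy hy'
    rwa [hy', not_lt, ← h0] at hy

variable [InnerProductSpace ℝ F] [CompleteSpace F] {f : F → ℝ} {x x₀ z : F}

theorem gradient_ne_zero_iff : gradient f x ≠ 0 ↔ fderiv ℝ f x ≠ 0 := by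
  simp [gradient]

theorem contDiffAt_gradient {m n : ℕ∞ω} (hf : ContDiffAt ℝ n f x) (hmn : m + 1 ≤ n) :
    ContDiffAt ℝ m (gradient f) x :=
  (InnerProductSpace.toDual ℝ F).symm.toContinuousLinearEquiv.contDiff.contDiffAt.comp x
    (hf.fderiv_right hmn)

theorem exists_sub_eq_smul_gradient_of_closest {s : Set F} (hf : ContDiffAt ℝ 1 f z)
    (hdf : fderiv ℝ f z ≠ 0) (hs : ∀ᶠ y in 𝓝 z, (y ∈ s ↔ f y = 0)) (hz : z ∈ s)
    (hmin : ∀ y ∈ s, dist x z ≤ dist x y) : ∃ l : ℝ, x - z = l • gradient f z := by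
  have hextr : IsLocalExtrOn (fun y => ‖x - y‖ ^ 2) {y | f y = f z} z := by
    left
    filter_upwards [nhdsWithin_le_nhds hs, self_mem_nhdsWithin] with y hy hyz
    have hys : y ∈ s := hy.2 (Eq.trans hyz (hs.self_of_nhds.1 hz))
    simpa only [dist_eq_norm] using pow_le_pow_left₀ dist_nonneg (hmin y hys) 2
  obtain ⟨a, b, hab, h⟩ := hextr.exists_multipliers_of_hasStrictFDerivAt_1d
    (hf.hasStrictFDerivAt one_ne_zero)
    ((hasStrictFDerivAt_norm_sq (x - z)).comp z ((hasStrictFDerivAt_id z).const_sub x))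
  have hgrad : a • gradient f z = (2 * b) • (x - z) := by
    refine ext_inner_right ℝ fun w => ?_
    have := congrArg (fun L => L w) h
    simp only [add_apply, smul_apply, ContinuousLinearMap.comp_apply, innerSL_apply_apply,
      neg_apply, ContinuousLinearMap.id_apply, inner_neg_right, smul_eq_mul,
      nsmul_eq_mul, zero_apply] at this
    rw [real_inner_smul_left, real_inner_smul_left, inner_gradient_left]
    push_cast at this
    linarith
  have hb : b ≠ 0 := by
    rintro rfl
    have ha : a ≠ 0 := by
      rintro rfl
      exact hab rfl
    rw [mul_zero, zero_smul, smul_eq_zero] at hgrad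
    exact hgrad.elim ha (gradient_ne_zero_iff.2 hdf)
  refine ⟨(2 * b)⁻¹ * a, ?_⟩
  rw [mul_smul, hgrad, inv_smul_smul₀ (mul_ne_zero two_ne_zero hb)]

theorem eventually_closest_eq_add_smul_gradient {s : Set F} (hf : ContDiff ℝ 1 f)
    (hdf : fderiv ℝ f x₀ ≠ 0) (hs : ∀ᶠ y in 𝓝 x₀, (y ∈ s ↔ f y = 0)) (hx₀ : x₀ ∈ s)
    {P : F × ℝ → Prop} (hP : ∀ᶠ q in 𝓝 (x₀, 0), P q) :
    ∀ᶠ x in 𝓝 x₀, ∀ y ∈ s, (∀ z ∈ s, dist x y ≤ dist x z) →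
      ∃ l : ℝ, x - y = l • gradient f y ∧ P (y, l) := by
  have hgx₀ : 0 < ‖gradient f x₀‖ := norm_pos_iff.2 (gradient_ne_zero_iff.2 hdf)
  have hgrad : ∀ᶠ y in 𝓝 x₀, ‖gradient f x₀‖ / 2 < ‖gradient f y‖ :=
    (contDiffAt_gradient (m := 0) hf.contDiffAt (by simp)).continuousAt.norm.eventually
      (lt_mem_nhds (half_lt_self hgx₀))
  rw [nhds_prod_eq] at hP
  obtain ⟨p, hp, p', hp', hpP⟩ := Filter.eventually_prod_iff.1 hP
  obtain ⟨r, hr, near⟩ := Metric.eventually_nhds_iff.1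
    (hgrad.and ((eventually_eventually_nhds.2 hs).and hp))
  obtain ⟨r', hr', small⟩ := Metric.eventually_nhds_iff.1 hp'
  filter_upwards [Metric.ball_mem_nhds x₀
    (lt_min (half_pos hr) (mul_pos hr' (half_pos hgx₀)))] with x hx y hy hmin
  obtain ⟨hx1, hx2⟩ := lt_min_iff.1 (Metric.mem_ball.1 hx)
  have hxy : dist x y ≤ dist x x₀ := hmin x₀ hx₀
  obtain ⟨hgy, hsy, hpy⟩ := near (y := y) (by linarith [dist_triangle_left y x₀ x])
  have hgy0 : 0 < ‖gradient f y‖ := (half_pos hgx₀).trans hgy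
  obtain ⟨l, hl⟩ := exists_sub_eq_smul_gradient_of_closest hf.contDiffAt
    (gradient_ne_zero_iff.1 (norm_pos_iff.1 hgy0)) hsy hy hmin
  refine ⟨l, hl, hpP hpy (small ?_)⟩
  rw [Real.dist_0_eq_abs]
  refine lt_of_mul_lt_mul_right ?_ (half_pos hgx₀).le
  calc |l| * (‖gradient f x₀‖ / 2) ≤ |l| * ‖gradient f y‖ := by gcongr
    _ = dist x y := by rw [dist_eq_norm, hl, norm_smul, Real.norm_eq_abs]
    _ < r' * (‖gradient f x₀‖ / 2) := hxy.trans_lt hx2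

theorem eventually_lt_of_move_along_gradient (hf : ContDiffAt ℝ 1 f x₀)
    (hdf : fderiv ℝ f x₀ ≠ 0) : ∀ᶠ q : F × ℝ in 𝓝 (x₀, 0),
      (0 < q.2 → f q.1 < f (q.1 + q.2 • gradient f q.1)) ∧
        (q.2 < 0 → f (q.1 + q.2 • gradient f q.1) < f q.1) := by
  set a := ‖gradient f x₀‖
  have ha : 0 < a := norm_pos_iff.2 (gradient_ne_zero_iff.2 hdf)
  have hg : ContinuousAt (fun q : F × ℝ => gradient f q.1) (x₀, 0) :=
    ContinuousAt.comp (g := gradient f)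
      (contDiffAt_gradient (m := 0) hf (by simp)).continuousAt continuousAt_fst
  have hmove : ContinuousAt (fun q : F × ℝ => (q.1 + q.2 • gradient f q.1, q.1)) (x₀, 0) :=
    (continuousAt_fst.add (continuousAt_snd.smul hg)).prodMk continuousAt_fst
  have hlin := (hf.hasStrictFDerivAt one_ne_zero).isLittleO.def (half_pos ha)
  have hinner : ∀ᶠ q : F × ℝ in 𝓝 (x₀, 0),
      a / 2 * ‖gradient f q.1‖ < ⟪gradient f x₀, gradient f q.1⟫ := by
    refine (hg.norm.const_mul (a / 2)).eventually_lt (continuousAt_const.inner hg) ?_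
    rw [real_inner_self_eq_norm_sq]
    change a / 2 * a < a ^ 2
    nlinarith
  filter_upwards [hmove.eventually (by simpa only [zero_smul, add_zero] using hlin), hinner]
    with q hq hinn
  rw [add_sub_cancel_left, map_smul, ← inner_gradient_left, norm_smul, smul_eq_mul,
    Real.norm_eq_abs, Real.norm_eq_abs, abs_le] at hq
  constructor <;> intro ht
  · rw [abs_of_pos ht] at hq
    nlinarith [hq.1]
  · rw [abs_of_neg ht] at hq
    nlinarith [hq.2]

/-- The coordinates `(y, t) ↦ (y + t ∇f(y), f(y))` around the zero set of `f`: a point over `0` in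
the last component has been moved from the zero set along the normal direction. -/
noncomputable def normalMap (f : F → ℝ) (q : F × ℝ) : F × ℝ := (q.1 + q.2 • gradient f q.1, f q.1)

theorem contDiff_normalMap (hf : ContDiff ℝ ∞ f) : ContDiff ℝ ∞ (normalMap f) := by
  have hg : ContDiff ℝ ∞ (gradient f) := contDiff_iff_contDiffAt.2 fun x =>
    contDiffAt_gradient hf.contDiffAt (by simp)
  unfold normalMap
  fun_prop

theorem fderiv_normalMap_apply (hf : ContDiff ℝ ∞ f) (x w : F) (t : ℝ) :
    fderiv ℝ (normalMap f) (x, 0) (w, t) = (w + t • gradient f x, fderiv ℝ f x w) := by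
  have hg : DifferentiableAt ℝ (gradient f) x :=
    (contDiffAt_gradient (m := 1) hf.contDiffAt (by norm_cast)).differentiableAt one_ne_zero
  have hg' : HasFDerivAt (fun q : F × ℝ => gradient f q.1) _ (x, (0 : ℝ)) :=
    HasFDerivAt.comp (g := gradient f) (x, (0 : ℝ)) hg.hasFDerivAt hasFDerivAt_fst
  have hf' : HasFDerivAt (fun q : F × ℝ => f q.1) _ (x, (0 : ℝ)) :=
    HasFDerivAt.comp (x, (0 : ℝ)) (hf.differentiable (by simp) x).hasFDerivAt hasFDerivAt_fst
  have hd : HasFDerivAt (normalMap f) _ (x, (0 : ℝ)) :=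
    (hasFDerivAt_fst.add (hasFDerivAt_snd.smul hg')).prodMk hf'
  rw [hd.fderiv]
  simp

theorem exists_equiv_fderiv_normalMap [FiniteDimensional ℝ F] (hf : ContDiff ℝ ∞ f)
    (hdf : fderiv ℝ f x ≠ 0) : ∃ e : (F × ℝ) ≃L[ℝ] (F × ℝ),
      (e : (F × ℝ) →L[ℝ] (F × ℝ)) = fderiv ℝ (normalMap f) (x, 0) := by
  have hinj : Function.Injective (fderiv ℝ (normalMap f) (x, 0)) := by
    rw [injective_iff_map_eq_zero]
    rintro ⟨w, t⟩ h
    rw [fderiv_normalMap_apply hf, Prod.mk_eq_zero, ← inner_gradient_left] at h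
    obtain ⟨hw, hinner⟩ := h
    rw [eq_neg_of_add_eq_zero_left hw, inner_neg_right, real_inner_smul_right, neg_eq_zero,
      mul_eq_zero, inner_self_eq_zero] at hinner
    have ht : t = 0 := hinner.resolve_right (gradient_ne_zero_iff.2 hdf)
    simpa [ht] using hw
  exact ⟨(LinearEquiv.ofInjectiveEndo (fderiv ℝ (normalMap f) (x, 0)).toLinearMap
    hinj).toContinuousLinearEquiv, rfl⟩

end LevelSet

theorem abs_sdist (Ω : Set E3) (x : E3) : |sdist Ω x| = Metric.infDist x (frontier Ω) := by
  unfold sdist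
  split_ifs <;> simp [abs_of_nonneg Metric.infDist_nonneg]

theorem BoundsSmoothSurface.isCompact_frontier {Ω : Set E3} (hΩ : BoundsSmoothSurface Ω) :
    IsCompact (frontier Ω) :=
  Metric.isCompact_of_isClosed_isBounded isClosed_frontier
    (hΩ.isBounded.closure.subset frontier_subset_closure)

theorem BoundsSmoothSurface.exists_closest {Ω : Set E3} (hΩ : BoundsSmoothSurface Ω) (x : E3) :
    ∃ y ∈ frontier Ω, dist x y = Metric.infDist x (frontier Ω) := by
  obtain ⟨y, hy, hxy⟩ := hΩ.isCompact_frontier.exists_infDist_eq_dist hΩ.isConnected.nonempty x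
  exact ⟨y, hy, hxy.symm⟩

theorem eventually_defining {Ω : Set E3} (hΩ : IsOpen Ω) {f : E3 → ℝ} (hf : ContDiff ℝ 1 f)
    {x₀ : E3} (hdf : fderiv ℝ f x₀ ≠ 0) (hloc : ∀ᶠ y in 𝓝 x₀, (y ∈ Ω ↔ f y < 0)) :
    ∀ᶠ y in 𝓝 x₀, (y ∈ frontier Ω ↔ f y = 0) := by
  filter_upwards [(hf.continuous_fderiv one_ne_zero).continuousAt.eventually_ne hdf,
    eventually_eventually_nhds.2 hloc] with y hy hloc'
  exact mem_frontier_iff_of_eventually_mem_iff hΩ hf.continuous.continuousAt hy hloc'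

/-- The inverse of `normalMap` recovers the closest point and the multiplier, hence the distance. -/
theorem eventually_sdist_eq {Ω : Set E3} (hΩ : BoundsSmoothSurface Ω) {f : E3 → ℝ}
    (hf : ContDiff ℝ 1 f) {x₀ : E3} (hx₀ : x₀ ∈ frontier Ω) (hdf : fderiv ℝ f x₀ ≠ 0)
    (hloc : ∀ᶠ y in 𝓝 x₀, (y ∈ Ω ↔ f y < 0)) {e : OpenPartialHomeomorph (E3 × ℝ) (E3 × ℝ)}
    (he : ⇑e = normalMap f) (hsrc : (x₀, (0 : ℝ)) ∈ e.source) :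
    ∀ᶠ x in 𝓝 x₀, sdist Ω x = (e.symm (x, 0)).2 * ‖gradient f (e.symm (x, 0)).1‖ := by
  have hfrontier := eventually_defining hΩ.isOpen hf hdf hloc
  have hclosest := eventually_closest_eq_add_smul_gradient hf hdf hfrontier hx₀
    (((continuousAt_fst (p := (x₀, (0 : ℝ)))).eventually hfrontier).and
      ((e.open_source.eventually_mem hsrc).and
        (eventually_lt_of_move_along_gradient hf.contDiffAt hdf)))
  filter_upwards [hclosest, hloc] with x hx hxΩ
  obtain ⟨y, hy, hxy⟩ := hΩ.exists_closest x
  obtain ⟨l, hl, hyf, hmem, hpos, hneg⟩ := hx y hy fun z hz =>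
    hxy.trans_le (Metric.infDist_le_dist_of_mem hz)
  have hfy : f y = 0 := hyf.1 hy
  have hsymm : e.symm (x, 0) = (y, l) := by
    rw [← e.left_inv hmem, he]
    simp [normalMap, hfy, ← hl]
  simp only [← hl, add_sub_cancel, hfy] at hpos hneg
  have hdist : Metric.infDist x (frontier Ω) = |l| * ‖gradient f y‖ := by
    rw [← hxy, dist_eq_norm, hl, norm_smul, Real.norm_eq_abs]
  rw [hsymm, sdist, hdist]
  split_ifs with hxo
  · rw [abs_of_nonpos (not_lt.1 fun h => (hpos h).not_gt (hxΩ.1 hxo)), neg_mul, neg_neg]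
  · rw [abs_of_nonneg (not_lt.1 fun h => hxo (hxΩ.2 (hneg h)))]

theorem eventually_contDiffAt_sdist {Ω : Set E3} (hΩ : BoundsSmoothSurface Ω) {x₀ : E3}
    (hx₀ : x₀ ∈ frontier Ω) : ∀ᶠ x in 𝓝 x₀, ContDiffAt ℝ ∞ (sdist Ω) x := by
  obtain ⟨f, hf, hdf, hloc⟩ := hΩ.smooth x₀ hx₀
  have hf1 : ContDiff ℝ 1 f := hf.of_le (by norm_cast)
  obtain ⟨e', he'⟩ := exists_equiv_fderiv_normalMap hf hdf
  obtain ⟨e, hsrc, he, hsymm⟩ := exists_openPartialHomeomorph_contDiffAt_symm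
    (contDiff_normalMap hf) (by norm_cast) he'
  have hfx₀ : f x₀ = 0 := (eventually_defining hΩ.isOpen hf1 hdf hloc).self_of_nhds.1 hx₀
  have hval : e (x₀, 0) = (x₀, 0) := by simp [he, normalMap, hfx₀]
  have htgt : (x₀, (0 : ℝ)) ∈ e.target := hval ▸ e.map_source hsrc
  have hsymm₀ : e.symm (x₀, 0) = (x₀, 0) := by simpa only [hval] using e.left_inv hsrc
  have hemb : ContinuousAt (fun x : E3 => (x, (0 : ℝ))) x₀ := by fun_prop
  have hgrad : ∀ᶠ x in 𝓝 x₀, gradient f (e.symm (x, 0)).1 ≠ 0 := by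
    have hg : ContinuousAt (gradient f) (e.symm (x₀, 0)).1 :=
      (contDiffAt_gradient (m := 0) hf1.contDiffAt (by simp)).continuousAt
    refine (ContinuousAt.comp (f := fun x => (e.symm (x, (0 : ℝ))).1) hg (continuousAt_fst.comp
      (ContinuousAt.comp (g := e.symm) (e.continuousAt_symm htgt) hemb))).eventually_ne ?_
    simpa only [Function.comp_apply, hsymm₀] using gradient_ne_zero_iff.2 hdf
  filter_upwards [hemb.eventually (e.open_target.mem_nhds htgt), hgrad,
    eventually_eventually_nhds.2 (eventually_sdist_eq hΩ hf1 hx₀ hdf hloc he hsrc)]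
    with x hx hgx hsdist
  have hinv : ContDiffAt ℝ ∞ (fun x : E3 => e.symm (x, (0 : ℝ))) x :=
    (hsymm _ hx).comp x (by fun_prop)
  have hnorm : ContDiffAt ℝ ∞ (fun x : E3 => ‖gradient f (e.symm (x, (0 : ℝ))).1‖) x :=
    ((contDiffAt_gradient hf.contDiffAt (by simp)).comp x hinv.fst).norm ℝ hgx
  exact (hinv.snd.mul hnorm).congr_of_eventuallyEq hsdist

/-! ### Tubular neighbourhoods -/

section Closest

variable {F : Type*} [NormedAddCommGroup F] [NormedSpace ℝ F] {s : Set F} {x y : F} {t : ℝ}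

theorem dist_add_smul_sub_self (x y : F) (ht : 0 ≤ t) :
    dist (y + t • (x - y)) y = t * dist x y := by
  rw [dist_eq_norm, dist_eq_norm, add_sub_cancel_left, norm_smul, Real.norm_of_nonneg ht]

theorem infDist_segment (hy : y ∈ s) (hxy : dist x y = Metric.infDist x s) (h0 : 0 ≤ t)
    (h1 : t ≤ 1) : Metric.infDist (y + t • (x - y)) s = t * Metric.infDist x s := by
  have hdist : dist x (y + t • (x - y)) = (1 - t) * dist x y := by
    have : x - (y + t • (x - y)) = (1 - t) • (x - y) := by module
    rw [dist_eq_norm, dist_eq_norm, this, norm_smul, Real.norm_of_nonneg (sub_nonneg.2 h1)]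
  have hle := Metric.infDist_le_dist_of_mem (x := y + t • (x - y)) hy
  have hge := Metric.infDist_le_infDist_add_dist (s := s) (x := x) (y := y + t • (x - y))
  rw [dist_add_smul_sub_self x y h0, hxy] at hle
  rw [hdist, hxy] at hge
  linarith

end Closest

section SignedDistance

variable {Ω : Set E3} {x y : E3} {t : ℝ}

theorem sdist_of_mem_frontier (hx : x ∈ frontier Ω) : sdist Ω x = 0 := by
  rw [← abs_eq_zero, abs_sdist, Metric.infDist_zero_of_mem hx]

theorem sdist_ne_zero (hne : (frontier Ω).Nonempty) (hx : x ∉ frontier Ω) : sdist Ω x ≠ 0 := by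
  rw [← abs_ne_zero, abs_sdist]
  exact ((isClosed_frontier.notMem_iff_infDist_pos hne).1 hx).ne'

theorem mem_iff_of_segment (hΩ : IsOpen Ω) (hx : x ∉ frontier Ω) (hy : y ∈ frontier Ω)
    (hxy : dist x y = Metric.infDist x (frontier Ω)) (h0 : 0 < t) (h1 : t ≤ 1) :
    y + t • (x - y) ∈ Ω ↔ x ∈ Ω := by
  have hpos : 0 < Metric.infDist x (frontier Ω) :=
    (isClosed_frontier.notMem_iff_infDist_pos ⟨y, hy⟩).1 hx
  set S : Set E3 := (fun s : ℝ => y + s • (x - y)) '' Icc t 1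
  have hpre : IsPreconnected S := isPreconnected_Icc.image _ (by fun_prop)
  have hxS : x ∈ S := ⟨1, ⟨h1, le_rfl⟩, by simp⟩
  have hzS : y + t • (x - y) ∈ S := ⟨t, ⟨le_rfl, h1⟩, rfl⟩
  have hclosure : closure Ω ∩ S ⊆ Ω := by
    rintro z ⟨hz, s, ⟨hts, hs1⟩, rfl⟩
    by_contra hcon
    have hzf : y + s • (x - y) ∈ frontier Ω := by
      rw [hΩ.frontier_eq]
      exact ⟨hz, hcon⟩
    have hdist := infDist_segment hy hxy (h0.le.trans hts) hs1
    rw [Metric.infDist_zero_of_mem hzf] at hdist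
    exact (mul_pos (h0.trans_le hts) hpos).ne hdist
  exact ⟨fun h => hpre.subset_of_closure_inter_subset hΩ ⟨_, hzS, h⟩ hclosure hxS,
    fun h => hpre.subset_of_closure_inter_subset hΩ ⟨_, hxS, h⟩ hclosure hzS⟩

theorem sdist_segment (hΩ : IsOpen Ω) (hx : x ∉ frontier Ω) (hy : y ∈ frontier Ω)
    (hxy : dist x y = Metric.infDist x (frontier Ω)) (h0 : 0 < t) (h1 : t ≤ 1) :
    sdist Ω (y + t • (x - y)) = t * sdist Ω x := by
  have hside := mem_iff_of_segment hΩ hx hy hxy h0 h1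
  unfold sdist
  rw [infDist_segment hy hxy h0.le h1]
  by_cases hxΩ : x ∈ Ω
  · rw [if_pos (hside.2 hxΩ), if_pos hxΩ, mul_neg]
  · rw [if_neg (mt hside.1 hxΩ), if_neg hxΩ]

theorem norm_nu_le (hΩ : IsOpen Ω) (hx : x ∉ frontier Ω) : ‖nu Ω x‖ ≤ 1 := by
  have hlip : ‖fderiv ℝ (fun z => Metric.infDist z (frontier Ω)) x‖ ≤ 1 :=
    norm_fderiv_le_of_lipschitz ℝ (Metric.lipschitz_infDist_pt _)
  rw [nu, gradient, LinearIsometryEquiv.norm_map]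
  by_cases hxΩ : x ∈ Ω
  · have : sdist Ω =ᶠ[𝓝 x] fun z => -Metric.infDist z (frontier Ω) := by
      filter_upwards [hΩ.mem_nhds hxΩ] with z hz
      rw [sdist, if_pos hz]
    rwa [this.fderiv_eq, fderiv_fun_neg, norm_neg]
  · have hxc : x ∉ closure Ω := fun h => hx (hΩ.frontier_eq ▸ ⟨h, hxΩ⟩)
    have : sdist Ω =ᶠ[𝓝 x] fun z => Metric.infDist z (frontier Ω) := by
      filter_upwards [isClosed_closure.isOpen_compl.mem_nhds hxc] with z hz
      rw [sdist, if_neg fun h => hz (subset_closure h)]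
    rwa [this.fderiv_eq]

theorem inner_nu_sub_of_closest (hΩ : IsOpen Ω) (hx : x ∉ frontier Ω) (hy : y ∈ frontier Ω)
    (hxy : dist x y = Metric.infDist x (frontier Ω)) (hd : DifferentiableAt ℝ (sdist Ω) x) :
    ⟪nu Ω x, x - y⟫ = sdist Ω x := by
  have hchain : HasDerivAt (fun t : ℝ => sdist Ω (y + t • (x - y))) ⟪nu Ω x, x - y⟫ 1 := by
    have hline : HasDerivAt (fun t : ℝ => y + t • (x - y)) (x - y) 1 := by
      simpa using ((hasDerivAt_id (1 : ℝ)).smul_const (x - y)).const_add y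
    have hd' : HasFDerivAt (sdist Ω) (fderiv ℝ (sdist Ω) x) (y + (1 : ℝ) • (x - y)) := by
      simpa using hd.hasFDerivAt
    rw [nu, inner_gradient_left]
    exact hd'.comp_hasDerivAt (1 : ℝ) hline
  have hlinear : HasDerivWithinAt (fun t : ℝ => sdist Ω (y + t • (x - y))) (sdist Ω x)
      (Iic 1) 1 := by
    have hmul : HasDerivWithinAt (fun t : ℝ => t * sdist Ω x) (sdist Ω x) (Iic 1) 1 := by
      simpa using ((hasDerivAt_id (1 : ℝ)).mul_const (sdist Ω x)).hasDerivWithinAt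
    refine hmul.congr_of_eventuallyEq ?_ (sdist_segment hΩ hx hy hxy one_pos le_rfl)
    filter_upwards [nhdsWithin_le_nhds (lt_mem_nhds one_pos), self_mem_nhdsWithin] with t h0 h1
    exact sdist_segment hΩ hx hy hxy h0 h1
  exact (uniqueDiffWithinAt_Iic (1 : ℝ)).eq_deriv _ hchain.hasDerivWithinAt hlinear

/-- Equality in Cauchy–Schwarz for `⟪∇d, x - y⟫ = d`, where `‖x - y‖ = |d|` and `‖∇d‖ ≤ 1`. -/
theorem sub_eq_sdist_smul_nu (hΩ : IsOpen Ω) (hx : x ∉ frontier Ω) (hy : y ∈ frontier Ω)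
    (hxy : dist x y = Metric.infDist x (frontier Ω)) (hd : DifferentiableAt ℝ (sdist Ω) x) :
    x - y = sdist Ω x • nu Ω x := by
  have hnorm : ‖x - y‖ ^ 2 = sdist Ω x ^ 2 := by
    rw [← dist_eq_norm, hxy, ← abs_sdist, sq_abs]
  have hnu : ‖nu Ω x‖ ^ 2 ≤ 1 := pow_le_one₀ (norm_nonneg _) (norm_nu_le hΩ hx)
  rw [← sub_eq_zero, ← norm_eq_zero, ← sq_eq_zero_iff]
  refine le_antisymm ?_ (sq_nonneg _)
  rw [norm_sub_sq_real, real_inner_smul_right, real_inner_comm,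
    inner_nu_sub_of_closest hΩ hx hy hxy hd, hnorm, norm_smul, Real.norm_eq_abs, mul_pow, sq_abs]
  nlinarith [mul_le_mul_of_nonneg_left hnu (sq_nonneg (sdist Ω x))]

theorem norm_nu_of_closest (hΩ : IsOpen Ω) (hx : x ∉ frontier Ω) (hy : y ∈ frontier Ω)
    (hxy : dist x y = Metric.infDist x (frontier Ω)) (hd : DifferentiableAt ℝ (sdist Ω) x) :
    ‖nu Ω x‖ = 1 := by
  have hd0 : |sdist Ω x| ≠ 0 := abs_ne_zero.2 (sdist_ne_zero ⟨y, hy⟩ hx)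
  refine mul_left_cancel₀ hd0 ?_
  rw [mul_one, ← Real.norm_eq_abs, ← norm_smul, ← sub_eq_sdist_smul_nu hΩ hx hy hxy hd,
    ← dist_eq_norm, hxy, Real.norm_eq_abs, abs_sdist]

theorem proj_of_mem_frontier (hx : x ∈ frontier Ω) : proj Ω x = x := by
  rw [proj, sdist_of_mem_frontier hx, zero_smul, sub_zero]

theorem eq_proj_of_closest (hΩ : IsOpen Ω) (hy : y ∈ frontier Ω)
    (hxy : dist x y = Metric.infDist x (frontier Ω)) (hd : DifferentiableAt ℝ (sdist Ω) x) :
    y = proj Ω x := by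
  by_cases hx : x ∈ frontier Ω
  · rw [Metric.infDist_zero_of_mem hx, dist_eq_zero] at hxy
    rw [proj_of_mem_frontier hx, hxy]
  · rw [proj, ← sub_eq_sdist_smul_nu hΩ hx hy hxy hd, sub_sub_cancel]

theorem nu_segment (hΩ : IsOpen Ω) (hx : x ∉ frontier Ω) (hy : y ∈ frontier Ω)
    (hxy : dist x y = Metric.infDist x (frontier Ω)) (hd : DifferentiableAt ℝ (sdist Ω) x)
    (h0 : 0 < t) (h1 : t ≤ 1) (hdt : DifferentiableAt ℝ (sdist Ω) (y + t • (x - y))) :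
    nu Ω (y + t • (x - y)) = nu Ω x := by
  have hdx : sdist Ω x ≠ 0 := sdist_ne_zero ⟨y, hy⟩ hx
  have hz := sdist_segment hΩ hx hy hxy h0 h1
  have hzf : y + t • (x - y) ∉ frontier Ω := fun h =>
    mul_ne_zero h0.ne' hdx (hz.symm.trans (sdist_of_mem_frontier h))
  have hzy : dist (y + t • (x - y)) y = Metric.infDist (y + t • (x - y)) (frontier Ω) := by
    rw [infDist_segment hy hxy h0.le h1, ← hxy, dist_add_smul_sub_self x y h0.le]
  have hsub := sub_eq_sdist_smul_nu hΩ hzf hy hzy hdt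
  rw [add_sub_cancel_left, hz, mul_smul] at hsub
  refine smul_right_injective _ hdx ?_
  change sdist Ω x • nu Ω (y + t • (x - y)) = sdist Ω x • nu Ω x
  rw [← smul_right_injective _ h0.ne' hsub, sub_eq_sdist_smul_nu hΩ hx hy hxy hd]

end SignedDistance

theorem inner_fderiv_gradient_comm {F : Type*} [NormedAddCommGroup F] [InnerProductSpace ℝ F]
    [CompleteSpace F] {f : F → ℝ} {x : F} (hf : ContDiffAt ℝ 2 f x) (a b : F) :
    ⟪fderiv ℝ (gradient f) x a, b⟫ = ⟪a, fderiv ℝ (gradient f) x b⟫ := by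
  have hg : HasFDerivAt (gradient f) (fderiv ℝ (gradient f) x) x :=
    ((contDiffAt_gradient (m := 1) hf (by norm_num)).differentiableAt one_ne_zero).hasFDerivAt
  have hdual : fderiv ℝ f = InnerProductSpace.toDual ℝ F ∘ gradient f := toDual_comp_gradient.symm
  have hhess (a b : F) : fderiv ℝ (fderiv ℝ f) x a b = ⟪fderiv ℝ (gradient f) x a, b⟫ := by
    have h := (InnerProductSpace.toDual ℝ F).toContinuousLinearEquiv.hasFDerivAt.comp x hg
    have h' : HasFDerivAt (fderiv ℝ f) _ x := hdual ▸ h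
    rw [h'.fderiv]
    rfl
  have hsymm : IsSymmSndFDerivAt ℝ f x :=
    hf.isSymmSndFDerivAt (minSmoothness_of_isRCLikeNormedField).le
  rw [← hhess, hsymm.eq a b, hhess, real_inner_comm]

theorem inner_fderiv_eq_zero_of_norm_eq_one {E F : Type*} [NormedAddCommGroup E] [NormedSpace ℝ E]
    [NormedAddCommGroup F] [InnerProductSpace ℝ F] {f : E → F} {x : E} (hf : DifferentiableAt ℝ f x)
    (hnorm : ∀ᶠ z in 𝓝 x, ‖f z‖ = 1) (w : E) : ⟪f x, fderiv ℝ f x w⟫ = 0 := by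
  have hconst : HasFDerivAt (fun z => ‖f z‖ ^ 2) (0 : E →L[ℝ] ℝ) x := by
    refine (hasFDerivAt_const (1 : ℝ) x).congr_of_eventuallyEq ?_
    filter_upwards [hnorm] with z hz
    rw [hz, one_pow]
  simpa using DFunLike.congr_fun (hf.hasFDerivAt.norm_sq.unique hconst) w

/-- An open neighbourhood of the surface `frontier Ω` on which the signed distance function is
smooth and satisfies the eikonal equation, the closest point projection is well defined and the
normal is constant along normal lines. -/
structure IsTubeNbhd (Ω N : Set E3) : Prop where
  isOpen : IsOpen N
  frontier_subset : frontier Ω ⊆ N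
  smooth : ∀ x ∈ N, ContDiffAt ℝ ∞ (sdist Ω) x
  norm_nu : ∀ x ∈ N, ‖nu Ω x‖ = 1
  proj_mem : ∀ x ∈ N, proj Ω x ∈ frontier Ω
  dist_proj : ∀ x ∈ N, dist x (proj Ω x) = Metric.infDist x (frontier Ω)
  unique : ∀ x ∈ N, ∀ y ∈ frontier Ω,
    dist x y = Metric.infDist x (frontier Ω) → y = proj Ω x
  nu_proj : ∀ x ∈ N, nu Ω (proj Ω x) = nu Ω x

namespace BoundsSmoothSurface

variable {Ω : Set E3} (hΩ : BoundsSmoothSurface Ω) {x y : E3}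
include hΩ

theorem norm_nu_of_isOpen {N : Set E3} (hN : IsOpen N)
    (hs : ∀ x ∈ N, ContDiffAt ℝ ∞ (sdist Ω) x) (hx : x ∈ N) : ‖nu Ω x‖ = 1 := by
  have hoff : ∀ z ∈ N, z ∉ frontier Ω → ‖nu Ω z‖ = 1 := fun z hz hzf => by
    obtain ⟨y, hy, hzy⟩ := hΩ.exists_closest z
    exact norm_nu_of_closest hΩ.isOpen hzf hy hzy ((hs z hz).differentiableAt (by simp))
  by_cases hxf : x ∈ frontier Ω
  · have hclosure : x ∈ closure (N ∩ Ω) := hN.inter_closure ⟨hx, frontier_subset_closure hxf⟩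
    have hfreq : ∃ᶠ z in 𝓝 x, ‖nu Ω z‖ = 1 :=
      (mem_closure_iff_frequently.1 hclosure).mono fun z hz => hoff z hz.1 fun hzf =>
        (hΩ.isOpen.frontier_eq ▸ hzf).2 hz.2
    have hcont : ContinuousAt (nu Ω) x :=
      (contDiffAt_gradient (m := ∞) (hs x hx) (by simp)).continuousAt
    exact not_not.1 fun hne => hfreq (hcont.norm.eventually_ne hne)
  · exact hoff x hx hxf

theorem nu_of_closest {δ : ℝ}
    (hs : ∀ z ∈ Metric.thickening δ (frontier Ω), ContDiffAt ℝ ∞ (sdist Ω) z)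
    (hx : x ∈ Metric.thickening δ (frontier Ω)) (hxf : x ∉ frontier Ω) (hy : y ∈ frontier Ω)
    (hxy : dist x y = Metric.infDist x (frontier Ω)) : nu Ω y = nu Ω x := by
  have hδ : Metric.infDist x (frontier Ω) < δ := (Metric.mem_thickening_iff_infDist_lt ⟨y, hy⟩).1 hx
  have hdiff : ∀ z ∈ Metric.thickening δ (frontier Ω), DifferentiableAt ℝ (sdist Ω) z :=
    fun z hz => (hs z hz).differentiableAt (by simp)
  have hcont : ContinuousAt (nu Ω) (y + (0 : ℝ) • (x - y)) := by
    rw [zero_smul, add_zero]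
    exact (contDiffAt_gradient (m := ∞) (hs y (Metric.self_subset_thickening
      (Metric.infDist_nonneg.trans_lt hδ) _ hy)) (by simp)).continuousAt
  have hlim : Filter.Tendsto (fun t : ℝ => nu Ω (y + t • (x - y))) (𝓝[>] 0) (𝓝 (nu Ω y)) := by
    have : ContinuousAt (fun t : ℝ => nu Ω (y + t • (x - y))) 0 :=
      ContinuousAt.comp (g := nu Ω) hcont (by fun_prop)
    simpa only [zero_smul, add_zero] using this.tendsto.mono_left nhdsWithin_le_nhds
  refine tendsto_nhds_unique hlim (tendsto_const_nhds.congr' ?_)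
  filter_upwards [Ioc_mem_nhdsGT one_pos] with t ⟨h0, h1⟩
  refine (nu_segment hΩ.isOpen hxf hy hxy (hdiff x hx) h0 h1 (hdiff _ ?_)).symm
  rw [Metric.mem_thickening_iff_infDist_lt ⟨y, hy⟩, infDist_segment hy hxy h0.le h1]
  exact (mul_le_of_le_one_left Metric.infDist_nonneg h1).trans_lt hδ

theorem isTubeNbhd_thickening {δ : ℝ} (hδ : 0 < δ)
    (hs : ∀ x ∈ Metric.thickening δ (frontier Ω), ContDiffAt ℝ ∞ (sdist Ω) x) :
    IsTubeNbhd Ω (Metric.thickening δ (frontier Ω)) := by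
  have hdiff : ∀ x ∈ Metric.thickening δ (frontier Ω), DifferentiableAt ℝ (sdist Ω) x :=
    fun x hx => (hs x hx).differentiableAt (by simp)
  have hproj : ∀ x ∈ Metric.thickening δ (frontier Ω), proj Ω x ∈ frontier Ω ∧
      dist x (proj Ω x) = Metric.infDist x (frontier Ω) := fun x hx => by
    obtain ⟨y, hy, hxy⟩ := hΩ.exists_closest x
    rw [← eq_proj_of_closest hΩ.isOpen hy hxy (hdiff x hx)]
    exact ⟨hy, hxy⟩
  refine ⟨Metric.isOpen_thickening, Metric.self_subset_thickening hδ _, hs,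
    fun x hx => hΩ.norm_nu_of_isOpen Metric.isOpen_thickening hs hx, fun x hx => (hproj x hx).1,
    fun x hx => (hproj x hx).2,
    fun x hx y hy hxy => eq_proj_of_closest hΩ.isOpen hy hxy (hdiff x hx), fun x hx => ?_⟩
  by_cases hxf : x ∈ frontier Ω
  · rw [proj_of_mem_frontier hxf]
  · exact hΩ.nu_of_closest hs hx hxf (hproj x hx).1 (hproj x hx).2

end BoundsSmoothSurface

namespace IsTubeNbhd

variable {Ω N : Set E3} (hN : IsTubeNbhd Ω N) {x : E3}
include hN

theorem isTubularWidth {δ : ℝ} (hδ : 0 < δ) (h : tube Ω δ ⊆ N) : IsTubularWidth Ω δ where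
  pos := hδ
  smooth x hx := hN.smooth x (h hx)
  proj_mem x hx := hN.proj_mem x (h hx)
  dist_proj x hx := hN.dist_proj x (h hx)
  unique x hx := hN.unique x (h hx)

theorem contDiffAt_nu (hx : x ∈ N) : ContDiffAt ℝ ∞ (nu Ω) x :=
  contDiffAt_gradient (hN.smooth x hx) (by simp)

theorem contDiffAt_proj (hx : x ∈ N) : ContDiffAt ℝ ∞ (proj Ω) x :=
  contDiffAt_id.sub ((hN.smooth x hx).smul (hN.contDiffAt_nu hx))

theorem contDiffAt_fderiv_nu (hx : x ∈ N) : ContDiffAt ℝ ∞ (fderiv ℝ (nu Ω)) x :=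
  (hN.contDiffAt_nu hx).fderiv_right (m := ∞) (by simp)

theorem contDiffAt_fderiv_proj (hx : x ∈ N) : ContDiffAt ℝ ∞ (fderiv ℝ (proj Ω)) x :=
  (hN.contDiffAt_proj hx).fderiv_right (m := ∞) (by simp)

theorem hasFDerivAt_nu (hx : x ∈ N) : HasFDerivAt (nu Ω) (fderiv ℝ (nu Ω) x) x :=
  ((hN.contDiffAt_nu hx).differentiableAt (by simp)).hasFDerivAt

theorem hasFDerivAt_sdist (hx : x ∈ N) : HasFDerivAt (sdist Ω) (innerSL ℝ (nu Ω x)) x := by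
  have hgrad : innerSL ℝ (nu Ω x) = fderiv ℝ (sdist Ω) x := by
    ext1 w
    rw [innerSL_apply_apply, nu, inner_gradient_left]
  rw [hgrad]
  exact ((hN.smooth x hx).differentiableAt (by simp)).hasFDerivAt

theorem inner_nu_fderiv_nu (hx : x ∈ N) (w : E3) : ⟪nu Ω x, fderiv ℝ (nu Ω) x w⟫ = 0 :=
  inner_fderiv_eq_zero_of_norm_eq_one (hN.hasFDerivAt_nu hx).differentiableAt
    (by filter_upwards [hN.isOpen.mem_nhds hx] with z hz using hN.norm_nu z hz) w

theorem inner_fderiv_nu_comm (hx : x ∈ N) (a b : E3) :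
    ⟪fderiv ℝ (nu Ω) x a, b⟫ = ⟪a, fderiv ℝ (nu Ω) x b⟫ :=
  inner_fderiv_gradient_comm ((hN.smooth x hx).of_le (by norm_cast)) a b

theorem fderiv_nu_nu (hx : x ∈ N) : fderiv ℝ (nu Ω) x (nu Ω x) = 0 :=
  ext_inner_right ℝ fun w => by
    rw [hN.inner_fderiv_nu_comm hx, hN.inner_nu_fderiv_nu hx, inner_zero_left]

theorem fderiv_proj_apply (hx : x ∈ N) (w : E3) : fderiv ℝ (proj Ω) x w =
    tangProj (nu Ω x) w - sdist Ω x • fderiv ℝ (nu Ω) x w := by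
  have h : HasFDerivAt (proj Ω) _ x :=
    (hasFDerivAt_id x).sub ((hN.hasFDerivAt_sdist hx).smul (hN.hasFDerivAt_nu hx))
  rw [h.fderiv, tangProj_apply]
  simp only [sub_apply, add_apply, smul_apply, ContinuousLinearMap.id_apply,
    ContinuousLinearMap.smulRight_apply, innerSL_apply_apply]
  abel

theorem inner_nu_fderiv_proj (hx : x ∈ N) (w : E3) : ⟪nu Ω x, fderiv ℝ (proj Ω) x w⟫ = 0 := by
  rw [hN.fderiv_proj_apply hx, inner_sub_right, inner_tangProj (hN.norm_nu x hx),
    real_inner_smul_right, hN.inner_nu_fderiv_nu hx, mul_zero, sub_zero]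

end IsTubeNbhd

/-- The endomorphism `I - d D²d`, which agrees with the differential of `proj` on tangential
vectors and fixes the normal. -/
noncomputable def shapeMap (Ω : Set E3) (x : E3) : Mat3 :=
  ContinuousLinearMap.id ℝ E3 - sdist Ω x • fderiv ℝ (nu Ω) x

theorem contDiff_det {n : ℕ∞ω} : ContDiff ℝ n (fun L : Mat3 => L.det) := by
  simp only [E3.det_eq, Matrix.det_fin_three, Matrix.of_apply]
  fun_prop

theorem IsTubeNbhd.contDiffAt_det_shapeMap {Ω N : Set E3} (hN : IsTubeNbhd Ω N) {x : E3}
    (hx : x ∈ N) : ContDiffAt ℝ ∞ (fun z => (shapeMap Ω z).det) x :=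
  contDiff_det.contDiffAt.comp x
    (contDiffAt_const.sub ((hN.smooth x hx).smul (hN.contDiffAt_fderiv_nu hx)))

theorem exists_isTubeNbhd {Ω : Set E3} (hΩ : BoundsSmoothSurface Ω) :
    ∃ N δ, IsTubeNbhd Ω N ∧ 0 < δ ∧ tube Ω δ ⊆ N ∧ ∀ x ∈ N, 1 / 2 < (shapeMap Ω x).det := by
  have hO : IsOpen {x | ∀ᶠ z in 𝓝 x, ContDiffAt ℝ ∞ (sdist Ω) z} :=
    isOpen_setOfPred_eventually_nhds
  obtain ⟨δ₀, hδ₀, hsub₀⟩ := hΩ.isCompact_frontier.exists_thickening_subset_open hO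
    fun x hx => eventually_contDiffAt_sdist hΩ hx
  have hN₀ := hΩ.isTubeNbhd_thickening hδ₀ fun x hx => (hsub₀ hx).self_of_nhds
  have hO' : IsOpen
      (Metric.thickening δ₀ (frontier Ω) ∩ (fun x => (shapeMap Ω x).det) ⁻¹' Ioi (1 / 2)) :=
    ContinuousOn.isOpen_inter_preimage
      (fun x hx => (hN₀.contDiffAt_det_shapeMap hx).continuousAt.continuousWithinAt)
      hN₀.isOpen isOpen_Ioi
  have hdet : ∀ x ∈ frontier Ω, (shapeMap Ω x).det = 1 := fun x hx => by
    have hid : shapeMap Ω x = ContinuousLinearMap.id ℝ E3 := by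
      ext1 w
      rw [shapeMap, sdist_of_mem_frontier hx, sub_apply, smul_apply, zero_smul, sub_zero]
    rw [hid]
    exact LinearMap.det_id
  obtain ⟨δ₁, hδ₁, hsub₁⟩ := hΩ.isCompact_frontier.exists_thickening_subset_open hO'
    fun x hx => ⟨hN₀.frontier_subset hx, by simp only [mem_preimage, mem_Ioi, hdet x hx]; norm_num⟩
  refine ⟨_, δ₁ / 2, hΩ.isTubeNbhd_thickening hδ₁ fun x hx => hN₀.smooth x (hsub₁ hx).1,
    half_pos hδ₁, fun x hx => ?_, fun x hx => (hsub₁ hx).2⟩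
  rw [Metric.mem_thickening_iff_infDist_lt hΩ.isConnected.nonempty]
  exact lt_of_le_of_lt hx (half_lt_self hδ₁)

theorem isCompact_tube {Ω : Set E3} (hΩ : BoundsSmoothSurface Ω) (δ : ℝ) :
    IsCompact (tube Ω δ) := by
  refine Metric.isCompact_of_isClosed_isBounded
    (isClosed_le (Metric.continuous_infDist_pt _) continuous_const) ?_
  refine (hΩ.isCompact_frontier.isBounded.thickening (δ := δ + 1)).subset fun x hx => ?_
  rw [Metric.mem_thickening_iff_infDist_lt hΩ.isConnected.nonempty]
  exact lt_of_le_of_lt hx (lt_add_one _)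

/-! ### The area formula on planes -/

section HausdorffMeasure

variable {X Y Z : Type*} [MetricSpace Y] [MeasurableSpace Y] [BorelSpace Y] [MetricSpace Z]
  [MeasurableSpace Z] [BorelSpace Z] {f : X → Y} {g : X → Z} {s : Set X}

theorem euclideanHausdorffMeasure_image_le_of_dist_le {K : NNReal} (d : ℕ)
    (h : ∀ x ∈ s, ∀ y ∈ s, dist (f x) (f y) ≤ K * dist (g x) (g y)) :
    μHE[d] (f '' s) ≤ (K : ENNReal) ^ d * μHE[d] (g '' s) := by
  rcases s.eq_empty_or_nonempty with rfl | hne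
  · simp
  have : Nonempty X := hne.nonempty
  have hlip : LipschitzOnWith K (f ∘ Function.invFunOn g s) (g '' s) :=
    LipschitzOnWith.of_dist_le_mul fun a ha b hb => by
      have := h _ (Function.invFunOn_mem ha) _ (Function.invFunOn_mem hb)
      rwa [Function.invFunOn_eq ha, Function.invFunOn_eq hb] at this
  have himage : f '' s = (f ∘ Function.invFunOn g s) '' (g '' s) := by
    refine Subset.antisymm ?_ ?_
    · rintro _ ⟨x, hx, rfl⟩
      have hgx : g x ∈ g '' s := mem_image_of_mem g hx
      refine ⟨g x, hgx, dist_le_zero.1 ?_⟩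
      have := h _ (Function.invFunOn_mem hgx) x hx
      rwa [Function.invFunOn_eq hgx, dist_self, mul_zero] at this
    · rintro _ ⟨z, hz, rfl⟩
      exact mem_image_of_mem f (Function.invFunOn_mem hz)
  have hmeas := hlip.hausdorffMeasure_image_le (d := d) d.cast_nonneg
  rw [← himage, ENNReal.rpow_natCast] at hmeas
  simp_rw [Measure.euclideanHausdorffMeasure_def, Measure.smul_apply, ENNReal.smul_def,
    smul_eq_mul]
  rw [mul_left_comm]
  gcongr

end HausdorffMeasure

section LinearApproximation

variable {U V : Type*} [NormedAddCommGroup U] [NormedSpace ℝ U] [NormedAddCommGroup V]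
  [NormedSpace ℝ V]

theorem exists_approximatesLinearOn_dist_le [FiniteDimensional ℝ U] {A : U →L[ℝ] V}
    (hA : Function.Injective A) {K : NNReal} (hK : 1 < K) :
    ∃ r : NNReal, 0 < r ∧ ∀ (g : U → V) (s : Set U), ApproximatesLinearOn g A s r →
      ∀ x ∈ s, ∀ y ∈ s, dist (g x) (g y) ≤ K * dist (A x) (A y) ∧
        dist (A x) (A y) ≤ K * dist (g x) (g y) := by
  obtain ⟨c, hc, hanti⟩ := A.toLinearMap.exists_antilipschitzWith (LinearMap.ker_eq_bot.2 hA)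
  have hK0 : 0 < K := one_pos.trans hK
  have hlt : K⁻¹ < 1 := inv_lt_one_of_one_lt₀ hK
  refine ⟨(1 - K⁻¹) / c, div_pos (tsub_pos_of_lt hlt) hc, fun g s hg x hx y hy => ?_⟩
  have hle : ‖x - y‖ ≤ c * ‖A (x - y)‖ := by
    simpa [dist_eq_norm] using hanti.le_mul_dist (x - y) 0
  have happrox : ‖g x - g y - A (x - y)‖ ≤ (1 - (K : ℝ)⁻¹) * ‖A (x - y)‖ := by
    have hc' : (c : ℝ) ≠ 0 := by exact_mod_cast hc.ne'
    have h := hg x hx y hy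
    rw [NNReal.coe_div, NNReal.coe_sub hlt.le, NNReal.coe_one, NNReal.coe_inv] at h
    have hr : 0 ≤ (1 - (K : ℝ)⁻¹) / c :=
      div_nonneg (sub_nonneg.2 (by exact_mod_cast hlt.le)) c.coe_nonneg
    calc _ ≤ (1 - (K : ℝ)⁻¹) / c * (c * ‖A (x - y)‖) := h.trans (by gcongr)
      _ = _ := by field_simp
  have hKK : (K : ℝ) * (K : ℝ)⁻¹ = 1 := mul_inv_cancel₀ (by exact_mod_cast hK0.ne')
  have hKinv : 2 - (K : ℝ)⁻¹ ≤ K := by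
    nlinarith [sq_nonneg ((K : ℝ) - 1), inv_nonneg.2 K.coe_nonneg, NNReal.coe_le_coe.2 hK.le]
  rw [dist_eq_norm, dist_eq_norm, ← map_sub]
  constructor
  · have := norm_le_norm_add_norm_sub' (g x - g y) (A (x - y))
    nlinarith [norm_nonneg (A (x - y))]
  · have := norm_le_norm_add_norm_sub (g x - g y) (A (x - y))
    calc ‖A (x - y)‖ = K * ((K : ℝ)⁻¹ * ‖A (x - y)‖) := by rw [← mul_assoc, hKK, one_mul]
      _ ≤ _ := by gcongr; linarith

end LinearApproximation

section AreaFormula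

open Module

variable {U V : Type*} [NormedAddCommGroup U] [InnerProductSpace ℝ U] [FiniteDimensional ℝ U]
  [MeasurableSpace U] [BorelSpace U] [NormedAddCommGroup V] [InnerProductSpace ℝ V]
  [MeasurableSpace V] [BorelSpace V] {f : U → V} {f' : U → U →L[ℝ] V} {s : Set U}

omit [MeasurableSpace U] [BorelSpace U] [MeasurableSpace V] [BorelSpace V] in
theorem ofReal_normDet_le_of_norm_le {L A : U →L[ℝ] V} {K : NNReal}
    (h : ∀ u, ‖L u‖ ≤ K * ‖A u‖) : ENNReal.ofReal L.toLinearMap.normDet ≤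
      (K : ENNReal) ^ finrank ℝ U * ENNReal.ofReal A.toLinearMap.normDet := by
  borelize U V
  have himage := euclideanHausdorffMeasure_image_le_of_dist_le (f := L.toLinearMap)
    (g := A.toLinearMap) (s := Metric.closedBall 0 1) (finrank ℝ U) fun x _ y _ => by
      rw [dist_eq_norm, dist_eq_norm, ← map_sub, ← map_sub]
      exact h (x - y)
  rw [LinearMap.euclideanHausdorffMeasure_image_eq_normDet_mul_volume,
    LinearMap.euclideanHausdorffMeasure_image_eq_normDet_mul_volume, ← mul_assoc] at himage
  exact (ENNReal.mul_le_mul_iff_left (Metric.measure_closedBall_pos volume 0 one_pos).ne'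
    measure_closedBall_lt_top.ne).1 himage

omit [MeasurableSpace U] [BorelSpace U] [MeasurableSpace V] [BorelSpace V] in
theorem exists_isOpen_almost_isometric {x₀ : U} (hx₀ : x₀ ∈ s)
    (hf : ∀ x ∈ s, HasStrictFDerivAt f (f' x) x) (hinj : Function.Injective (f' x₀)) {K : NNReal}
    (hK : 1 < K) : ∃ W, IsOpen W ∧ x₀ ∈ W ∧
      (∀ x ∈ W, ∀ y ∈ W, dist (f x) (f y) ≤ K * dist (f' x₀ x) (f' x₀ y) ∧
        dist (f' x₀ x) (f' x₀ y) ≤ K * dist (f x) (f y)) ∧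
      ∀ x ∈ s ∩ W, ∀ u, ‖f' x u‖ ≤ K * ‖f' x₀ u‖ ∧ ‖f' x₀ u‖ ≤ K * ‖f' x u‖ := by
  obtain ⟨r, hr, hKr⟩ := exists_approximatesLinearOn_dist_le hinj hK
  obtain ⟨W₀, hW₀, happrox₀⟩ := (hf x₀ hx₀).approximates_deriv_on_nhds (c := r) (Or.inr hr)
  obtain ⟨W, hWW₀, hW, hxW⟩ := mem_nhds_iff.1 hW₀
  have happrox := happrox₀.mono_set hWW₀
  refine ⟨W, hW, hxW, hKr f W happrox, fun x hx u => ?_⟩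
  have hnorm : ‖f' x - f' x₀‖ ≤ r :=
    ((hf x hx.1).hasFDerivAt.sub (f' x₀).hasFDerivAt).le_of_lipschitzOn (hW.mem_nhds hx.2)
      (lipschitzOnWith_iff_restrict.2 happrox.lipschitz_sub)
  have hlin : ApproximatesLinearOn (f' x) (f' x₀) univ r := fun a _ b _ => by
    rw [← map_sub, ← sub_apply]
    exact (f' x - f' x₀).le_of_opNorm_le hnorm _
  simpa [dist_eq_norm] using hKr _ _ hlin u (mem_univ _) 0 (mem_univ _)

theorem exists_isOpen_area_estimate {x₀ : U} (hx₀ : x₀ ∈ s)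
    (hf : ∀ x ∈ s, HasStrictFDerivAt f (f' x) x) (hinj : Function.Injective (f' x₀)) {K : NNReal}
    (hK : 1 < K) : ∃ W, IsOpen W ∧ x₀ ∈ W ∧ ∀ B ⊆ s ∩ W, MeasurableSet B →
      μHE[finrank ℝ U] (f '' B) ≤ ((K : ENNReal) ^ finrank ℝ U) ^ 2 *
        ∫⁻ x in B, ENNReal.ofReal (f' x).toLinearMap.normDet ∧
      ∫⁻ x in B, ENNReal.ofReal (f' x).toLinearMap.normDet ≤
        ((K : ENNReal) ^ finrank ℝ U) ^ 2 * μHE[finrank ℝ U] (f '' B) := by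
  obtain ⟨W, hW, hxW, hdist, hderiv⟩ := exists_isOpen_almost_isometric hx₀ hf hinj hK
  have himage (B : Set U) :
      ∫⁻ _ in B, ENNReal.ofReal (f' x₀).toLinearMap.normDet = μHE[finrank ℝ U] (f' x₀ '' B) := by
    rw [setLIntegral_const]
    exact ((f' x₀).toLinearMap.euclideanHausdorffMeasure_image_eq_normDet_mul_volume B).symm
  have hfin : (K : ENNReal) ^ finrank ℝ U ≠ ⊤ := ENNReal.pow_ne_top ENNReal.coe_ne_top
  refine ⟨W, hW, hxW, fun B hB hBm => ⟨?_, ?_⟩⟩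
  · calc μHE[finrank ℝ U] (f '' B)
        ≤ (K : ENNReal) ^ finrank ℝ U * μHE[finrank ℝ U] (f' x₀ '' B) :=
          euclideanHausdorffMeasure_image_le_of_dist_le _ fun x hx y hy =>
            (hdist x (hB hx).2 y (hB hy).2).1
      _ ≤ (K : ENNReal) ^ finrank ℝ U * ((K : ENNReal) ^ finrank ℝ U *
            ∫⁻ x in B, ENNReal.ofReal (f' x).toLinearMap.normDet) := by
          gcongr
          rw [← himage, ← lintegral_const_mul' _ _ hfin]
          exact setLIntegral_mono' hBm fun x hx =>
            ofReal_normDet_le_of_norm_le fun u => (hderiv x (hB hx) u).2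
      _ = _ := by ring
  · calc ∫⁻ x in B, ENNReal.ofReal (f' x).toLinearMap.normDet
        ≤ (K : ENNReal) ^ finrank ℝ U * μHE[finrank ℝ U] (f' x₀ '' B) := by
          rw [← himage, ← lintegral_const_mul' _ _ hfin]
          exact setLIntegral_mono' hBm fun x hx =>
            ofReal_normDet_le_of_norm_le fun u => (hderiv x (hB hx) u).1
      _ ≤ (K : ENNReal) ^ finrank ℝ U *
            ((K : ENNReal) ^ finrank ℝ U * μHE[finrank ℝ U] (f '' B)) := by
          gcongr
          exact euclideanHausdorffMeasure_image_le_of_dist_le _ fun x hx y hy =>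
            (hdist x (hB hx).2 y (hB hy).2).2
      _ = _ := by ring

theorem exists_measurable_partition_of_local {X : Type*} [TopologicalSpace X]
    [SecondCountableTopology X] [MeasurableSpace X] [OpensMeasurableSpace X] {s : Set X}
    (hs : MeasurableSet s) (hne : s.Nonempty) {p : Set X → Prop}
    (h : ∀ x ∈ s, ∃ W, IsOpen W ∧ x ∈ W ∧ ∀ B ⊆ s ∩ W, MeasurableSet B → p B) :
    ∃ t : ℕ → Set X, Pairwise (Function.onFun Disjoint t) ∧ (∀ k, MeasurableSet (t k)) ∧
      s = ⋃ k, t k ∧ ∀ k, p (t k) := by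
  choose! W hWo hxW hW using h
  obtain ⟨c, hcs, hc, hcover⟩ := TopologicalSpace.countable_cover_nhdsWithin
    (f := W) fun x hx => mem_nhdsWithin_of_mem_nhds ((hWo x hx).mem_nhds (hxW x hx))
  have hcne : c.Nonempty := by
    obtain ⟨x, hx⟩ := hne
    obtain ⟨y, hy, -⟩ := mem_iUnion₂.1 (hcover hx)
    exact ⟨y, hy⟩
  obtain ⟨x, rfl⟩ := hc.exists_eq_range hcne
  have hxs : ∀ k, x k ∈ s := fun k => hcs ⟨k, rfl⟩
  have hmeas : ∀ k, MeasurableSet (s ∩ disjointed (fun k => W (x k)) k) := fun k =>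
    hs.inter (MeasurableSet.disjointed (fun k => (hWo _ (hxs k)).measurableSet) k)
  refine ⟨fun k => s ∩ disjointed (fun k => W (x k)) k, fun i j hij =>
    (disjoint_disjointed _ hij).mono inter_subset_right inter_subset_right, hmeas, ?_,
    fun k => hW _ (hxs k) _ (inter_subset_inter_right _ (disjointed_subset _ _)) (hmeas k)⟩
  rw [← inter_iUnion, iUnion_disjointed, eq_comm, inter_eq_left]
  simpa only [biUnion_range] using hcover

theorem area_estimate (hs : MeasurableSet s) (hf : ∀ x ∈ s, HasStrictFDerivAt f (f' x) x)
    (hf' : ∀ x ∈ s, Function.Injective (f' x)) (hinj : InjOn f s) {K : NNReal} (hK : 1 < K) :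
    μHE[finrank ℝ U] (f '' s) ≤ ((K : ENNReal) ^ finrank ℝ U) ^ 2 *
        ∫⁻ x in s, ENNReal.ofReal (f' x).toLinearMap.normDet ∧
      ∫⁻ x in s, ENNReal.ofReal (f' x).toLinearMap.normDet ≤
        ((K : ENNReal) ^ finrank ℝ U) ^ 2 * μHE[finrank ℝ U] (f '' s) := by
  rcases s.eq_empty_or_nonempty with rfl | hne
  · simp
  obtain ⟨t, hdisj, hmeas, hunion, ht⟩ := exists_measurable_partition_of_local hs hne
    fun x hx => exists_isOpen_area_estimate hx hf (hf' x hx) hK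
  have hts : ∀ k, t k ⊆ s := fun k => hunion ▸ subset_iUnion t k
  have hcont : ContinuousOn f s := fun x hx => (hf x hx).continuousAt.continuousWithinAt
  have hlintegral : ∫⁻ x in s, ENNReal.ofReal (f' x).toLinearMap.normDet =
      ∑' k, ∫⁻ x in t k, ENNReal.ofReal (f' x).toLinearMap.normDet := by
    rw [hunion, lintegral_iUnion hmeas hdisj]
  have himage : μHE[finrank ℝ U] (f '' s) = ∑' k, μHE[finrank ℝ U] (f '' t k) := by
    rw [hunion, image_iUnion]
    exact measure_iUnion (fun i j hij => disjoint_image_image fun x hx y hy =>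
        (hinj.ne_iff (hts i hx) (hts j hy)).2 ((hdisj hij).ne_of_mem hx hy))
      fun k => (hmeas k).image_of_continuousOn_injOn (hcont.mono (hts k)) (hinj.mono (hts k))
  rw [hlintegral, himage, ← ENNReal.tsum_mul_left, ← ENNReal.tsum_mul_left]
  exact ⟨ENNReal.tsum_le_tsum fun k => (ht k).1, ENNReal.tsum_le_tsum fun k => (ht k).2⟩

theorem le_of_forall_one_lt_le_pow_mul {a b : ENNReal} {n : ℕ}
    (h : ∀ K : NNReal, 1 < K → a ≤ (K : ENNReal) ^ n * b) : a ≤ b := by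
  have hpow : Filter.Tendsto (fun K : NNReal => (K : ENNReal) ^ n) (𝓝[>] 1) (𝓝 1) := by
    have hcont : Continuous fun K : NNReal => (K : ENNReal) ^ n := by fun_prop
    simpa using (hcont.tendsto 1).mono_left nhdsWithin_le_nhds
  have hlim : Filter.Tendsto (fun K : NNReal => (K : ENNReal) ^ n * b) (𝓝[>] 1) (𝓝 b) := by
    simpa using ENNReal.Tendsto.mul_const hpow (Or.inl one_ne_zero)
  exact ge_of_tendsto hlim (Filter.eventually_of_mem self_mem_nhdsWithin h)

theorem euclideanHausdorffMeasure_image_eq_lintegral_normDet (hs : MeasurableSet s)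
    (hf : ∀ x ∈ s, HasStrictFDerivAt f (f' x) x) (hf' : ∀ x ∈ s, Function.Injective (f' x))
    (hinj : InjOn f s) : μHE[finrank ℝ U] (f '' s) =
      ∫⁻ x in s, ENNReal.ofReal (f' x).toLinearMap.normDet := by
  refine le_antisymm ?_ ?_ <;>
    refine le_of_forall_one_lt_le_pow_mul (n := finrank ℝ U * 2) fun K hK => ?_ <;> rw [pow_mul]
  · exact (area_estimate hs hf hf' hinj hK).1
  · exact (area_estimate hs hf hf' hinj hK).2

end AreaFormula

/-! ### Weak derivatives -/

section CompactSupport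

variable {X E F G : Type*} [NormedAddCommGroup E] [NormedSpace ℝ E] [NormedAddCommGroup F]
  [NormedSpace ℝ F] [NormedAddCommGroup G] [NormedSpace ℝ G]

theorem integrable_bilin_of_hasCompactSupport_left [TopologicalSpace X]
    [SecondCountableTopology X] [MeasurableSpace X] [OpensMeasurableSpace X] {μ : Measure X}
    (B : E →L[ℝ] F →L[ℝ] G) {f : X → E} {g : X → F} (hf : Continuous f)
    (hfs : HasCompactSupport f) (hg : Integrable g μ) : Integrable (fun x => B (f x) (g x)) μ := by
  obtain ⟨K, hK⟩ := hf.bounded_above_of_compact_support hfs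
  exact B.integrable_of_bilin_of_bdd_left K hf.aestronglyMeasurable (.of_forall hK) hg

theorem integrable_apply_of_hasCompactSupport [TopologicalSpace X]
    [SecondCountableTopology X] [MeasurableSpace X] [OpensMeasurableSpace X] {μ : Measure X}
    {L : X → F →L[ℝ] G} {f : X → F} (hL : Integrable L μ) (hf : Continuous f)
    (hfs : HasCompactSupport f) : Integrable (fun x => L x (f x)) μ :=
  integrable_bilin_of_hasCompactSupport_left (.flip (.id ℝ (F →L[ℝ] G))) hf hfs hL

theorem contDiff_smul_of_tsupport {n : ℕ∞ω} {g : E → ℝ} {f : E → F} (hg : ContDiff ℝ n g)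
    (hf : ∀ x ∈ tsupport g, ContDiffAt ℝ n f x) : ContDiff ℝ n (fun x => g x • f x) := by
  refine contDiff_iff_contDiffAt.2 fun x => ?_
  by_cases hx : x ∈ tsupport g
  · exact hg.contDiffAt.smul (hf x hx)
  · refine contDiffAt_const.congr_of_eventuallyEq (f := fun _ => (0 : F)) ?_
    filter_upwards [notMem_tsupport_iff_eventuallyEq.1 hx] with z hz
    simp only [hz, Pi.zero_apply, zero_smul]

end CompactSupport

section MatrixMultipliers

variable {X F H : Type*} [NormedAddCommGroup X] [NormedSpace ℝ X] [SecondCountableTopology X]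
  [MeasurableSpace X] [OpensMeasurableSpace X] [NormedAddCommGroup F] [NormedSpace ℝ F]
  [NormedAddCommGroup H] [NormedSpace ℝ H] {μ : Measure X}
  {s : X → ℝ} {ψ : X → X} {v : X → F} {A : X → X →L[ℝ] F} {G : X → F →L[ℝ] H}

omit [NormedSpace ℝ X] in
theorem integrable_mul_smul (hs : Continuous s) (hss : HasCompactSupport s) (hv : Integrable v μ)
    (hG : Continuous G) : Integrable (fun x => s x • G x (v x)) μ :=
  integrable_bilin_of_hasCompactSupport_left (.id ℝ (F →L[ℝ] H)) (f := fun x => s x • G x)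
    (hs.smul hG) hss.smul_right hv

theorem integrable_fderiv_apply_apply (hψ : Continuous ψ) (hψs : HasCompactSupport ψ)
    (hv : Integrable v μ) (hG : ContDiff ℝ 1 G) :
    Integrable (fun x => fderiv ℝ G x (ψ x) (v x)) μ := by
  refine integrable_bilin_of_hasCompactSupport_left (.id ℝ (F →L[ℝ] H))
    (f := fun x => fderiv ℝ G x (ψ x)) ((hG.continuous_fderiv one_ne_zero).clm_apply hψ) ?_ hv
  exact hψs.mono' fun x hx => subset_tsupport _ fun h0 => hx (by simp only [h0, map_zero])

theorem integrable_apply_apply (hψ : Continuous ψ) (hψs : HasCompactSupport ψ)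
    (hA : Integrable A μ) (hG : Continuous G) : Integrable (fun x => G x (A x (ψ x))) μ := by
  refine integrable_bilin_of_hasCompactSupport_left (.id ℝ ((X →L[ℝ] F) →L[ℝ] H))
    (f := fun x => G x ∘L ContinuousLinearMap.apply ℝ F (ψ x))
    (hG.clm_comp ((ContinuousLinearMap.apply ℝ F).continuous.comp hψ)) ?_ hA
  exact hψs.mono' fun x hx => subset_tsupport _ fun h0 => hx (by
    simp only [h0, map_zero, ContinuousLinearMap.comp_zero])

theorem integrable_leibniz_smul (hs : Continuous s) (hss : HasCompactSupport s)
    (hψ : Continuous ψ) (hψs : HasCompactSupport ψ) (hv : Integrable v μ) {g : X → ℝ}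
    (hg : ContDiff ℝ 1 g) : Integrable (fun x => (g x * s x + fderiv ℝ g x (ψ x)) • v x) μ := by
  refine integrable_bilin_of_hasCompactSupport_left (.lsmul ℝ ℝ)
    (f := fun x => g x * s x + fderiv ℝ g x (ψ x))
    ((hg.continuous.mul hs).add ((hg.continuous_fderiv one_ne_zero).clm_apply hψ))
    (hss.mul_left.add ?_) hv
  exact hψs.mono' fun x hx => subset_tsupport _ fun h0 => hx (by simp only [h0, map_zero])

/-- The formula is linear in the multiplier, and a matrix multiplier is a combination of constant
matrices with scalar coefficients. -/
theorem integral_by_parts_matrix_mul [FiniteDimensional ℝ F] [FiniteDimensional ℝ H]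
    (hs : Continuous s) (hss : HasCompactSupport s) (hψ : Continuous ψ)
    (hψs : HasCompactSupport ψ) (hv : Integrable v μ) (hA : Integrable A μ) {n : ℕ∞ω}
    (hn : 1 ≤ n) (hG : ContDiff ℝ n G) (h : ∀ g : X → ℝ, ContDiff ℝ n g →
      ∫ x, (g x * s x + fderiv ℝ g x (ψ x)) • v x ∂μ = -∫ x, g x • A x (ψ x) ∂μ) :
    ∫ x, (s x • G x (v x) + fderiv ℝ G x (ψ x) (v x)) ∂μ = -∫ x, G x (A x (ψ x)) ∂μ := by
  let b := Module.finBasis ℝ (F →L[ℝ] H)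
  let l := fun k => LinearMap.toContinuousLinearMap (b.coord k)
  have hl : ∀ L : F →L[ℝ] H, ∑ k, l k L • b k = L := b.sum_repr
  have hg : ∀ k, ContDiff ℝ n fun x => l k (G x) := fun k => (l k).contDiff.comp hG
  have hgd : ∀ k x, fderiv ℝ (fun x => l k (G x)) x (ψ x) = l k (fderiv ℝ G x (ψ x)) :=
    fun k x => DFunLike.congr_fun ((l k).hasFDerivAt.comp x
      (hG.differentiable (one_pos.trans_le hn).ne' x).hasFDerivAt).fderiv (ψ x)
  have hvint : ∀ k, Integrable (fun x => (l k (G x) * s x + l k (fderiv ℝ G x (ψ x))) • v x) μ :=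
    fun k => by
      simpa only [hgd] using integrable_leibniz_smul hs hss hψ hψs hv ((hg k).of_le hn)
  have hAint : ∀ k, Integrable (fun x => l k (G x) • A x (ψ x)) μ := fun k => by
    simpa only [map_smul] using integrable_apply_of_hasCompactSupport hA
      (f := fun x => l k (G x) • ψ x) ((hg k).continuous.smul hψ) hψs.smul_left
  have hleft : ∀ x, s x • G x (v x) + fderiv ℝ G x (ψ x) (v x) =
      ∑ k, b k ((l k (G x) * s x + l k (fderiv ℝ G x (ψ x))) • v x) := fun x => by
    conv_lhs => rw [← hl (G x), ← hl (fderiv ℝ G x (ψ x))]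
    simp only [sum_apply, smul_apply, Finset.smul_sum, ← Finset.sum_add_distrib, map_smul]
    exact Finset.sum_congr rfl fun k _ => by module
  have hright : ∀ x, G x (A x (ψ x)) = ∑ k, b k (l k (G x) • A x (ψ x)) := fun x => by
    conv_lhs => rw [← hl (G x)]
    simp only [sum_apply, smul_apply, map_smul]
  simp_rw [hleft, hright]
  rw [integral_finsetSum _ fun k _ => (b k).integrable_comp (hvint k),
    integral_finsetSum _ fun k _ => (b k).integrable_comp (hAint k), ← Finset.sum_neg_distrib]
  refine Finset.sum_congr rfl fun k _ => ?_
  have hk := h _ (hg k)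
  simp only [hgd] at hk
  rw [(b k).integral_comp_comm (hvint k), (b k).integral_comp_comm (hAint k), hk, map_neg]

end MatrixMultipliers

section SurfaceDivergence

theorem surfDiv_smul {n : E3 → E3} {g : E3 → ℝ} {ψ : E3 → E3} {x : E3} (hn : ‖n x‖ = 1)
    (hg : DifferentiableAt ℝ g x) (hψ : DifferentiableAt ℝ ψ x) (hx : ⟪n x, ψ x⟫ = 0) :
    surfDiv n (fun z => g z • ψ z) x = g x * surfDiv n ψ x + fderiv ℝ g x (ψ x) := by
  obtain ⟨e₁, e₂, hf⟩ := exists_isFrame hn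
  simp only [surfDiv, covGrad]
  rw [hf.trace_tangential, hf.trace_tangential, fderiv_fun_smul hg hψ]
  conv_rhs => rw [hf.eq_sum_inner_smul (ψ x), hx]
  simp only [add_apply, smul_apply, ContinuousLinearMap.smulRight_apply, inner_add_right,
    real_inner_smul_right, zero_smul, add_zero, map_add, map_smul, smul_eq_mul]
  ring

/-- The surface divergence of a field on the plane with unit normal `m`, as a linear function of
the Jacobian. -/
noncomputable def planeDiv (m : E3) : Mat3 →ₗ[ℝ] ℝ where
  toFun L := LinearMap.trace ℝ E3 (tangProj m ∘L L ∘L tangProj m).toLinearMap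
  map_add' L L' := by
    rw [ContinuousLinearMap.add_comp, ContinuousLinearMap.comp_add]
    exact map_add _ _ _
  map_smul' r L := by
    rw [ContinuousLinearMap.smul_comp, ContinuousLinearMap.comp_smul]
    exact map_smul _ _ _

theorem continuous_surfDiv_const (m : E3) {ψ : E3 → E3} (hψ : ContDiff ℝ 1 ψ) :
    Continuous (surfDiv (fun _ => m) ψ) :=
  (planeDiv m).continuous_of_finiteDimensional.comp (hψ.continuous_fderiv one_ne_zero)

theorem hasCompactSupport_surfDiv_const (m : E3) {ψ : E3 → E3} (hψ : HasCompactSupport ψ) :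
    HasCompactSupport (surfDiv (fun _ => m) ψ) :=
  (hψ.fderiv ℝ).comp_left (g := planeDiv m) (map_zero _)

end SurfaceDivergence

section TestFields

variable {S W : Set E3} {n : E3 → E3}

theorem contDiffAt_tangProj {k : ℕ∞ω} {x : E3} (hn : ContDiffAt ℝ k n x) (w : E3) :
    ContDiffAt ℝ k (fun z => tangProj (n z) w) x := by
  simp only [tangProj_apply]
  exact contDiffAt_const.sub ((hn.inner ℝ contDiffAt_const).smul hn)

theorem IsTestField.smul {ψ : E3 → E3} (hψ : IsTestField S n ψ) {g : E3 → ℝ}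
    (hg : ContDiff ℝ ∞ g) : IsTestField S n (fun x => g x • ψ x) where
  smooth := hg.smul hψ.smooth
  compact := HasCompactSupport.smul_left (f := g) hψ.compact
  support _ hx := hψ.support ⟨tsupport_smul_subset_right g ψ hx.1, hx.2⟩
  tangential x hx := by rw [real_inner_smul_left, hψ.tangential x hx, mul_zero]

theorem isTestField_smul_tangProj (hWS : W ∩ closure S ⊆ S) (hn : ∀ x ∈ W, ContDiffAt ℝ ∞ n x)
    (hn1 : ∀ x ∈ S, ‖n x‖ = 1) {g : E3 → ℝ} (hg : ContDiff ℝ ∞ g) (hgs : HasCompactSupport g)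
    (hgW : tsupport g ⊆ W) (e : E3) : IsTestField S n (fun x => g x • tangProj (n x) e) where
  smooth := contDiff_smul_of_tsupport hg fun x hx => contDiffAt_tangProj (hn x (hgW hx)) e
  compact := hgs.smul_right
  support x hx := hWS ⟨hgW (tsupport_smul_subset_left _ _ hx.1), hx.2⟩
  tangential x hx := by
    rw [real_inner_smul_left, real_inner_comm, inner_tangProj (hn1 x hx), mul_zero]

variable {F : Type*} [NormedAddCommGroup F] [NormedSpace ℝ F] {D : E3 → E3 →L[ℝ] F}

theorem integrable_apply_tangProj (hSm : MeasurableSet S) (hn : ContinuousOn n S)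
    (hn1 : ∀ x ∈ S, ‖n x‖ = 1) (hD : Integrable D (μHE[2].restrict S)) (e : E3) :
    Integrable (fun x => D x (tangProj (n x) e)) (μHE[2].restrict S) := by
  have hcont : ContinuousOn (fun x => tangProj (n x) e) S := by
    simp only [tangProj_apply]
    exact continuousOn_const.sub ((hn.inner (𝕜 := ℝ) continuousOn_const).smul hn)
  have hmeas := hcont.aestronglyMeasurable (μ := μHE[2]) hSm
  refine (ContinuousLinearMap.id ℝ (E3 →L[ℝ] F)).integrable_of_bilin_of_bdd_right ‖e‖ hD hmeas ?_
  filter_upwards [ae_restrict_mem hSm] with x hx using norm_tangProj_apply_le (hn1 x hx) e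

theorem ae_eq_zero_of_integral_testField_eq_zero [CompleteSpace F] (hSm : MeasurableSet S)
    (hW : IsOpen W) (hSW : S ⊆ W) (hWS : W ∩ closure S ⊆ S) (hn : ∀ x ∈ W, ContDiffAt ℝ ∞ n x)
    (hn1 : ∀ x ∈ S, ‖n x‖ = 1) (hD : Integrable D (μHE[2].restrict S))
    (hDn : ∀ᵐ x ∂(μHE[2].restrict S), D x (n x) = 0)
    (h : ∀ φ : E3 → E3, IsTestField S n φ → ∫ x in S, D x (φ x) ∂μHE[2] = 0) :
    ∀ᵐ x ∂(μHE[2].restrict S), D x = 0 := by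
  have hcont : ContinuousOn n S := fun x hx =>
    (hn x (hSW hx)).continuousAt.continuousWithinAt
  have htang : ∀ e : E3, ∀ᵐ x ∂(μHE[2].restrict S), D x (tangProj (n x) e) = 0 := by
    intro e
    have hzero := hW.ae_eq_zero_of_integral_contDiff_smul_eq_zero
      ((integrable_apply_tangProj hSm hcont hn1 hD e).locallyIntegrable.locallyIntegrableOn W)
      fun g hg hgs hgW => by
        simpa only [map_smul] using h _ (isTestField_smul_tangProj hWS hn hn1 hg hgs hgW e)
    filter_upwards [hzero, ae_restrict_mem hSm] with x hx hxS using hx (hSW hxS)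
  let b := EuclideanSpace.basisFun (Fin 3) ℝ
  filter_upwards [ae_all_iff.2 fun i => htang (b i), hDn] with x hx hxn
  refine ContinuousLinearMap.coe_injective (b.toBasis.ext fun i => ?_)
  simpa [tangProj_apply, hxn] using hx i

end TestFields

namespace IsH1Tangential

variable {S W : Set E3} {n v : E3 → E3} {A B : E3 → Mat3}

theorem integrable (h : IsH1Tangential S n v A) (hfin : μHE[2] S ≠ ⊤) :
    Integrable v (μHE[2].restrict S) :=
  have : IsFiniteMeasure (μHE[2].restrict S : Measure E3) := ⟨by simpa using hfin.lt_top⟩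
  h.memLp.integrable (by norm_num)

theorem integrable_grad (h : IsH1Tangential S n v A) (hfin : μHE[2] S ≠ ⊤) :
    Integrable A (μHE[2].restrict S) :=
  have : IsFiniteMeasure (μHE[2].restrict S : Measure E3) := ⟨by simpa using hfin.lt_top⟩
  h.memLp_grad.integrable (by norm_num)

theorem grad_unique (hA : IsH1Tangential S n v A) (hB : IsH1Tangential S n v B)
    (hfin : μHE[2] S ≠ ⊤) (hSm : MeasurableSet S) (hW : IsOpen W) (hSW : S ⊆ W)
    (hWS : W ∩ closure S ⊆ S) (hn : ∀ x ∈ W, ContDiffAt ℝ ∞ n x) (hn1 : ∀ x ∈ S, ‖n x‖ = 1) :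
    ∀ᵐ x ∂(μHE[2].restrict S), A x = B x := by
  have hAi := hA.integrable_grad hfin
  have hBi := hB.integrable_grad hfin
  have hzero := ae_eq_zero_of_integral_testField_eq_zero hSm hW hSW hWS hn hn1
    (D := fun x => A x - B x) (hAi.sub hBi)
    (by filter_upwards [hA.grad_normal, hB.grad_normal] with x hAx hBx
        rw [sub_apply, hAx, hBx, sub_zero])
    (fun φ hφ => by
      simp only [sub_apply]
      rw [integral_sub (integrable_apply_of_hasCompactSupport hAi hφ.smooth.continuous hφ.compact)
          (integrable_apply_of_hasCompactSupport hBi hφ.smooth.continuous hφ.compact),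
        sub_eq_zero, ← neg_inj, ← hA.weak φ hφ, ← hB.weak φ hφ])
  filter_upwards [hzero] with x hx using sub_eq_zero.1 hx

section ConstantNormal

variable {m : E3} (hm : ‖m‖ = 1) (hA : IsH1Tangential S (fun _ => m) v A) (hfin : μHE[2] S ≠ ⊤)
  (hSm : MeasurableSet S)
include hA hfin

theorem integral_inner_normal_grad {φ : E3 → E3} (hφ : IsTestField S (fun _ => m) φ) :
    ∫ x in S, (innerSL ℝ m ∘L A x) (φ x) ∂μHE[2] = 0 := by
  have hdiv : Integrable (fun x => surfDiv (fun _ => m) φ x • v x) (μHE[2].restrict S) :=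
    integrable_bilin_of_hasCompactSupport_left (.lsmul ℝ ℝ)
      (continuous_surfDiv_const m (hφ.smooth.of_le (by simp)))
      (hasCompactSupport_surfDiv_const m hφ.compact) (hA.integrable hfin)
  have hgrad := integrable_apply_of_hasCompactSupport (hA.integrable_grad hfin)
    hφ.smooth.continuous hφ.compact
  simp only [ContinuousLinearMap.comp_apply]
  rw [(innerSL ℝ m).integral_comp_comm hgrad, ← neg_inj, ← map_neg, ← hA.weak φ hφ,
    ← (innerSL ℝ m).integral_comp_comm hdiv, neg_zero]
  refine integral_eq_zero_of_ae ?_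
  filter_upwards [hA.tangential] with x hx
  rw [map_smul, innerSL_apply_apply, real_inner_comm, hx, smul_zero, Pi.zero_apply]

include hm hSm

theorem covGrad_ae_eq (hW : IsOpen W) (hSW : S ⊆ W) (hWS : W ∩ closure S ⊆ S) :
    ∀ᵐ x ∂(μHE[2].restrict S), covGrad (fun _ => m) A x = A x := by
  have hzero := ae_eq_zero_of_integral_testField_eq_zero hSm hW hSW hWS (n := fun _ => m)
    (fun x _ => contDiffAt_const) (fun x _ => hm) (D := fun x => innerSL ℝ m ∘L A x)
    (((ContinuousLinearMap.compL ℝ E3 E3 ℝ) (innerSL ℝ m)).integrable_comp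
      (hA.integrable_grad hfin))
    (by filter_upwards [hA.grad_normal] with x hx
        rw [ContinuousLinearMap.comp_apply, hx, map_zero])
    fun φ hφ => hA.integral_inner_normal_grad hfin hφ
  filter_upwards [hzero, hA.grad_normal] with x hx hxn
  have hrange : ∀ z, ⟪m, A x z⟫ = 0 := fun z => DFunLike.congr_fun hx z
  ext1 w
  rw [covGrad, ContinuousLinearMap.comp_apply, ContinuousLinearMap.comp_apply,
    tangProj_of_inner_eq_zero (hrange _), tangProj_apply, map_sub, map_smul, hxn, smul_zero,
    sub_zero]

omit hfin in
theorem weak_scalar_mul {ψ : E3 → E3} (hψ : IsTestField S (fun _ => m) ψ) {g : E3 → ℝ}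
    (hg : ContDiff ℝ ∞ g) :
    ∫ x in S, (g x * surfDiv (fun _ => m) ψ x + fderiv ℝ g x (ψ x)) • v x ∂μHE[2] =
      -∫ x in S, g x • A x (ψ x) ∂μHE[2] := by
  have hdiv : ∀ x ∈ S, surfDiv (fun _ => m) (fun z => g z • ψ z) x =
      g x * surfDiv (fun _ => m) ψ x + fderiv ℝ g x (ψ x) := fun x hx =>
    surfDiv_smul hm (hg.differentiable (by simp) x) (hψ.smooth.differentiable (by simp) x)
      (by rw [real_inner_comm]; exact hψ.tangential x hx)
  have hweak := hA.weak _ (hψ.smul hg)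
  simp only [map_smul] at hweak
  rw [← hweak]
  exact setIntegral_congr_fun hSm fun x hx => congrArg (· • v x) (hdiv x hx).symm

theorem weak_matrix_mul {ψ : E3 → E3} (hψ : IsTestField S (fun _ => m) ψ) {G : E3 → Mat3}
    (hG : ContDiff ℝ ∞ G) : ∫ x in S, surfDiv (fun _ => m) ψ x • G x (v x) ∂μHE[2] =
      -∫ x in S, (G x (A x (ψ x)) + fderiv ℝ G x (ψ x) (v x)) ∂μHE[2] := by
  have hAi := hA.integrable_grad hfin
  have hvi := hA.integrable hfin
  have hψc := hψ.smooth.continuous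
  have hsc := continuous_surfDiv_const m (hψ.smooth.of_le (by simp))
  have hss := hasCompactSupport_surfDiv_const m hψ.compact
  have hmatrix := integral_by_parts_matrix_mul hsc hss hψc hψ.compact hvi hAi (by simp) hG
    fun g hg => weak_scalar_mul hm hA hSm hψ hg
  have hderiv := integrable_fderiv_apply_apply hψc hψ.compact hvi (hG.of_le (by simp))
  rw [integral_add (integrable_mul_smul hsc hss hvi hG.continuous) hderiv] at hmatrix
  rw [integral_add (integrable_apply_apply hψc hψ.compact hAi hG.continuous) hderiv, neg_add,
    ← hmatrix]
  abel

end ConstantNormal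

end IsH1Tangential

/-! ### The area element and the Piola matrix -/

/-- `n` is a smooth field of unit normals along the map `Φ`: it is orthogonal to the image of every
differential of `Φ` on `N`. -/
structure IsUnitNormalAlong (Φ n : E3 → E3) (N : Set E3) : Prop where
  isOpen : IsOpen N
  contDiffAt_map : ∀ x ∈ N, ContDiffAt ℝ ∞ Φ x
  contDiffAt_normal : ∀ x ∈ N, ContDiffAt ℝ ∞ n x
  norm_normal : ∀ x ∈ N, ‖n x‖ = 1
  inner_fderiv : ∀ x ∈ N, ∀ w, ⟪n x, fderiv ℝ Φ x w⟫ = 0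

/-- The oriented area element of the restriction of `Φ` to planes with orthonormal basis `e₁, e₂`,
where `n` is a unit normal field along `Φ`. -/
noncomputable def areaElement (Φ n : E3 → E3) (e₁ e₂ x : E3) : ℝ :=
  tripleProd (fderiv ℝ Φ x e₁) (fderiv ℝ Φ x e₂) (n x)

/-- The transposed cofactor matrix of `DΦ`, considered as a map from the plane spanned by `e₁, e₂`
to the plane orthogonal to `n`. -/
noncomputable def cofactorMap (Φ n : E3 → E3) (e₁ e₂ x : E3) : Mat3 :=
  (innerSL ℝ (crossProd (fderiv ℝ Φ x e₂) (n x))).smulRight e₁ +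
    (innerSL ℝ (crossProd (n x) (fderiv ℝ Φ x e₁))).smulRight e₂

/-- The inverse of `DΦ` as a map from the plane spanned by `e₁, e₂` to the plane orthogonal to `n`,
extended by zero in the direction `n`. -/
noncomputable def tangentInv (Φ n : E3 → E3) (e₁ e₂ x : E3) : Mat3 :=
  (areaElement Φ n e₁ e₂ x)⁻¹ • cofactorMap Φ n e₁ e₂ x

/-- The matrix `μ⁻¹ DΦ` of the Piola transform, with the area element for the area ratio `μ`. -/
noncomputable def piolaMat (Φ n : E3 → E3) (e₁ e₂ x : E3) : Mat3 :=
  (areaElement Φ n e₁ e₂ x)⁻¹ • fderiv ℝ Φ x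

/-- The Jacobian of the Piola transform of `v`, pulled back to the plane spanned by `e₁, e₂`, in
terms of the Jacobian `A` of `v`. -/
noncomputable def piolaGrad (Φ n : E3 → E3) (e₁ e₂ : E3) (v : E3 → E3) (A : E3 → Mat3) (x : E3) :
    Mat3 :=
  (fderiv ℝ (piolaMat Φ n e₁ e₂) x).flip (v x) ∘L tangentInv Φ n e₁ e₂ x +
    piolaMat Φ n e₁ e₂ x ∘L A x ∘L tangentInv Φ n e₁ e₂ x

theorem cofactorMap_apply (Φ n : E3 → E3) (e₁ e₂ x w : E3) : cofactorMap Φ n e₁ e₂ x w =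
    tripleProd w (fderiv ℝ Φ x e₂) (n x) • e₁ + tripleProd (fderiv ℝ Φ x e₁) w (n x) • e₂ := by
  rw [tripleProd_rotate (fderiv ℝ Φ x e₁) w, ← inner_crossProd_left, ← inner_crossProd_left]
  rfl

theorem piolaGrad_apply (Φ n : E3 → E3) (e₁ e₂ : E3) (v : E3 → E3) (A : E3 → Mat3) (x w : E3) :
    piolaGrad Φ n e₁ e₂ v A x w =
      fderiv ℝ (piolaMat Φ n e₁ e₂) x (tangentInv Φ n e₁ e₂ x w) (v x) +
        piolaMat Φ n e₁ e₂ x (A x (tangentInv Φ n e₁ e₂ x w)) := rfl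

theorem tangentInv_normal (Φ n : E3 → E3) (e₁ e₂ x : E3) :
    tangentInv Φ n e₁ e₂ x (n x) = 0 := by
  rw [tangentInv, smul_apply, cofactorMap_apply, tripleProd_self_outer, tripleProd_self_right,
    zero_smul, zero_smul, add_zero, smul_zero]

section TripleProduct

variable {f g h : E3 → E3} {f' g' h' : Mat3} {x : E3}

theorem differentiableAt_tripleProd (hf : DifferentiableAt ℝ f x) (hg : DifferentiableAt ℝ g x)
    (hh : DifferentiableAt ℝ h x) : DifferentiableAt ℝ (fun z => tripleProd (f z) (g z) (h z)) x :=
  ((crossProdL.differentiableAt.comp x hf).clm_apply hg).inner ℝ hh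

theorem contDiffAt_tripleProd {k : ℕ∞ω} (hf : ContDiffAt ℝ k f x) (hg : ContDiffAt ℝ k g x)
    (hh : ContDiffAt ℝ k h x) : ContDiffAt ℝ k (fun z => tripleProd (f z) (g z) (h z)) x :=
  ((crossProdL.contDiff.contDiffAt.comp x hf).clm_apply hg).inner ℝ hh

theorem fderiv_tripleProd_apply (hf : HasFDerivAt f f' x) (hg : HasFDerivAt g g' x)
    (hh : HasFDerivAt h h' x) (w : E3) :
    fderiv ℝ (fun z => tripleProd (f z) (g z) (h z)) x w =
      tripleProd (f' w) (g x) (h x) + tripleProd (f x) (g' w) (h x) +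
        tripleProd (f x) (g x) (h' w) := by
  have hfg : HasFDerivAt (fun z => crossProdL (f z) (g z)) _ x :=
    (crossProdL.hasFDerivAt.comp x hf).clm_apply hg
  have hfgh : HasFDerivAt (fun z => tripleProd (f z) (g z) (h z)) _ x := hfg.inner ℝ hh
  rw [hfgh.fderiv]
  simp only [tripleProd, crossProdL_apply, ContinuousLinearMap.comp_apply,
    ContinuousLinearMap.prod_apply, fderivInnerCLM_apply, add_apply, inner_add_left,
    ContinuousLinearMap.flip_apply, Function.comp_apply]
  ring

end TripleProduct

theorem hasFDerivAt_fderiv_apply {E F : Type*} [NormedAddCommGroup E] [NormedSpace ℝ E]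
    [NormedAddCommGroup F] [NormedSpace ℝ F] {f : E → F} {x : E}
    (hf : DifferentiableAt ℝ (fderiv ℝ f) x) (e : E) :
    HasFDerivAt (fun z => fderiv ℝ f z e) ((fderiv ℝ (fderiv ℝ f) x).flip e) x :=
  (ContinuousLinearMap.apply ℝ F e).hasFDerivAt.comp x hf.hasFDerivAt

theorem IsFrame.surfDiv_smul_add_smul {e₁ e₂ m : E3} (hf : IsFrame e₁ e₂ m) {a b : E3 → ℝ} {x : E3}
    (ha : DifferentiableAt ℝ a x) (hb : DifferentiableAt ℝ b x) :
    surfDiv (fun _ => m) (fun z => a z • e₁ + b z • e₂) x = fderiv ℝ a x e₁ + fderiv ℝ b x e₂ := by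
  rw [surfDiv, covGrad, hf.trace_tangential,
    ((ha.hasFDerivAt.smul_const e₁).fun_add (hb.hasFDerivAt.smul_const e₂)).fderiv]
  simp only [add_apply, ContinuousLinearMap.smulRight_apply, inner_add_right,
    real_inner_smul_right, real_inner_self_eq_norm_sq, hf.norm_fst, hf.norm_snd, hf.inner_fst_snd,
    real_inner_comm e₁ e₂]
  ring

namespace IsUnitNormalAlong

variable {Φ n : E3 → E3} {N : Set E3} (h : IsUnitNormalAlong Φ n N) {x : E3} {e₁ e₂ m : E3}
include h

theorem contDiffAt_fderiv (hx : x ∈ N) : ContDiffAt ℝ ∞ (fderiv ℝ Φ) x :=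
  (h.contDiffAt_map x hx).fderiv_right (m := ∞) (by simp)

theorem contDiffAt_fderiv_apply (hx : x ∈ N) (w : E3) :
    ContDiffAt ℝ ∞ (fun z => fderiv ℝ Φ z w) x :=
  (h.contDiffAt_fderiv hx).clm_apply contDiffAt_const

theorem hasFDerivAt_map (hx : x ∈ N) : HasFDerivAt Φ (fderiv ℝ Φ x) x :=
  ((h.contDiffAt_map x hx).differentiableAt (by simp)).hasFDerivAt

theorem contDiffAt_areaElement (hx : x ∈ N) : ContDiffAt ℝ ∞ (areaElement Φ n e₁ e₂) x :=
  contDiffAt_tripleProd (h.contDiffAt_fderiv_apply hx _) (h.contDiffAt_fderiv_apply hx _)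
    (h.contDiffAt_normal x hx)

theorem contDiffAt_cofactorMap (hx : x ∈ N) : ContDiffAt ℝ ∞ (cofactorMap Φ n e₁ e₂) x := by
  have hcross : ∀ {f g : E3 → E3}, ContDiffAt ℝ ∞ f x → ContDiffAt ℝ ∞ g x → ∀ e : E3,
      ContDiffAt ℝ ∞ (fun z => (innerSL ℝ (crossProd (f z) (g z))).smulRight e) x := by
    intro f g hf hg e
    have hfg : ContDiffAt ℝ ∞ (fun z => crossProdL (f z) (g z)) x :=
      (crossProdL.contDiff.contDiffAt.comp x hf).clm_apply hg
    exact ContDiffAt.smulRight ((innerSL ℝ).contDiff.contDiffAt.comp x hfg) contDiffAt_const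
  exact (hcross (h.contDiffAt_fderiv_apply hx _) (h.contDiffAt_normal x hx) _).add
    (hcross (h.contDiffAt_normal x hx) (h.contDiffAt_fderiv_apply hx _) _)

theorem contDiffAt_piolaMat (hx : x ∈ N) (h0 : areaElement Φ n e₁ e₂ x ≠ 0) :
    ContDiffAt ℝ ∞ (piolaMat Φ n e₁ e₂) x :=
  ((h.contDiffAt_areaElement hx).inv h0).smul (h.contDiffAt_fderiv hx)

theorem contDiffAt_tangentInv (hx : x ∈ N) (h0 : areaElement Φ n e₁ e₂ x ≠ 0) :
    ContDiffAt ℝ ∞ (tangentInv Φ n e₁ e₂) x :=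
  ((h.contDiffAt_areaElement hx).inv h0).smul (h.contDiffAt_cofactorMap hx)

theorem inner_normal_fderiv_normal (hx : x ∈ N) (w : E3) : ⟪n x, fderiv ℝ n x w⟫ = 0 :=
  inner_fderiv_eq_zero_of_norm_eq_one ((h.contDiffAt_normal x hx).differentiableAt (by simp))
    (by filter_upwards [h.isOpen.mem_nhds hx] with z hz using h.norm_normal z hz) w

theorem fderiv_fderiv_comm (hx : x ∈ N) (v w : E3) :
    fderiv ℝ (fderiv ℝ Φ) x v w = fderiv ℝ (fderiv ℝ Φ) x w v :=
  ((h.contDiffAt_map x hx).isSymmSndFDerivAt (by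
    rw [minSmoothness_of_isRCLikeNormedField]
    exact WithTop.coe_le_coe.2 (le_top : (2 : ℕ∞) ≤ ⊤))).eq v w

/-- The Piola identity. The second derivatives of `Φ` cancel by symmetry, and the derivatives of
`n` do not contribute because they are tangential. -/
theorem surfDiv_cofactorMap (hf : IsFrame e₁ e₂ m) (hx : x ∈ N) {φ ν : E3 → E3}
    (hφ : DifferentiableAt ℝ φ (Φ x)) (hν : ν (Φ x) = n x) (hφn : ⟪n x, φ (Φ x)⟫ = 0) :
    surfDiv (fun _ => m) (fun z => cofactorMap Φ n e₁ e₂ z (φ (Φ z))) x =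
      areaElement Φ n e₁ e₂ x * surfDiv ν φ (Φ x) := by
  have hD : ∀ e, HasFDerivAt (fun z => fderiv ℝ Φ z e) ((fderiv ℝ (fderiv ℝ Φ) x).flip e) x :=
    hasFDerivAt_fderiv_apply ((h.contDiffAt_fderiv hx).differentiableAt (by simp))
  have hφΦ : HasFDerivAt (fun z => φ (Φ z)) (fderiv ℝ φ (Φ x) ∘L fderiv ℝ Φ x) x :=
    hφ.hasFDerivAt.comp x (h.hasFDerivAt_map hx)
  have hn : HasFDerivAt n (fderiv ℝ n x) x :=
    ((h.contDiffAt_normal x hx).differentiableAt (by simp)).hasFDerivAt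
  have htangent : ∀ {a b : E3} (w : E3), ⟪n x, a⟫ = 0 → ⟪n x, b⟫ = 0 →
      tripleProd a b (fderiv ℝ n x w) = 0 := fun {a b} w ha hb =>
    tripleProd_eq_zero_of_inner_eq_zero
      (norm_ne_zero_iff.1 (by rw [h.norm_normal x hx]; exact one_ne_zero))
      (by rwa [real_inner_comm]) (by rwa [real_inner_comm])
      (by rw [real_inner_comm]; exact h.inner_normal_fderiv_normal hx w)
  have htrace := tripleProd_map_tangent (fderiv ℝ φ (Φ x)) (h.norm_normal x hx)
    (h.inner_fderiv x hx e₁) (h.inner_fderiv x hx e₂)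
  simp only [cofactorMap_apply]
  rw [hf.surfDiv_smul_add_smul
      (differentiableAt_tripleProd hφΦ.differentiableAt (hD e₂).differentiableAt
        hn.differentiableAt)
      (differentiableAt_tripleProd (hD e₁).differentiableAt hφΦ.differentiableAt
        hn.differentiableAt),
    fderiv_tripleProd_apply hφΦ (hD e₂) hn, fderiv_tripleProd_apply (hD e₁) hφΦ hn,
    htangent e₁ hφn (h.inner_fderiv x hx e₂), htangent e₂ (h.inner_fderiv x hx e₁) hφn,
    ContinuousLinearMap.flip_apply, ContinuousLinearMap.flip_apply, h.fderiv_fderiv_comm hx e₁ e₂,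
    tripleProd_swap (φ (Φ x)), surfDiv, covGrad, hν, areaElement]
  simp only [ContinuousLinearMap.comp_apply] at htrace ⊢
  linear_combination htrace

end IsUnitNormalAlong

section ClosestPoint

variable {Ω N : Set E3} (hN : IsTubeNbhd Ω N) {x : E3} {e₁ e₂ m : E3}
include hN

theorem IsTubeNbhd.isUnitNormalAlong : IsUnitNormalAlong (proj Ω) (nu Ω) N where
  isOpen := hN.isOpen
  contDiffAt_map _ := hN.contDiffAt_proj
  contDiffAt_normal _ := hN.contDiffAt_nu
  norm_normal := hN.norm_nu
  inner_fderiv _ := hN.inner_nu_fderiv_proj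

theorem IsTubeNbhd.fderiv_proj_eq_shapeMap (hx : x ∈ N) (w : E3) :
    fderiv ℝ (proj Ω) x w = shapeMap Ω x w - ⟪nu Ω x, w⟫ • nu Ω x := by
  rw [hN.fderiv_proj_apply hx, tangProj_apply, shapeMap, sub_apply, smul_apply,
    ContinuousLinearMap.id_apply, sub_right_comm]

theorem IsTubeNbhd.shapeMap_nu (hx : x ∈ N) : shapeMap Ω x (nu Ω x) = nu Ω x := by
  rw [shapeMap, sub_apply, smul_apply, hN.fderiv_nu_nu hx, smul_zero, sub_zero,
    ContinuousLinearMap.id_apply]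

theorem IsTubeNbhd.areaElement_proj (hf : IsFrame e₁ e₂ m) (hx : x ∈ N) :
    areaElement (proj Ω) (nu Ω) e₁ e₂ x = (shapeMap Ω x).det * ⟪m, nu Ω x⟫ := by
  rw [← hf.crossProd_fst_snd, ← tripleProd, ← tripleProd_map, hN.shapeMap_nu hx, areaElement,
    hN.fderiv_proj_eq_shapeMap hx, hN.fderiv_proj_eq_shapeMap hx]
  simp only [tripleProd_sub_left, tripleProd_smul_left, tripleProd_sub_middle,
    tripleProd_smul_middle, tripleProd_self_outer, tripleProd_self_right, mul_zero, sub_zero]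

end ClosestPoint

/-! ### Flat pieces and their images -/

theorem continuousOn_leftInverse {X Y : Type*} [TopologicalSpace X] [TopologicalSpace Y]
    [T2Space Y] {C : Set X} (hC : IsCompact C) {f : X → Y} {g : Y → X} (hf : ContinuousOn f C)
    (h : LeftInvOn g f C) : ContinuousOn g (f '' C) :=
  continuousOn_iff_isClosed.2 fun t ht => ⟨f '' (t ∩ C),
    ((hC.inter_left ht).image_of_continuousOn (hf.mono inter_subset_right)).isClosed, by
      rw [h.image_inter', inter_assoc, inter_self]⟩

section ImageMeasure

variable {X Y F : Type*} [MeasurableSpace X] [MeasurableSpace Y] [NormedAddCommGroup F]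
  {μ : Measure X} {ν : Measure Y} {S C : Set X} {f : X → Y} {g : Y → X} {J : X → ENNReal}

theorem map_restrict_image_restrict (hS : MeasurableSet S) (hC : MeasurableSet (f '' C))
    (hSC : S ⊆ C) (hg : AEMeasurable g (ν.restrict (f '' C))) (hgf : LeftInvOn g f C)
    (hJ : ∀ A ⊆ S, MeasurableSet A → ν (f '' A) = ∫⁻ x in A, J x ∂μ) :
    (Measure.map g (ν.restrict (f '' C))).restrict S = (μ.restrict S).withDensity J := by
  ext B hB
  rw [Measure.restrict_apply hB, Measure.map_apply_of_aemeasurable hg (hB.inter hS),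
    Measure.restrict_apply' hC, ← hgf.image_inter', inter_assoc, inter_eq_left.2 hSC,
    hJ _ inter_subset_right (hB.inter hS), withDensity_apply _ hB, Measure.restrict_restrict hB]

theorem map_restrict_image (hS : MeasurableSet S) (hfS : MeasurableSet (f '' S))
    (hg : AEMeasurable g (ν.restrict (f '' S))) (hgf : LeftInvOn g f S)
    (hJ : ∀ A ⊆ S, MeasurableSet A → ν (f '' A) = ∫⁻ x in A, J x ∂μ) :
    Measure.map g (ν.restrict (f '' S)) = (μ.restrict S).withDensity J := by
  have hmem : ∀ᵐ x ∂Measure.map g (ν.restrict (f '' S)), x ∈ S := by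
    refine (ae_map_iff hg hS).2 ?_
    filter_upwards [ae_restrict_mem hfS]
    rintro _ ⟨x, hx, rfl⟩
    rwa [hgf hx]
  rw [← map_restrict_image_restrict hS hfS Subset.rfl hg hgf hJ,
    Measure.restrict_eq_self_of_ae_mem hmem]

theorem rnDeriv_ae_eq_of_restrict_eq_withDensity {μ ν : Measure X} [SigmaFinite μ] [SigmaFinite ν]
    (hS : MeasurableSet S) (hJ : AEMeasurable J (ν.restrict S))
    (h : μ.restrict S = (ν.restrict S).withDensity J) :
    ∀ᵐ x ∂ν.restrict S, μ.rnDeriv ν x = J x := by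
  have hind := Measure.rnDeriv_withDensity₀ ν ((aemeasurable_indicator_iff hS).2 hJ)
  rw [withDensity_indicator hS, ← h] at hind
  filter_upwards [ae_restrict_of_ae (Measure.rnDeriv_restrict μ ν hS), ae_restrict_of_ae hind,
    ae_restrict_mem hS] with x hx hx' hxS
  simpa only [indicator_of_mem hxS] using hx.symm.trans hx'

end ImageMeasure

section Planes

/-- The linear parametrization of the span of `e₁, e₂`. -/
noncomputable def planeLin (e₁ e₂ : E3) : EuclideanSpace ℝ (Fin 2) →L[ℝ] E3 :=
  (EuclideanSpace.proj (0 : Fin 2)).smulRight e₁ + (EuclideanSpace.proj (1 : Fin 2)).smulRight e₂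

/-- The parametrization of the plane through `q` with directions `e₁, e₂`. -/
noncomputable def planeParam (q e₁ e₂ : E3) (s : EuclideanSpace ℝ (Fin 2)) : E3 :=
  q + planeLin e₁ e₂ s

theorem planeLin_apply (e₁ e₂ : E3) (s : EuclideanSpace ℝ (Fin 2)) :
    planeLin e₁ e₂ s = s 0 • e₁ + s 1 • e₂ := rfl

theorem normDet_comp_planeLin (L : Mat3) (e₁ e₂ : E3) :
    (L ∘L planeLin e₁ e₂).toLinearMap.normDet = ‖crossProd (L e₁) (L e₂)‖ := by
  have hgram := (L ∘L planeLin e₁ e₂).toLinearMap.normDet_sq_eq_det_gram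
    (EuclideanSpace.basisFun (Fin 2) ℝ)
  rw [Matrix.det_fin_two] at hgram
  simp only [Matrix.gram_apply, EuclideanSpace.basisFun_apply, ContinuousLinearMap.coe_coe,
    ContinuousLinearMap.comp_apply, planeLin_apply, PiLp.single_apply] at hgram
  simp only [Fin.isValue, if_true, one_ne_zero, zero_ne_one, if_false, one_smul, zero_smul,
    add_zero, zero_add, real_inner_self_eq_norm_sq, real_inner_comm (L e₁) (L e₂),
    RCLike.ofReal_real_eq_id, id_eq] at hgram
  rw [← sq_eq_sq₀ (LinearMap.normDet_nonneg _) (norm_nonneg _), norm_crossProd_sq]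
  linear_combination hgram

theorem crossProd_eq_tripleProd_smul {a b n : E3} (hn : ‖n‖ = 1) (ha : ⟪n, a⟫ = 0)
    (hb : ⟪n, b⟫ = 0) : crossProd a b = tripleProd a b n • n := by
  obtain ⟨e₁, e₂, hf⟩ := exists_isFrame hn
  have hortho : ∀ w : E3, ⟪n, w⟫ = 0 → ⟪w, crossProd a b⟫ = 0 := fun w hw => by
    rw [real_inner_comm, inner_crossProd_left]
    exact tripleProd_eq_zero_of_inner_eq_zero (norm_ne_zero_iff.1 (hn.symm ▸ one_ne_zero))
      ((real_inner_comm _ _).trans hw) ((real_inner_comm _ _).trans ha)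
      ((real_inner_comm _ _).trans hb)
  rw [hf.eq_sum_inner_smul (crossProd a b), hortho e₁ hf.inner_normal_fst,
    hortho e₂ hf.inner_normal_snd, zero_smul, zero_smul, zero_add, zero_add, real_inner_comm,
    inner_crossProd_left, tripleProd_rotate]

namespace IsFrame

variable {e₁ e₂ m : E3} (hf : IsFrame e₁ e₂ m)
include hf

theorem isometry_planeParam (q : E3) : Isometry (planeParam q e₁ e₂) := by
  refine Isometry.of_dist_eq fun s s' => ?_
  rw [dist_eq_norm, dist_eq_norm, planeParam, planeParam, add_sub_add_left_eq_sub, ← map_sub]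
  refine (sq_eq_sq₀ (norm_nonneg _) (norm_nonneg _)).1 ?_
  rw [planeLin_apply, norm_add_sq_real, norm_smul, norm_smul, hf.norm_fst, hf.norm_snd,
    real_inner_smul_left, real_inner_smul_right, hf.inner_fst_snd, EuclideanSpace.norm_sq_eq,
    Fin.sum_univ_two]
  ring

theorem mem_range_planeParam {q x : E3} (hx : ⟪m, x - q⟫ = 0) :
    x ∈ range (planeParam q e₁ e₂) := by
  have hsum := hf.eq_sum_inner_smul (x - q)
  rw [hx, zero_smul, add_zero] at hsum
  refine ⟨!₂[⟪e₁, x - q⟫, ⟪e₂, x - q⟫], ?_⟩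
  simp only [planeParam, planeLin_apply, Matrix.cons_val_zero, Matrix.cons_val_one, ← hsum,
    add_sub_cancel]

theorem setLIntegral_plane {q : E3} {A : Set E3} (hA : MeasurableSet A)
    (hplane : ∀ x ∈ A, ⟪m, x - q⟫ = 0) (f : E3 → ENNReal) :
    ∫⁻ x in A, f x ∂μHE[2] = ∫⁻ s in planeParam q e₁ e₂ ⁻¹' A, f (planeParam q e₁ e₂ s) := by
  have hi := hf.isometry_planeParam q
  have hmap := hi.map_euclideanHausdorffMeasure (d := 2)
  rw [EuclideanSpace.euclideanHausdorffMeasure_eq_volume] at hmap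
  have hsub : A ⊆ range (planeParam q e₁ e₂) := fun x hx => hf.mem_range_planeParam (hplane x hx)
  have he : MeasurableEmbedding (planeParam q e₁ e₂) := hi.isClosedEmbedding.measurableEmbedding
  rw [← inter_eq_left.2 hsub, ← Measure.restrict_restrict hA, ← hmap, he.restrict_map,
    he.lintegral_map, inter_eq_left.2 hsub]

theorem euclideanHausdorffMeasure_lt_top_of_isCompact {q : E3} {K : Set E3} (hK : IsCompact K)
    (hplane : ∀ x ∈ K, ⟪m, x - q⟫ = 0) : μHE[2] K < ⊤ := by
  have hvolume := hf.setLIntegral_plane hK.measurableSet hplane (fun _ => 1)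
  rw [setLIntegral_one, setLIntegral_one] at hvolume
  rw [hvolume]
  exact ((hf.isometry_planeParam q).isClosedEmbedding.isCompact_preimage hK).measure_lt_top

theorem euclideanHausdorffMeasure_image {q : E3} {A : Set E3} (hA : MeasurableSet A)
    (hplane : ∀ x ∈ A, ⟪m, x - q⟫ = 0) {Φ : E3 → E3} {Φ' : E3 → Mat3}
    (hΦ : ∀ x ∈ A, HasStrictFDerivAt Φ (Φ' x) x)
    (hΦ' : ∀ x ∈ A, crossProd (Φ' x e₁) (Φ' x e₂) ≠ 0) (hinj : InjOn Φ A) :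
    μHE[2] (Φ '' A) =
      ∫⁻ x in A, ENNReal.ofReal ‖crossProd (Φ' x e₁) (Φ' x e₂)‖ ∂μHE[2] := by
  have hi := hf.isometry_planeParam q
  have himage : planeParam q e₁ e₂ '' (planeParam q e₁ e₂ ⁻¹' A) = A :=
    image_preimage_eq_of_subset fun x hx => hf.mem_range_planeParam (hplane x hx)
  have hparam : ∀ s, HasStrictFDerivAt (planeParam q e₁ e₂) (planeLin e₁ e₂) s := fun s =>
    (planeLin e₁ e₂).hasStrictFDerivAt.const_add q
  have harea := euclideanHausdorffMeasure_image_eq_lintegral_normDet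
    (f := Φ ∘ planeParam q e₁ e₂) (f' := fun s => Φ' (planeParam q e₁ e₂ s) ∘L planeLin e₁ e₂)
    (hi.continuous.measurable hA) (fun s hs => (hΦ _ hs).comp s (hparam s))
    (fun s hs => LinearMap.ker_eq_bot.1 (by
      have := hΦ' _ hs
      rw [← norm_ne_zero_iff, ← normDet_comp_planeLin] at this
      exact not_not.1 (mt LinearMap.normDet_eq_zero_iff_ker_ne_bot.2 this)))
    (fun s hs s' hs' h => hi.injective (hinj hs hs' h))
  rw [finrank_euclideanSpace_fin, image_comp, himage] at harea
  simp only [harea, normDet_comp_planeLin, hf.setLIntegral_plane hA hplane]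

end IsFrame

end Planes

/-- A flat piece `S` of a surface, contained in a compact subset `K` of the plane through `q` with
oriented orthonormal frame `e₁, e₂, m`, such that `Φ` is an orientation preserving embedding of `K`
with smooth unit normal field `n` along it. The sets `S` of interest are the open triangles, with
the closed triangle for `K`. -/
structure FlatPiece (Φ n : E3 → E3) (N : Set E3) (e₁ e₂ m q : E3) (S K : Set E3) : Prop where
  frame : IsFrame e₁ e₂ m
  normalAlong : IsUnitNormalAlong Φ n N
  isCompact : IsCompact K
  subset_nhd : K ⊆ N
  plane : ∀ x ∈ K, ⟪m, x - q⟫ = 0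
  injOn : InjOn Φ K
  areaElement_pos : ∀ x ∈ K, 0 < areaElement Φ n e₁ e₂ x
  subset : S ⊆ K
  isCompact_diff : IsCompact (K \ S)

namespace FlatPiece

variable {Φ n : E3 → E3} {N : Set E3} {e₁ e₂ m q : E3} {S K : Set E3}
  (hP : FlatPiece Φ n N e₁ e₂ m q S K)
include hP

theorem measurableSet : MeasurableSet S := by
  rw [← sdiff_sdiff_cancel_left hP.subset]
  exact hP.isCompact.measurableSet.diff hP.isCompact_diff.measurableSet

theorem continuousOn_map : ContinuousOn Φ K := fun x hx =>
  (hP.normalAlong.contDiffAt_map x (hP.subset_nhd hx)).continuousAt.continuousWithinAt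

theorem continuousOn_areaElement : ContinuousOn (areaElement Φ n e₁ e₂) K := fun _ hx =>
  (hP.normalAlong.contDiffAt_areaElement (hP.subset_nhd hx)).continuousAt.continuousWithinAt

theorem measure_image {A : Set E3} (hAK : A ⊆ K) (hA : MeasurableSet A) :
    μHE[2] (Φ '' A) = ∫⁻ x in A, ENNReal.ofReal (areaElement Φ n e₁ e₂ x) ∂μHE[2] := by
  have hcross : ∀ x ∈ A, crossProd (fderiv ℝ Φ x e₁) (fderiv ℝ Φ x e₂) =
      areaElement Φ n e₁ e₂ x • n x := fun x hx =>
    have hxN := hP.subset_nhd (hAK hx)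
    crossProd_eq_tripleProd_smul (hP.normalAlong.norm_normal x hxN)
      (hP.normalAlong.inner_fderiv x hxN e₁) (hP.normalAlong.inner_fderiv x hxN e₂)
  have hnorm : ∀ x ∈ A, ‖crossProd (fderiv ℝ Φ x e₁) (fderiv ℝ Φ x e₂)‖ =
      areaElement Φ n e₁ e₂ x := fun x hx => by
    rw [hcross x hx, norm_smul, hP.normalAlong.norm_normal x (hP.subset_nhd (hAK hx)), mul_one,
      Real.norm_of_nonneg (hP.areaElement_pos x (hAK hx)).le]
  rw [hP.frame.euclideanHausdorffMeasure_image hA (fun x hx => hP.plane x (hAK hx))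
    (fun x hx => (hP.normalAlong.contDiffAt_map x (hP.subset_nhd (hAK hx))).hasStrictFDerivAt
      (by simp))
    (fun x hx => norm_ne_zero_iff.1 (by rw [hnorm x hx]; exact (hP.areaElement_pos x (hAK hx)).ne'))
    (hP.injOn.mono hAK)]
  exact setLIntegral_congr_fun hA fun x hx => by rw [hnorm x hx]

theorem measure_lt_top : μHE[2] K < ⊤ :=
  hP.frame.euclideanHausdorffMeasure_lt_top_of_isCompact hP.isCompact hP.plane

theorem exists_areaElement_le : ∃ J : ℝ, ∀ x ∈ K, areaElement Φ n e₁ e₂ x ≤ J := by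
  obtain ⟨J, hJ⟩ := hP.isCompact.exists_bound_of_continuousOn hP.continuousOn_areaElement
  exact ⟨J, fun x hx => (le_abs_self _).trans (hJ x hx)⟩

theorem measure_image_lt_top : μHE[2] (Φ '' K) < ⊤ := by
  obtain ⟨J, hJ⟩ := hP.exists_areaElement_le
  rw [hP.measure_image Subset.rfl hP.isCompact.measurableSet]
  exact setLIntegral_lt_top_of_le_nnreal hP.measure_lt_top.ne
    ⟨J.toNNReal, fun x hx => ENNReal.ofReal_le_ofReal (hJ x hx)⟩

theorem measurableSet_image : MeasurableSet (Φ '' S) :=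
  hP.measurableSet.image_of_continuousOn_injOn (hP.continuousOn_map.mono hP.subset)
    (hP.injOn.mono hP.subset)

theorem aemeasurable_areaElement :
    AEMeasurable (fun x => ENNReal.ofReal (areaElement Φ n e₁ e₂ x)) (μHE[2].restrict S) :=
  ((hP.continuousOn_areaElement.mono hP.subset).aemeasurable hP.measurableSet).ennreal_ofReal

theorem areaRatio_ae_eq {C : Set E3} {Ψ : E3 → E3} (hC : IsCompact C) (hSC : S ⊆ C)
    (hΦ : ContinuousOn Φ C) (hΨ : LeftInvOn Ψ Φ C) (hfin : μHE[2] C ≠ ⊤)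
    (hfin' : μHE[2] (Φ '' C) ≠ ⊤) :
    ∀ᵐ x ∂(μHE[2].restrict S), areaRatio C (Φ '' C) Ψ x = areaElement Φ n e₁ e₂ x := by
  have himage : MeasurableSet (Φ '' C) := (hC.image_of_continuousOn hΦ).measurableSet
  have hmeas : AEMeasurable Ψ (μHE[2].restrict (Φ '' C)) :=
    (continuousOn_leftInverse hC hΦ hΨ).aemeasurable himage
  have : IsFiniteMeasure ((μHE[2] : Measure E3).restrict C) := ⟨by simpa using hfin.lt_top⟩
  have : IsFiniteMeasure ((μHE[2] : Measure E3).restrict (Φ '' C)) := ⟨by simpa using hfin'.lt_top⟩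
  have hrestrict : ((μHE[2] : Measure E3).restrict C).restrict S = μHE[2].restrict S := by
    rw [Measure.restrict_restrict hP.measurableSet, inter_eq_left.2 hSC]
  have hdensity := map_restrict_image_restrict hP.measurableSet himage hSC hmeas hΨ
    fun A hA => hP.measure_image (hA.trans hP.subset)
  rw [← hrestrict] at hdensity
  have hderiv := rnDeriv_ae_eq_of_restrict_eq_withDensity hP.measurableSet
    (by rw [hrestrict]; exact hP.aemeasurable_areaElement) hdensity
  rw [hrestrict] at hderiv
  filter_upwards [hderiv, ae_restrict_mem hP.measurableSet] with x hx hxS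
  rw [areaRatio, hx, ENNReal.toReal_ofReal (hP.areaElement_pos x (hP.subset hxS)).le]

section Inverse

variable {Ψ : E3 → E3} (hΨ : LeftInvOn Ψ Φ K)
include hΨ

theorem aemeasurable_inv : AEMeasurable Ψ (μHE[2].restrict (Φ '' S)) :=
  ((continuousOn_leftInverse hP.isCompact hP.continuousOn_map hΨ).mono
    (image_mono hP.subset)).aemeasurable hP.measurableSet_image

theorem map_inv : Measure.map Ψ (μHE[2].restrict (Φ '' S)) =
    (μHE[2].restrict S).withDensity fun x => ENNReal.ofReal (areaElement Φ n e₁ e₂ x) :=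
  map_restrict_image hP.measurableSet hP.measurableSet_image (hP.aemeasurable_inv hΨ)
    (hΨ.mono hP.subset) fun _ hA => hP.measure_image (hA.trans hP.subset)

theorem ae_inv {p : E3 → Prop} (h : ∀ᵐ x ∂(μHE[2].restrict S), p x) :
    ∀ᵐ y ∂(μHE[2].restrict (Φ '' S)), p (Ψ y) := by
  refine ae_of_ae_map (hP.aemeasurable_inv hΨ) ?_
  rw [hP.map_inv hΨ]
  exact (withDensity_absolutelyContinuous _ _).ae_le h

theorem map_inv_le {J : ℝ} (hJ : ∀ x ∈ S, areaElement Φ n e₁ e₂ x ≤ J) :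
    Measure.map Ψ (μHE[2].restrict (Φ '' S)) ≤ ENNReal.ofReal J • μHE[2].restrict S := by
  rw [hP.map_inv hΨ, ← withDensity_const]
  refine withDensity_mono ?_
  filter_upwards [ae_restrict_mem hP.measurableSet] with x hx
  exact ENNReal.ofReal_le_ofReal (hJ x hx)

variable {F : Type*} [NormedAddCommGroup F] {f : E3 → F}

theorem aestronglyMeasurable_map_inv (hf : AEStronglyMeasurable f (μHE[2].restrict S)) :
    AEStronglyMeasurable f (Measure.map Ψ (μHE[2].restrict (Φ '' S))) := by
  rw [hP.map_inv hΨ]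
  exact hf.mono_ac (withDensity_absolutelyContinuous _ _)

theorem integral_comp_inv [NormedSpace ℝ F] (hf : AEStronglyMeasurable f (μHE[2].restrict S)) :
    ∫ y in Φ '' S, f (Ψ y) ∂μHE[2] = ∫ x in S, areaElement Φ n e₁ e₂ x • f x ∂μHE[2] := by
  rw [← integral_map (hP.aemeasurable_inv hΨ) (hP.aestronglyMeasurable_map_inv hΨ hf),
    hP.map_inv hΨ, integral_withDensity_eq_integral_toReal_smul₀ hP.aemeasurable_areaElement
      (.of_forall fun x => ENNReal.ofReal_lt_top)]
  refine setIntegral_congr_fun hP.measurableSet fun x hx => ?_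
  simp only [ENNReal.toReal_ofReal (hP.areaElement_pos x (hP.subset hx)).le]

theorem memLp_comp_inv {p : ENNReal} (hf : MemLp f p (μHE[2].restrict S)) :
    MemLp (fun y => f (Ψ y)) p (μHE[2].restrict (Φ '' S)) := by
  obtain ⟨J, hJ⟩ := hP.exists_areaElement_le
  refine (memLp_map_measure_iff (hP.aestronglyMeasurable_map_inv hΨ hf.aestronglyMeasurable)
    (hP.aemeasurable_inv hΨ)).1 ?_
  exact hf.of_measure_le_smul ENNReal.ofReal_ne_top
    (hP.map_inv_le hΨ fun x hx => hJ x (hP.subset hx))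

theorem eLpNorm_comp_inv_le {J : ℝ} (hJ : ∀ x ∈ S, areaElement Φ n e₁ e₂ x ≤ J) {p : ENNReal}
    (hf : AEStronglyMeasurable f (μHE[2].restrict S)) :
    eLpNorm (fun y => f (Ψ y)) p (μHE[2].restrict (Φ '' S)) ≤
      ENNReal.ofReal J ^ (1 / p).toReal * eLpNorm f p (μHE[2].restrict S) :=
  (eLpNorm_map_measure (hP.aestronglyMeasurable_map_inv hΨ hf)
    (hP.aemeasurable_inv hΨ)).symm.trans_le (eLpNorm_le_of_measure_le_smul (hP.map_inv_le hΨ hJ))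

end Inverse

end FlatPiece

theorem exists_cutoff_eq_one_nhds {E : Type*} [NormedAddCommGroup E] [NormedSpace ℝ E]
    [FiniteDimensional ℝ E] {K U : Set E} (hK : IsCompact K) (hU : IsOpen U) (hKU : K ⊆ U) :
    ∃ χ : E → ℝ, ContDiff ℝ ∞ χ ∧ HasCompactSupport χ ∧ tsupport χ ⊆ U ∧
      ∀ x ∈ K, ∀ᶠ z in 𝓝 x, χ z = 1 := by
  obtain ⟨L, hL, hKL, hLU⟩ := exists_compact_between hK hU hKU
  obtain ⟨f, hf1, hf0, -⟩ := exists_contMDiffMap_one_nhds_of_subset_interior (n := ⊤)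
    (modelWithCornersSelf ℝ E) hK.isClosed hKL
  have hsupp : Function.support f ⊆ L := fun x hx => by_contra fun hxL => hx (hf0 x hxL)
  exact ⟨f, f.contMDiff.contDiff, HasCompactSupport.of_support_subset_isCompact hL hsupp,
    (closure_minimal hsupp hL.isClosed).trans hLU,
    fun x hx => hf1.filter_mono (nhds_le_nhdsSet hx)⟩

theorem memLp_clm_apply_of_continuousOn {X F G : Type*} [TopologicalSpace X]
    [SecondCountableTopology X] [MeasurableSpace X] [BorelSpace X]
    [NormedAddCommGroup F] [NormedSpace ℝ F] [NormedAddCommGroup G] [NormedSpace ℝ G]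
    {μ : Measure X} {S K : Set X} {p : ENNReal} (hS : MeasurableSet S) (hSK : S ⊆ K)
    (hK : IsCompact K) {L : X → F →L[ℝ] G} (hL : ContinuousOn L K) {v : X → F}
    (hv : MemLp v p (μ.restrict S)) : MemLp (fun x => L x (v x)) p (μ.restrict S) := by
  obtain ⟨J, hJ⟩ := hK.exists_bound_of_continuousOn hL
  refine hv.of_le_mul (c := J) ((ContinuousLinearMap.id ℝ (F →L[ℝ] G)).aestronglyMeasurable_comp₂
    ((hL.mono hSK).aestronglyMeasurable hS) hv.aestronglyMeasurable) ?_
  filter_upwards [ae_restrict_mem hS] with x hx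
  exact ((L x).le_opNorm _).trans (by gcongr; exact hJ x (hSK hx))

theorem surfDiv_congr_of_eventuallyEq {n φ ψ : E3 → E3} {x : E3} (h : φ =ᶠ[𝓝 x] ψ) :
    surfDiv n φ x = surfDiv n ψ x := by
  rw [surfDiv, surfDiv, covGrad, covGrad, h.fderiv_eq]

theorem continuous_tangProj : Continuous tangProj :=
  continuous_const.sub <| (ContinuousLinearMap.smulRightL ℝ E3 E3).continuous₂.comp
    ((innerSL ℝ (E := E3)).continuous.prodMk continuous_id)

theorem continuous_tangProj_conj :
    Continuous fun z : E3 × Mat3 => tangProj z.1 ∘L z.2 ∘L tangProj z.1 :=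
  have hproj : Continuous fun z : E3 × Mat3 => tangProj z.1 :=
    continuous_tangProj.comp continuous_fst
  hproj.clm_comp (continuous_snd.clm_comp hproj)

theorem IsUnitNormalAlong.isOpen_areaElement_ne_zero {Φ n : E3 → E3} {N : Set E3}
    (h : IsUnitNormalAlong Φ n N) {e₁ e₂ : E3} :
    IsOpen (N ∩ areaElement Φ n e₁ e₂ ⁻¹' {0}ᶜ) :=
  ContinuousOn.isOpen_inter_preimage (fun _ hx =>
    (h.contDiffAt_areaElement hx).continuousAt.continuousWithinAt) h.isOpen isOpen_compl_singleton

namespace FlatPiece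

variable {Φ n : E3 → E3} {N : Set E3} {e₁ e₂ m q : E3} {S K : Set E3}
  (hP : FlatPiece Φ n N e₁ e₂ m q S K)
include hP

theorem contDiffAt_piolaMat {x : E3} (hx : x ∈ K) : ContDiffAt ℝ ∞ (piolaMat Φ n e₁ e₂) x :=
  hP.normalAlong.contDiffAt_piolaMat (hP.subset_nhd hx) (hP.areaElement_pos x hx).ne'

theorem continuousOn_piolaMat : ContinuousOn (piolaMat Φ n e₁ e₂) K := fun _ hx =>
  (hP.contDiffAt_piolaMat hx).continuousAt.continuousWithinAt

theorem continuousOn_fderiv_piolaMat : ContinuousOn (fderiv ℝ (piolaMat Φ n e₁ e₂)) K :=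
  fun _ hx => ((hP.contDiffAt_piolaMat hx).fderiv_right (m := 0)
    (by simp)).continuousAt.continuousWithinAt

theorem continuousOn_tangentInv : ContinuousOn (tangentInv Φ n e₁ e₂) K := fun x hx =>
  (hP.normalAlong.contDiffAt_tangentInv (hP.subset_nhd hx)
    (hP.areaElement_pos x hx).ne').continuousAt.continuousWithinAt

theorem memLp_piolaGrad {v : E3 → E3} {A : E3 → Mat3} {p : ENNReal}
    (hv : MemLp v p (μHE[2].restrict S)) (hA : MemLp A p (μHE[2].restrict S)) :
    MemLp (piolaGrad Φ n e₁ e₂ v A) p (μHE[2].restrict S) := by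
  have hR : ContinuousOn (fun x => (ContinuousLinearMap.compL ℝ E3 E3 E3).flip
      (tangentInv Φ n e₁ e₂ x)) K :=
    (ContinuousLinearMap.continuous _).comp_continuousOn hP.continuousOn_tangentInv
  have hF : ContinuousOn (fun x => ContinuousLinearMap.compL ℝ E3 E3 E3
      (piolaMat Φ n e₁ e₂ x)) K :=
    (ContinuousLinearMap.continuous _).comp_continuousOn hP.continuousOn_piolaMat
  have hD : ContinuousOn (fun x => (fderiv ℝ (piolaMat Φ n e₁ e₂) x).flip) K :=
    (ContinuousLinearMap.flipₗᵢ ℝ E3 E3 E3).continuous.comp_continuousOn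
      hP.continuousOn_fderiv_piolaMat
  exact (memLp_clm_apply_of_continuousOn hP.measurableSet hP.subset hP.isCompact
    (hR.clm_comp hD) hv).add
    (memLp_clm_apply_of_continuousOn hP.measurableSet hP.subset hP.isCompact (hF.clm_comp hR) hA)

theorem closure_subset : closure S ⊆ K := closure_minimal hP.subset hP.isCompact.isClosed

section WeakForm

variable {ν φ : E3 → E3} {χ : E3 → ℝ}

theorem isTestField_pullback (hφ : IsTestField (Φ '' S) ν φ) (hχ : ContDiff ℝ ∞ χ)
    (hχc : HasCompactSupport χ) (hχN : tsupport χ ⊆ N) :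
    IsTestField S (fun _ => m) (fun z => χ z • cofactorMap Φ n e₁ e₂ z (φ (Φ z))) where
  smooth := contDiff_smul_of_tsupport hχ fun x hx =>
    (hP.normalAlong.contDiffAt_cofactorMap (hχN hx)).clm_apply
      (hφ.smooth.contDiffAt.comp x (hP.normalAlong.contDiffAt_map x (hχN hx)))
  compact := hχc.smul_right
  support := by
    rintro x ⟨hx, hxS⟩
    have hxK := hP.closure_subset hxS
    have hcont : ContinuousAt Φ x :=
      (hP.normalAlong.contDiffAt_map x (hP.subset_nhd hxK)).continuousAt
    have hΦx : Φ x ∈ tsupport φ := by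
      by_contra hcon
      refine notMem_tsupport_iff_eventuallyEq.2 ?_ hx
      filter_upwards [hcont.eventually (notMem_tsupport_iff_eventuallyEq.1 hcon)] with z hz
      rw [hz, Pi.zero_apply, Pi.zero_apply, map_zero, smul_zero]
    obtain ⟨x', hx', hxx⟩ := hφ.support ⟨hΦx, mem_closure_image hcont hxS⟩
    rwa [← hP.injOn (hP.subset hx') hxK hxx]
  tangential x _ := by
    simp only [real_inner_comm m, cofactorMap_apply, real_inner_smul_right, inner_add_right,
      hP.frame.inner_normal_fst, hP.frame.inner_normal_snd, mul_zero, add_zero]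

variable (hν : ∀ x ∈ S, ν (Φ x) = n x)
include hν

theorem surfDiv_pullback (hφ : IsTestField (Φ '' S) ν φ) {x : E3} (hx : x ∈ S)
    (hχ : ∀ᶠ z in 𝓝 x, χ z = 1) :
    surfDiv (fun _ => m) (fun z => χ z • cofactorMap Φ n e₁ e₂ z (φ (Φ z))) x =
      areaElement Φ n e₁ e₂ x * surfDiv ν φ (Φ x) := by
  have hone : (fun z => χ z • cofactorMap Φ n e₁ e₂ z (φ (Φ z))) =ᶠ[𝓝 x]
      fun z => cofactorMap Φ n e₁ e₂ z (φ (Φ z)) := by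
    filter_upwards [hχ] with z hz
    rw [hz, one_smul]
  rw [surfDiv_congr_of_eventuallyEq hone]
  refine hP.normalAlong.surfDiv_cofactorMap hP.frame (hP.subset_nhd (hP.subset hx))
    (hφ.smooth.differentiable (by simp) _) (hν x hx) ?_
  rw [real_inner_comm, ← hν x hx]
  exact hφ.tangential _ ⟨x, hx, rfl⟩

theorem continuousOn_surfDiv_comp (hφ : ContDiff ℝ 1 φ) :
    ContinuousOn (fun x => surfDiv ν φ (Φ x)) S := by
  have hn : ContinuousOn n S := fun x hx => (hP.normalAlong.contDiffAt_normal x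
    (hP.subset_nhd (hP.subset hx))).continuousAt.continuousWithinAt
  have hD : ContinuousOn (fun x => fderiv ℝ φ (Φ x)) S :=
    (hφ.continuous_fderiv one_ne_zero).comp_continuousOn (hP.continuousOn_map.mono hP.subset)
  have htr : Continuous fun T : Mat3 => LinearMap.trace ℝ E3 T.toLinearMap :=
    LinearMap.continuous_of_finiteDimensional
      (LinearMap.trace ℝ E3 ∘ₗ ContinuousLinearMap.coeLM ℝ)
  refine ((htr.comp continuous_tangProj_conj).comp_continuousOn (hn.prodMk hD)).congr
    fun x hx => ?_
  rw [surfDiv, covGrad, hν x hx]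
  rfl

theorem integral_areaElement_smul_surfDiv {v : E3 → E3} {A : E3 → Mat3}
    (hA : IsH1Tangential S (fun _ => m) v A) (hφ : IsTestField (Φ '' S) ν φ) :
    ∫ x in S, areaElement Φ n e₁ e₂ x •
        (surfDiv ν φ (Φ x) • piolaMat Φ n e₁ e₂ x (v x)) ∂μHE[2] =
      -∫ x in S, areaElement Φ n e₁ e₂ x • piolaGrad Φ n e₁ e₂ v A x (φ (Φ x)) ∂μHE[2] := by
  obtain ⟨χ, hχ, hχc, hχs, hχ1⟩ := exists_cutoff_eq_one_nhds hP.isCompact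
    hP.normalAlong.isOpen_areaElement_ne_zero fun x hx =>
      ⟨hP.subset_nhd hx, (hP.areaElement_pos x hx).ne'⟩
  set ψ : E3 → E3 := fun z => χ z • cofactorMap Φ n e₁ e₂ z (φ (Φ z))
  set G : E3 → Mat3 := fun z => χ z • piolaMat Φ n e₁ e₂ z
  have hψ : IsTestField S (fun _ => m) ψ :=
    hP.isTestField_pullback hφ hχ hχc fun x hx => (hχs hx).1
  have hG : ContDiff ℝ ∞ G := contDiff_smul_of_tsupport hχ fun x hx =>
    hP.normalAlong.contDiffAt_piolaMat (hχs hx).1 (hχs hx).2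
  have hGeq : ∀ x ∈ S, G =ᶠ[𝓝 x] piolaMat Φ n e₁ e₂ := fun x hx => by
    filter_upwards [hχ1 x (hP.subset hx)] with z hz
    rw [← one_smul ℝ (piolaMat _ _ _ _ z), ← hz]
  have hψeq : ∀ x ∈ S, ψ x = areaElement Φ n e₁ e₂ x • tangentInv Φ n e₁ e₂ x (φ (Φ x)) :=
    fun x hx => by
      rw [tangentInv, smul_apply, smul_inv_smul₀ (hP.areaElement_pos x (hP.subset hx)).ne',
        ← one_smul ℝ (cofactorMap _ _ _ _ _ _), ← (hχ1 x (hP.subset hx)).self_of_nhds]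
  have hfin : μHE[2] S ≠ ⊤ := ((measure_mono hP.subset).trans_lt hP.measure_lt_top).ne
  have hmul := hA.weak_matrix_mul hP.frame.norm_normal hfin hP.measurableSet hψ hG
  refine Eq.trans (setIntegral_congr_fun hP.measurableSet fun x hx => ?_)
    (hmul.trans (congrArg Neg.neg (setIntegral_congr_fun hP.measurableSet fun x hx => ?_)))
  · simp only [ψ, hP.surfDiv_pullback hν hφ hx (hχ1 x (hP.subset hx)), (hGeq x hx).self_of_nhds,
      mul_smul]
  · simp only [(hGeq x hx).self_of_nhds, (hGeq x hx).fderiv_eq, hψeq x hx, piolaGrad_apply,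
      map_smul, smul_apply, smul_add]
    rw [add_comm]

end WeakForm

section Inverse

variable {Ψ : E3 → E3} (hΨ : LeftInvOn Ψ Φ K)
include hΨ

/-- Weak derivatives are transported by testing on the plane with the pulled back field
`(cof DΦ)ᵀ (φ ∘ Φ)`, whose divergence is that of `φ` times the area element by the Piola
identity. -/
theorem isH1Tangential_piola {ν v w : E3 → E3} {A : E3 → Mat3} (hν : ∀ x ∈ S, ν (Φ x) = n x)
    (hA : IsH1Tangential S (fun _ => m) v A)
    (hw : ∀ᵐ y ∂(μHE[2].restrict (Φ '' S)), w y = piolaMat Φ n e₁ e₂ (Ψ y) (v (Ψ y))) :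
    IsH1Tangential (Φ '' S) ν w (fun y => piolaGrad Φ n e₁ e₂ v A (Ψ y)) := by
  have hinv : ∀ x ∈ S, Ψ (Φ x) = x := fun x hx => hΨ (hP.subset hx)
  have hFv : MemLp (fun x => piolaMat Φ n e₁ e₂ x (v x)) 2 (μHE[2].restrict S) :=
    memLp_clm_apply_of_continuousOn hP.measurableSet hP.subset hP.isCompact
      hP.continuousOn_piolaMat hA.memLp
  have hB := hP.memLp_piolaGrad hA.memLp hA.memLp_grad
  refine ⟨(memLp_congr_ae hw).2 (hP.memLp_comp_inv hΨ hFv), hP.memLp_comp_inv hΨ hB, ?_, ?_,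
    fun φ hφ => ?_⟩
  · filter_upwards [hw, ae_restrict_mem hP.measurableSet_image] with _ hy ⟨x, hx, hxy⟩
    subst hxy
    rw [hy, hν x hx, hinv x hx, real_inner_comm, piolaMat, smul_apply, real_inner_smul_right,
      hP.normalAlong.inner_fderiv x (hP.subset_nhd (hP.subset hx)), mul_zero]
  · filter_upwards [ae_restrict_mem hP.measurableSet_image] with _ ⟨x, hx, hxy⟩
    subst hxy
    rw [hν x hx, hinv x hx, piolaGrad_apply, tangentInv_normal, map_zero, zero_apply, map_zero,
      map_zero, add_zero]
  · have hφS : ContinuousOn (fun x => φ (Φ x)) S :=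
      hφ.smooth.continuous.comp_continuousOn (hP.continuousOn_map.mono hP.subset)
    have hdivS := hP.continuousOn_surfDiv_comp hν (hφ.smooth.of_le (by simp))
    have hm₁ : AEStronglyMeasurable (fun x => surfDiv ν φ (Φ x) • piolaMat Φ n e₁ e₂ x (v x))
        (μHE[2].restrict S) :=
      (hdivS.aestronglyMeasurable hP.measurableSet).smul hFv.aestronglyMeasurable
    have hm₂ : AEStronglyMeasurable (fun x => piolaGrad Φ n e₁ e₂ v A x (φ (Φ x)))
        (μHE[2].restrict S) :=
      (ContinuousLinearMap.id ℝ Mat3).aestronglyMeasurable_comp₂ hB.aestronglyMeasurable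
        (hφS.aestronglyMeasurable hP.measurableSet)
    calc ∫ y in Φ '' S, surfDiv ν φ y • w y ∂μHE[2]
        = ∫ y in Φ '' S, surfDiv ν φ (Φ (Ψ y)) • piolaMat Φ n e₁ e₂ (Ψ y) (v (Ψ y)) ∂μHE[2] := by
          refine integral_congr_ae ?_
          filter_upwards [hw, ae_restrict_mem hP.measurableSet_image] with _ hy ⟨x, hx, hxy⟩
          subst hxy
          simp only [hy, hinv x hx]
      _ = -∫ y in Φ '' S, piolaGrad Φ n e₁ e₂ v A (Ψ y) (φ (Φ (Ψ y))) ∂μHE[2] := by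
          rw [hP.integral_comp_inv hΨ hm₁, hP.integral_areaElement_smul_surfDiv hν hA hφ,
            hP.integral_comp_inv hΨ hm₂]
      _ = -∫ y in Φ '' S, piolaGrad Φ n e₁ e₂ v A (Ψ y) (φ y) ∂μHE[2] := by
          refine congrArg Neg.neg (setIntegral_congr_fun hP.measurableSet_image ?_)
          rintro _ ⟨x, hx, rfl⟩
          simp only [hinv x hx]

end Inverse

end FlatPiece

/-! ### Estimates for the closest point projection -/

theorem abs_tripleProd_le_norm_tangProj {n : E3} (hn : ‖n‖ = 1) (a b : E3) :
    |tripleProd a b n| ≤ ‖tangProj n a‖ * ‖b‖ := by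
  have h : tripleProd a b n = tripleProd (tangProj n a) b n := by
    rw [tangProj_apply, tripleProd_sub_left, tripleProd_smul_left, tripleProd_self_outer, mul_zero,
      sub_zero]
  rw [h, ← mul_one (_ * _), ← hn]
  exact abs_tripleProd_le _ _ _

theorem IsFrame.inner_tangentInv {e₁ e₂ m : E3} (hf : IsFrame e₁ e₂ m) (Φ n : E3 → E3) (x w : E3) :
    ⟪m, tangentInv Φ n e₁ e₂ x w⟫ = 0 := by
  rw [tangentInv, smul_apply, cofactorMap_apply, real_inner_smul_right, inner_add_right,
    real_inner_smul_right, real_inner_smul_right, hf.inner_normal_fst, hf.inner_normal_snd,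
    mul_zero, mul_zero, add_zero, mul_zero]

theorem tangentInv_tangProj (Φ n : E3 → E3) (e₁ e₂ x w : E3) :
    tangentInv Φ n e₁ e₂ x (tangProj (n x) w) = tangentInv Φ n e₁ e₂ x w := by
  rw [tangProj_apply, map_sub, map_smul, tangentInv_normal, smul_zero, sub_zero]

theorem inner_of_covGrad_eq {m : E3} (hm : ‖m‖ = 1) {A : E3 → Mat3} {x : E3}
    (hA : covGrad (fun _ => m) A x = A x) (w : E3) : ⟪m, A x w⟫ = 0 := by
  rw [← hA]
  exact inner_tangProj hm _

theorem apply_tangProj_of_covGrad_eq {m : E3} (hm : ‖m‖ = 1) {A : E3 → Mat3} {x : E3}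
    (hA : covGrad (fun _ => m) A x = A x) (w : E3) : A x (tangProj m w) = A x w := by
  rw [← hA]
  simp only [covGrad, ContinuousLinearMap.comp_apply,
    tangProj_of_inner_eq_zero (inner_tangProj hm w)]

namespace IsUnitNormalAlong

variable {Φ n : E3 → E3} {N : Set E3} (h : IsUnitNormalAlong Φ n N) {x : E3} {e₁ e₂ m : E3}
include h

theorem tangProj_fderiv (hx : x ∈ N) (w : E3) :
    tangProj (n x) (fderiv ℝ Φ x w) = fderiv ℝ Φ x w :=
  tangProj_of_inner_eq_zero (h.inner_fderiv x hx w)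

theorem tangProj_piolaMat (hx : x ∈ N) (w : E3) :
    tangProj (n x) (piolaMat Φ n e₁ e₂ x w) = piolaMat Φ n e₁ e₂ x w := by
  rw [piolaMat, smul_apply, map_smul, h.tangProj_fderiv hx]

theorem fderiv_areaElement_apply (hx : x ∈ N) (t : E3) :
    fderiv ℝ (areaElement Φ n e₁ e₂) x t =
      tripleProd (fderiv ℝ (fderiv ℝ Φ) x t e₁) (fderiv ℝ Φ x e₂) (n x) -
        tripleProd (fderiv ℝ (fderiv ℝ Φ) x t e₂) (fderiv ℝ Φ x e₁) (n x) := by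
  have hD : ∀ e, HasFDerivAt (fun z => fderiv ℝ Φ z e) ((fderiv ℝ (fderiv ℝ Φ) x).flip e) x :=
    hasFDerivAt_fderiv_apply ((h.contDiffAt_fderiv hx).differentiableAt (by simp))
  have hn : HasFDerivAt n (fderiv ℝ n x) x :=
    ((h.contDiffAt_normal x hx).differentiableAt (by simp)).hasFDerivAt
  have hnormal : tripleProd (fderiv ℝ Φ x e₁) (fderiv ℝ Φ x e₂) (fderiv ℝ n x t) = 0 :=
    tripleProd_eq_zero_of_inner_eq_zero
      (norm_ne_zero_iff.1 (by rw [h.norm_normal x hx]; exact one_ne_zero))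
      (by rw [real_inner_comm]; exact h.inner_fderiv x hx e₁)
      (by rw [real_inner_comm]; exact h.inner_fderiv x hx e₂)
      (by rw [real_inner_comm]; exact h.inner_normal_fderiv_normal hx t)
  have harea : areaElement Φ n e₁ e₂ =
      fun z => tripleProd (fderiv ℝ Φ z e₁) (fderiv ℝ Φ z e₂) (n z) := rfl
  rw [harea, fderiv_tripleProd_apply (hD e₁) (hD e₂) hn, hnormal, add_zero,
    tripleProd_swap (fderiv ℝ Φ x e₁), ← sub_eq_add_neg]
  rfl

theorem fderiv_piolaMat_apply (hx : x ∈ N) (h0 : areaElement Φ n e₁ e₂ x ≠ 0) (t v : E3) :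
    fderiv ℝ (piolaMat Φ n e₁ e₂) x t v =
      (areaElement Φ n e₁ e₂ x)⁻¹ • fderiv ℝ (fderiv ℝ Φ) x t v -
        ((areaElement Φ n e₁ e₂ x)⁻¹ ^ 2 * fderiv ℝ (areaElement Φ n e₁ e₂) x t) •
          fderiv ℝ Φ x v := by
  have hD : HasFDerivAt (fderiv ℝ Φ) (fderiv ℝ (fderiv ℝ Φ) x) x :=
    ((h.contDiffAt_fderiv hx).differentiableAt (by simp)).hasFDerivAt
  have hJ : HasFDerivAt (areaElement Φ n e₁ e₂) (fderiv ℝ (areaElement Φ n e₁ e₂) x) x :=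
    ((h.contDiffAt_areaElement hx).differentiableAt (by simp)).hasFDerivAt
  have hP : HasFDerivAt (piolaMat Φ n e₁ e₂) _ x :=
    ((hasDerivAt_inv h0).comp_hasFDerivAt x hJ).smul hD
  rw [hP.fderiv]
  simp [sub_eq_add_neg]

/-- On a flat piece and for a tangential Jacobian, the error of the Piola transform splits into the
derivative of the Piola matrix and the deviations of `tangentInv` and `piolaMat` from the
identity. -/
theorem tangProj_piolaGrad_sub_apply (hm : ‖m‖ = 1) (hx : x ∈ N) (v : E3 → E3) {A : E3 → Mat3}
    (hA : covGrad (fun _ => m) A x = A x) (w : E3) :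
    (tangProj (n x) ∘L piolaGrad Φ n e₁ e₂ v A x ∘L tangProj (n x) - A x) w =
      tangProj (n x) (fderiv ℝ (piolaMat Φ n e₁ e₂) x (tangentInv Φ n e₁ e₂ x w) (v x)) +
        (piolaMat Φ n e₁ e₂ x (A x (tangentInv Φ n e₁ e₂ x w - tangProj m w)) +
          (piolaMat Φ n e₁ e₂ x (A x w) - A x w)) := by
  rw [sub_apply, ContinuousLinearMap.comp_apply, ContinuousLinearMap.comp_apply, piolaGrad_apply,
    tangentInv_tangProj, map_add, h.tangProj_piolaMat hx, map_sub,
    apply_tangProj_of_covGrad_eq hm hA, map_sub]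
  abel

end IsUnitNormalAlong

theorem IsTubeNbhd.fderiv_fderiv_proj_apply {Ω N : Set E3} (hN : IsTubeNbhd Ω N) {x : E3}
    (hx : x ∈ N) (t a : E3) : fderiv ℝ (fderiv ℝ (proj Ω)) x t a =
      -(⟪fderiv ℝ (nu Ω) x t, a⟫ • nu Ω x + ⟪nu Ω x, a⟫ • fderiv ℝ (nu Ω) x t +
        (⟪nu Ω x, t⟫ • fderiv ℝ (nu Ω) x a + sdist Ω x • fderiv ℝ (fderiv ℝ (nu Ω)) x t a)) := by
  have hDp := hasFDerivAt_fderiv_apply ((hN.contDiffAt_fderiv_proj hx).differentiableAt (by simp)) a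
  have hDn := hasFDerivAt_fderiv_apply ((hN.contDiffAt_fderiv_nu hx).differentiableAt (by simp)) a
  have hn := hN.hasFDerivAt_nu hx
  have hformula :
      HasFDerivAt (fun z => a - ⟪nu Ω z, a⟫ • nu Ω z - sdist Ω z • fderiv ℝ (nu Ω) z a) _ x :=
    ((hasFDerivAt_const a x).sub ((hn.inner ℝ (hasFDerivAt_const a x)).smul hn)).sub
      ((hN.hasFDerivAt_sdist hx).smul hDn)
  have heq : (fun z => fderiv ℝ (proj Ω) z a) =ᶠ[𝓝 x]
      fun z => a - ⟪nu Ω z, a⟫ • nu Ω z - sdist Ω z • fderiv ℝ (nu Ω) z a := by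
    filter_upwards [hN.isOpen.mem_nhds hx] with z hz
    rw [hN.fderiv_proj_apply hz, tangProj_apply]
  rw [← ContinuousLinearMap.flip_apply, hDp.unique (hformula.congr_of_eventuallyEq heq)]
  simp
  abel

/-- The map `proj Ω` is, up to errors of order `ε`, the identity on the plane with the frame
`e₁, e₂, m` at the point `x`. All other quantities in the estimates are bounded by `K`. -/
structure NearFlat (Ω N : Set E3) (e₁ e₂ m : E3) (K ε : ℝ) (x : E3) : Prop where
  frame : IsFrame e₁ e₂ m
  tube : IsTubeNbhd Ω N
  mem : x ∈ N
  one_le : 1 ≤ K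
  nonneg : 0 ≤ ε
  le : ε ≤ K
  norm_fderiv : ‖fderiv ℝ (nu Ω) x‖ ≤ K
  norm_fderiv_fderiv : ‖fderiv ℝ (fderiv ℝ (nu Ω)) x‖ ≤ K
  abs_sdist_le : |sdist Ω x| ≤ ε
  norm_nu_sub_le : ‖nu Ω x - m‖ ≤ ε
  areaElement_pos : 0 < areaElement (proj Ω) (nu Ω) e₁ e₂ x
  inv_areaElement_le : (areaElement (proj Ω) (nu Ω) e₁ e₂ x)⁻¹ ≤ K

namespace NearFlat

variable {Ω N : Set E3} {e₁ e₂ m : E3} {K ε : ℝ} {x : E3} (h : NearFlat Ω N e₁ e₂ m K ε x)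
include h

theorem norm_nu : ‖nu Ω x‖ = 1 := h.tube.norm_nu x h.mem

theorem bound_nonneg : 0 ≤ K := zero_le_one.trans h.one_le

theorem inv_areaElement_pos : 0 < (areaElement (proj Ω) (nu Ω) e₁ e₂ x)⁻¹ :=
  inv_pos.2 h.areaElement_pos

theorem pow_mul_le_pow_mul {i j : ℕ} (hij : i ≤ j) {r : ℝ} (hr : 0 ≤ r) : K ^ i * r ≤ K ^ j * r :=
  mul_le_mul_of_nonneg_right (pow_le_pow_right₀ h.one_le hij) hr

theorem abs_inner_nu_le {w : E3} (hw : ⟪m, w⟫ = 0) : |⟪nu Ω x, w⟫| ≤ ε * ‖w‖ := by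
  rw [← sub_zero ⟪nu Ω x, w⟫, ← hw, ← inner_sub_left]
  exact (abs_real_inner_le_norm _ _).trans (by gcongr; exact h.norm_nu_sub_le)

theorem norm_fderiv_apply_le (w : E3) : ‖fderiv ℝ (nu Ω) x w‖ ≤ K * ‖w‖ :=
  (ContinuousLinearMap.le_opNorm _ _).trans (by gcongr; exact h.norm_fderiv)

theorem norm_sdist_smul_le (w : E3) :
    ‖sdist Ω x • fderiv ℝ (nu Ω) x w‖ ≤ ε * (K * ‖w‖) := by
  rw [norm_smul, Real.norm_eq_abs]
  exact mul_le_mul h.abs_sdist_le (h.norm_fderiv_apply_le w) (norm_nonneg _) h.nonneg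

theorem norm_fderiv_proj_sub_le {w : E3} (hw : ⟪m, w⟫ = 0) :
    ‖fderiv ℝ (proj Ω) x w - w‖ ≤ 2 * K * ε * ‖w‖ := by
  have hsub : fderiv ℝ (proj Ω) x w - w =
      -(⟪nu Ω x, w⟫ • nu Ω x + sdist Ω x • fderiv ℝ (nu Ω) x w) := by
    rw [h.tube.fderiv_proj_apply h.mem, tangProj_apply]; abel
  have hnormal : ‖⟪nu Ω x, w⟫ • nu Ω x‖ ≤ ε * ‖w‖ := by
    rw [norm_smul, h.norm_nu, mul_one]; exact h.abs_inner_nu_le hw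
  have hK : ε * ‖w‖ ≤ K * (ε * ‖w‖) :=
    le_mul_of_one_le_left (mul_nonneg h.nonneg (norm_nonneg _)) h.one_le
  rw [hsub, norm_neg]
  linarith [norm_add_le (⟪nu Ω x, w⟫ • nu Ω x) (sdist Ω x • fderiv ℝ (nu Ω) x w),
    h.norm_sdist_smul_le w]

theorem norm_fderiv_proj_le (w : E3) : ‖fderiv ℝ (proj Ω) x w‖ ≤ 2 * K ^ 2 * ‖w‖ := by
  have hε : ε * (K * ‖w‖) ≤ K * (K * ‖w‖) :=
    mul_le_mul_of_nonneg_right h.le (mul_nonneg h.bound_nonneg (norm_nonneg w))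
  have hK := h.pow_mul_le_pow_mul (Nat.zero_le 2) (norm_nonneg w)
  rw [h.tube.fderiv_proj_apply h.mem]
  linarith [norm_sub_le (tangProj (nu Ω x) w) (sdist Ω x • fderiv ℝ (nu Ω) x w),
    norm_tangProj_apply_le h.norm_nu w, h.norm_sdist_smul_le w]

theorem norm_fderiv_proj_fst_sub_le : ‖fderiv ℝ (proj Ω) x e₁ - e₁‖ ≤ 2 * K * ε := by
  simpa only [h.frame.norm_fst, mul_one] using
    h.norm_fderiv_proj_sub_le h.frame.inner_normal_fst

theorem norm_fderiv_proj_snd_sub_le : ‖fderiv ℝ (proj Ω) x e₂ - e₂‖ ≤ 2 * K * ε := by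
  simpa only [h.frame.norm_snd, mul_one] using
    h.norm_fderiv_proj_sub_le h.frame.inner_normal_snd

theorem norm_fderiv_proj_fst_le : ‖fderiv ℝ (proj Ω) x e₁‖ ≤ 2 * K ^ 2 := by
  simpa only [h.frame.norm_fst, mul_one] using h.norm_fderiv_proj_le e₁

theorem norm_fderiv_proj_snd_le : ‖fderiv ℝ (proj Ω) x e₂‖ ≤ 2 * K ^ 2 := by
  simpa only [h.frame.norm_snd, mul_one] using h.norm_fderiv_proj_le e₂

theorem abs_areaElement_sub_one_le :
    |areaElement (proj Ω) (nu Ω) e₁ e₂ x - 1| ≤ 7 * K ^ 3 * ε := by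
  set X₁ := fderiv ℝ (proj Ω) x e₁
  set X₂ := fderiv ℝ (proj Ω) x e₂
  have htelescope : areaElement (proj Ω) (nu Ω) e₁ e₂ x - 1 =
      tripleProd (X₁ - e₁) X₂ (nu Ω x) + tripleProd e₁ (X₂ - e₂) (nu Ω x) +
        tripleProd e₁ e₂ (nu Ω x - m) := by
    rw [tripleProd_sub_left, tripleProd_sub_middle, tripleProd_sub_right,
      h.frame.tripleProd_eq_one, areaElement]
    ring
  have hfst := abs_tripleProd_le (X₁ - e₁) X₂ (nu Ω x)
  have hsnd := abs_tripleProd_le e₁ (X₂ - e₂) (nu Ω x)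
  have hnormal := abs_tripleProd_le e₁ e₂ (nu Ω x - m)
  simp only [h.norm_nu, h.frame.norm_fst, h.frame.norm_snd, mul_one, one_mul] at hfst hsnd hnormal
  have hprod : ‖X₁ - e₁‖ * ‖X₂‖ ≤ 2 * K * ε * (2 * K ^ 2) :=
    mul_le_mul h.norm_fderiv_proj_fst_sub_le h.norm_fderiv_proj_snd_le (norm_nonneg _)
      ((norm_nonneg _).trans h.norm_fderiv_proj_fst_sub_le)
  have hK₁ := h.pow_mul_le_pow_mul (show 1 ≤ 3 by norm_num) h.nonneg
  have hK₀ := h.pow_mul_le_pow_mul (Nat.zero_le 3) h.nonneg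
  rw [htelescope]
  refine (abs_add_three _ _ _).trans ?_
  linarith [h.norm_nu_sub_le, h.norm_fderiv_proj_snd_sub_le]

theorem areaElement_le : areaElement (proj Ω) (nu Ω) e₁ e₂ x ≤ 8 * K ^ 4 := by
  have hsub := (abs_le.1 h.abs_areaElement_sub_one_le).2
  have hε := mul_le_mul_of_nonneg_left h.le (pow_nonneg h.bound_nonneg 3)
  have hK : 1 ≤ K ^ 4 := one_le_pow₀ h.one_le
  linarith

theorem abs_inv_areaElement_sub_one_le :
    |(areaElement (proj Ω) (nu Ω) e₁ e₂ x)⁻¹ - 1| ≤ 7 * K ^ 4 * ε := by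
  have hinv : (areaElement (proj Ω) (nu Ω) e₁ e₂ x)⁻¹ - 1 =
      (areaElement (proj Ω) (nu Ω) e₁ e₂ x)⁻¹ *
        -(areaElement (proj Ω) (nu Ω) e₁ e₂ x - 1) := by
    rw [neg_sub, mul_sub, mul_one, inv_mul_cancel₀ h.areaElement_pos.ne']
  rw [hinv, abs_mul, abs_neg, abs_of_pos h.inv_areaElement_pos]
  exact (mul_le_mul h.inv_areaElement_le h.abs_areaElement_sub_one_le (abs_nonneg _)
    h.bound_nonneg).trans_eq (by ring)

theorem norm_inv_areaElement_smul_sub_le {a w : E3} {B : ℝ} (ha : ‖a - w‖ ≤ B) :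
    ‖(areaElement (proj Ω) (nu Ω) e₁ e₂ x)⁻¹ • a - w‖ ≤ K * B + 7 * K ^ 4 * ε * ‖w‖ := by
  have hsplit : (areaElement (proj Ω) (nu Ω) e₁ e₂ x)⁻¹ • a - w =
      (areaElement (proj Ω) (nu Ω) e₁ e₂ x)⁻¹ • (a - w) +
        ((areaElement (proj Ω) (nu Ω) e₁ e₂ x)⁻¹ - 1) • w := by
    rw [smul_sub, sub_smul, one_smul]; abel
  have hK := h.bound_nonneg
  rw [hsplit]
  refine (norm_add_le _ _).trans ?_
  rw [norm_smul, norm_smul, Real.norm_eq_abs, Real.norm_eq_abs, abs_of_pos h.inv_areaElement_pos]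
  gcongr
  · exact h.inv_areaElement_le
  · exact h.abs_inv_areaElement_sub_one_le

theorem norm_piolaMat_sub_le {w : E3} (hw : ⟪m, w⟫ = 0) :
    ‖piolaMat (proj Ω) (nu Ω) e₁ e₂ x w - w‖ ≤ 9 * K ^ 4 * (ε * ‖w‖) := by
  have hsub := h.norm_inv_areaElement_smul_sub_le (h.norm_fderiv_proj_sub_le hw)
  have hK := h.pow_mul_le_pow_mul (show 2 ≤ 4 by norm_num) (mul_nonneg h.nonneg (norm_nonneg w))
  rw [piolaMat, smul_apply]
  linarith

theorem norm_piolaMat_le (w : E3) :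
    ‖piolaMat (proj Ω) (nu Ω) e₁ e₂ x w‖ ≤ 2 * K ^ 3 * ‖w‖ := by
  rw [piolaMat, smul_apply, norm_smul, Real.norm_eq_abs, abs_of_pos h.inv_areaElement_pos]
  exact (mul_le_mul h.inv_areaElement_le (h.norm_fderiv_proj_le w) (norm_nonneg _)
    h.bound_nonneg).trans_eq (by ring)

theorem abs_tripleProd_fderiv_proj_snd_sub_le (w : E3) :
    |tripleProd w (fderiv ℝ (proj Ω) x e₂) (nu Ω x) - tripleProd w e₂ m| ≤
      ‖w‖ * (2 * K * ε) + ‖w‖ * ε := by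
  have hsplit : tripleProd w (fderiv ℝ (proj Ω) x e₂) (nu Ω x) - tripleProd w e₂ m =
      tripleProd w (fderiv ℝ (proj Ω) x e₂ - e₂) (nu Ω x) + tripleProd w e₂ (nu Ω x - m) := by
    rw [tripleProd_sub_middle, tripleProd_sub_right]; ring
  rw [hsplit]
  refine (abs_add_le _ _).trans (add_le_add ((abs_tripleProd_le _ _ _).trans ?_)
    ((abs_tripleProd_le _ _ _).trans ?_))
  · rw [h.norm_nu, mul_one]; gcongr; exact h.norm_fderiv_proj_snd_sub_le
  · rw [h.frame.norm_snd, mul_one]; gcongr; exact h.norm_nu_sub_le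

theorem abs_tripleProd_fderiv_proj_fst_sub_le (w : E3) :
    |tripleProd (fderiv ℝ (proj Ω) x e₁) w (nu Ω x) - tripleProd e₁ w m| ≤
      2 * K * ε * ‖w‖ + ‖w‖ * ε := by
  have hsplit : tripleProd (fderiv ℝ (proj Ω) x e₁) w (nu Ω x) - tripleProd e₁ w m =
      tripleProd (fderiv ℝ (proj Ω) x e₁ - e₁) w (nu Ω x) + tripleProd e₁ w (nu Ω x - m) := by
    rw [tripleProd_sub_left, tripleProd_sub_right]; ring
  rw [hsplit]
  refine (abs_add_le _ _).trans (add_le_add ((abs_tripleProd_le _ _ _).trans ?_)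
    ((abs_tripleProd_le _ _ _).trans ?_))
  · rw [h.norm_nu, mul_one]; gcongr; exact h.norm_fderiv_proj_fst_sub_le
  · rw [h.frame.norm_fst, one_mul]; gcongr; exact h.norm_nu_sub_le

theorem norm_cofactorMap_sub_le (w : E3) :
    ‖cofactorMap (proj Ω) (nu Ω) e₁ e₂ x w - tangProj m w‖ ≤ 6 * K * ε * ‖w‖ := by
  have hinner₁ : ⟪e₁, w⟫ = tripleProd w e₂ m := by
    rw [← inner_crossProd_left, h.frame.crossProd_snd_normal]
  have hinner₂ : ⟪e₂, w⟫ = tripleProd e₁ w m := by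
    rw [tripleProd_rotate, ← inner_crossProd_left, h.frame.crossProd_normal_fst]
  have hK := mul_le_mul_of_nonneg_right h.one_le (mul_nonneg h.nonneg (norm_nonneg w))
  rw [cofactorMap_apply, h.frame.tangProj_eq, hinner₁, hinner₂, add_sub_add_comm, ← sub_smul,
    ← sub_smul]
  refine (norm_add_le _ _).trans ?_
  rw [norm_smul, norm_smul, h.frame.norm_fst, h.frame.norm_snd, mul_one, mul_one,
    Real.norm_eq_abs, Real.norm_eq_abs]
  linarith [h.abs_tripleProd_fderiv_proj_snd_sub_le w, h.abs_tripleProd_fderiv_proj_fst_sub_le w]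

theorem norm_tangentInv_sub_le (w : E3) :
    ‖tangentInv (proj Ω) (nu Ω) e₁ e₂ x w - tangProj m w‖ ≤ 13 * K ^ 4 * (ε * ‖w‖) := by
  have hsub := h.norm_inv_areaElement_smul_sub_le (h.norm_cofactorMap_sub_le w)
  have hK := h.pow_mul_le_pow_mul (show 2 ≤ 4 by norm_num) (mul_nonneg h.nonneg (norm_nonneg w))
  have hproj : 7 * K ^ 4 * ε * ‖tangProj m w‖ ≤ 7 * K ^ 4 * ε * ‖w‖ :=
    mul_le_mul_of_nonneg_left (norm_tangProj_apply_le h.frame.norm_normal w)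
      (mul_nonneg (by have := h.bound_nonneg; positivity) h.nonneg)
  rw [tangentInv, smul_apply]
  linarith

theorem norm_tangentInv_le (w : E3) :
    ‖tangentInv (proj Ω) (nu Ω) e₁ e₂ x w‖ ≤ 14 * K ^ 5 * ‖w‖ := by
  have hε : 13 * K ^ 4 * (ε * ‖w‖) ≤ 13 * K ^ 4 * (K * ‖w‖) := by
    have := h.bound_nonneg
    gcongr
    exact h.le
  have hK := h.pow_mul_le_pow_mul (Nat.zero_le 5) (norm_nonneg w)
  have hadd := norm_add_le (tangentInv (proj Ω) (nu Ω) e₁ e₂ x w - tangProj m w) (tangProj m w)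
  rw [sub_add_cancel] at hadd
  linarith [h.norm_tangentInv_sub_le w, norm_tangProj_apply_le h.frame.norm_normal w]

theorem norm_tangProj_fderiv_fderiv_proj_le {t a : E3} (ht : ⟪m, t⟫ = 0) (ha : ⟪m, a⟫ = 0) :
    ‖tangProj (nu Ω x) (fderiv ℝ (fderiv ℝ (proj Ω)) x t a)‖ ≤ 3 * K * ε * (‖t‖ * ‖a‖) := by
  have hmixed : ∀ {b c : E3}, ⟪m, b⟫ = 0 →
      ‖⟪nu Ω x, b⟫ • fderiv ℝ (nu Ω) x c‖ ≤ ε * ‖b‖ * (K * ‖c‖) := fun {b c} hb => by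
    rw [norm_smul]
    exact mul_le_mul (h.abs_inner_nu_le hb) (h.norm_fderiv_apply_le c) (norm_nonneg _)
      (mul_nonneg h.nonneg (norm_nonneg _))
  have hsecond : ‖sdist Ω x • fderiv ℝ (fderiv ℝ (nu Ω)) x t a‖ ≤ ε * (K * ‖t‖ * ‖a‖) := by
    rw [norm_smul]
    exact mul_le_mul h.abs_sdist_le ((ContinuousLinearMap.le_opNorm₂ _ _ _).trans
      (by gcongr; exact h.norm_fderiv_fderiv)) (norm_nonneg _) h.nonneg
  rw [h.tube.fderiv_fderiv_proj_apply h.mem, map_neg, norm_neg, map_add, map_add, map_smul,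
    tangProj_self h.norm_nu, smul_zero, zero_add, ← map_add]
  refine (norm_tangProj_apply_le h.norm_nu _).trans ?_
  refine (norm_add_le _ _).trans ?_
  linarith [norm_add_le (⟪nu Ω x, t⟫ • fderiv ℝ (nu Ω) x a)
    (sdist Ω x • fderiv ℝ (fderiv ℝ (nu Ω)) x t a), hmixed (c := t) ha, hmixed (c := a) ht]

theorem abs_fderiv_areaElement_le {t : E3} (ht : ⟪m, t⟫ = 0) :
    |fderiv ℝ (areaElement (proj Ω) (nu Ω) e₁ e₂) x t| ≤ 12 * K ^ 3 * ε * ‖t‖ := by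
  have hfst := h.norm_tangProj_fderiv_fderiv_proj_le ht h.frame.inner_normal_fst
  have hsnd := h.norm_tangProj_fderiv_fderiv_proj_le ht h.frame.inner_normal_snd
  rw [h.frame.norm_fst, mul_one] at hfst
  rw [h.frame.norm_snd, mul_one] at hsnd
  have hpos : 0 ≤ 3 * K * ε * ‖t‖ := (norm_nonneg _).trans hfst
  rw [h.tube.isUnitNormalAlong.fderiv_areaElement_apply h.mem]
  calc _ ≤ 3 * K * ε * ‖t‖ * (2 * K ^ 2) + 3 * K * ε * ‖t‖ * (2 * K ^ 2) :=
        (abs_sub _ _).trans (add_le_add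
          ((abs_tripleProd_le_norm_tangProj h.norm_nu _ _).trans
            (mul_le_mul hfst h.norm_fderiv_proj_snd_le (norm_nonneg _) hpos))
          ((abs_tripleProd_le_norm_tangProj h.norm_nu _ _).trans
            (mul_le_mul hsnd h.norm_fderiv_proj_fst_le (norm_nonneg _) hpos)))
    _ = 12 * K ^ 3 * ε * ‖t‖ := by ring

theorem norm_tangProj_fderiv_piolaMat_le {t v : E3} (ht : ⟪m, t⟫ = 0) (hv : ⟪m, v⟫ = 0) :
    ‖tangProj (nu Ω x) (fderiv ℝ (piolaMat (proj Ω) (nu Ω) e₁ e₂) x t v)‖ ≤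
      27 * K ^ 7 * ε * (‖t‖ * ‖v‖) := by
  have hN := h.tube.isUnitNormalAlong
  have hK := h.bound_nonneg
  have hε := h.nonneg
  have hinv := h.inv_areaElement_pos.le
  have hsecond : (areaElement (proj Ω) (nu Ω) e₁ e₂ x)⁻¹ *
      ‖tangProj (nu Ω x) (fderiv ℝ (fderiv ℝ (proj Ω)) x t v)‖ ≤
        K * (3 * K * ε * (‖t‖ * ‖v‖)) :=
    mul_le_mul h.inv_areaElement_le (h.norm_tangProj_fderiv_fderiv_proj_le ht hv) (norm_nonneg _) hK
  have harea : (areaElement (proj Ω) (nu Ω) e₁ e₂ x)⁻¹ ^ 2 *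
      |fderiv ℝ (areaElement (proj Ω) (nu Ω) e₁ e₂) x t| * ‖fderiv ℝ (proj Ω) x v‖ ≤
        K ^ 2 * (12 * K ^ 3 * ε * ‖t‖) * (2 * K ^ 2 * ‖v‖) := by
    gcongr
    · exact h.inv_areaElement_le
    · exact h.abs_fderiv_areaElement_le ht
    · exact h.norm_fderiv_proj_le v
  have hpow := h.pow_mul_le_pow_mul (show 2 ≤ 7 by norm_num)
    (mul_nonneg hε (mul_nonneg (norm_nonneg t) (norm_nonneg v)))
  rw [hN.fderiv_piolaMat_apply h.mem h.areaElement_pos.ne', map_sub, map_smul, map_smul,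
    hN.tangProj_fderiv h.mem]
  refine (norm_sub_le _ _).trans ?_
  rw [norm_smul, norm_smul, norm_mul, norm_pow, Real.norm_eq_abs, Real.norm_eq_abs,
    abs_of_pos h.inv_areaElement_pos]
  linarith

theorem norm_tangProj_piolaGrad_sub_le {v : E3 → E3} {A : E3 → Mat3} (hv : ⟪m, v x⟫ = 0)
    (hA : covGrad (fun _ => m) A x = A x) :
    ‖tangProj (nu Ω x) ∘L piolaGrad (proj Ω) (nu Ω) e₁ e₂ v A x ∘L tangProj (nu Ω x) - A x‖ ≤
      378 * K ^ 12 * ε * (‖A x‖ + ‖v x‖) := by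
  have hK := h.bound_nonneg
  have hε := h.nonneg
  have hm := h.frame.norm_normal
  refine ContinuousLinearMap.opNorm_le_bound _ (by positivity) fun w => ?_
  set R := tangentInv (proj Ω) (nu Ω) e₁ e₂ x
  set F := piolaMat (proj Ω) (nu Ω) e₁ e₂ x
  have hDF : ‖tangProj (nu Ω x) (fderiv ℝ (piolaMat (proj Ω) (nu Ω) e₁ e₂) x (R w) (v x))‖ ≤
      27 * K ^ 7 * ε * (14 * K ^ 5 * ‖w‖ * ‖v x‖) := by
    refine (h.norm_tangProj_fderiv_piolaMat_le (h.frame.inner_tangentInv _ _ _ w) hv).trans ?_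
    gcongr
    exact h.norm_tangentInv_le w
  have hR : ‖F (A x (R w - tangProj m w))‖ ≤
      2 * K ^ 3 * (‖A x‖ * (13 * K ^ 4 * (ε * ‖w‖))) := by
    refine (h.norm_piolaMat_le _).trans ?_
    gcongr
    exact (A x).le_opNorm_of_le (h.norm_tangentInv_sub_le w)
  have hF : ‖F (A x w) - A x w‖ ≤ 9 * K ^ 4 * (ε * (‖A x‖ * ‖w‖)) := by
    refine (h.norm_piolaMat_sub_le (inner_of_covGrad_eq hm hA w)).trans ?_
    gcongr
    exact (A x).le_opNorm _
  have hr : 0 ≤ ε * (‖A x‖ * ‖w‖) := by positivity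
  have hpow₇ := h.pow_mul_le_pow_mul (show 7 ≤ 12 by norm_num) hr
  have hpow₄ := h.pow_mul_le_pow_mul (show 4 ≤ 12 by norm_num) hr
  have hpow : 0 ≤ K ^ 12 * (ε * (‖A x‖ * ‖w‖)) := by positivity
  rw [h.tube.isUnitNormalAlong.tangProj_piolaGrad_sub_apply hm h.mem v hA]
  refine (norm_add_le _ _).trans ?_
  linarith [norm_add_le (F (A x (R w - tangProj m w))) (F (A x w) - A x w)]

end NearFlat

theorem norm_symm_part_le (D : Mat3) :
    ‖(1 / 2 : ℝ) • (D + ContinuousLinearMap.adjoint D)‖ ≤ ‖D‖ := by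
  have hadd := norm_add_le D (ContinuousLinearMap.adjoint D)
  rw [LinearIsometryEquiv.norm_map] at hadd
  rw [norm_smul, Real.norm_of_nonneg (by norm_num)]
  linarith

theorem norm_deform_sub_le (n n' : E3 → E3) (A B : E3 → Mat3) (x y : E3) :
    ‖deform n B y - deform n' A x‖ ≤ ‖covGrad n B y - covGrad n' A x‖ := by
  refine le_trans (le_of_eq ?_) (norm_symm_part_le _)
  rw [deform, deform, map_sub]
  congr 1
  module

section LpEstimates

variable {X E F G : Type*} [MeasurableSpace X] {μ : Measure X} [NormedAddCommGroup E]
  [NormedAddCommGroup F] [NormedAddCommGroup G]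

theorem eLpNorm_norm_add_mul_norm_add_norm_le {f : X → E} {g : X → F} {h : X → G}
    (hf : AEStronglyMeasurable f μ) (hg : AEStronglyMeasurable g μ)
    (hh : AEStronglyMeasurable h μ) {p : ENNReal} (hp : 1 ≤ p) {c : ℝ} (hc : 0 ≤ c) :
    eLpNorm (fun x => ‖f x‖ + c * (‖g x‖ + ‖h x‖)) p μ ≤
      eLpNorm f p μ + ENNReal.ofReal c * (eLpNorm g p μ + eLpNorm h p μ) := by
  have hadd : eLpNorm (fun x => ‖g x‖ + ‖h x‖) p μ ≤ eLpNorm g p μ + eLpNorm h p μ :=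
    (eLpNorm_add_le hg.norm hh.norm hp).trans_eq
      (congrArg₂ (· + ·) (eLpNorm_norm g) (eLpNorm_norm h))
  have hmul : eLpNorm (fun x => c * (‖g x‖ + ‖h x‖)) p μ =
      ENNReal.ofReal c * eLpNorm (fun x => ‖g x‖ + ‖h x‖) p μ := by
    rw [← Real.enorm_of_nonneg hc]
    exact eLpNorm_const_smul c (fun x => ‖g x‖ + ‖h x‖) p μ
  refine (eLpNorm_add_le hf.norm ((hg.norm.add hh.norm).const_mul c) hp).trans ?_
  exact add_le_add (eLpNorm_norm f).le (hmul.trans_le (mul_le_mul_right hadd _))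

end LpEstimates

section ConstantNormal

variable {μ : Measure E3} {A : E3 → Mat3} (m : E3) (hA : AEStronglyMeasurable A μ)
include hA

theorem aestronglyMeasurable_covGrad : AEStronglyMeasurable (covGrad (fun _ => m) A) μ :=
  (continuous_tangProj_conj.comp (Continuous.prodMk_right m)).comp_aestronglyMeasurable hA

theorem aestronglyMeasurable_deform : AEStronglyMeasurable (deform (fun _ => m) A) μ :=
  have hcov := aestronglyMeasurable_covGrad m hA
  (hcov.add (ContinuousLinearMap.adjoint.continuous.comp_aestronglyMeasurable hcov)).const_smul
    (1 / 2 : ℝ)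

end ConstantNormal

namespace FlatPiece

variable {Φ n ν : E3 → E3} {N : Set E3} {e₁ e₂ m q : E3} {S K : Set E3}
  (hP : FlatPiece Φ n N e₁ e₂ m q S K) {v w Ψ : E3 → E3} {A B : E3 → Mat3}
include hP

theorem covGrad_ae_eq (hA : IsH1Tangential S (fun _ => m) v A) :
    ∀ᵐ x ∂(μHE[2].restrict S), covGrad (fun _ => m) A x = A x :=
  hA.covGrad_ae_eq hP.frame.norm_normal
    ((measure_mono hP.subset).trans_lt hP.measure_lt_top).ne hP.measurableSet
    hP.isCompact_diff.isClosed.isOpen_compl (fun _ hx hx' => hx'.2 hx)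
    fun _ hx => by_contra fun hxS => hx.1 ⟨hP.closure_subset hx.2, hxS⟩

theorem image_subset_inter_compl {W : Set E3} (hW : MapsTo Φ K W) :
    Φ '' S ⊆ W ∩ (Φ '' (K \ S))ᶜ := by
  rintro _ ⟨x, hx, rfl⟩
  refine ⟨hW (hP.subset hx), ?_⟩
  rintro ⟨x', hx', he⟩
  rw [hP.injOn hx'.1 (hP.subset hx) he] at hx'
  exact hx'.2 hx

theorem compl_image_diff_inter_closure_subset : (Φ '' (K \ S))ᶜ ∩ closure (Φ '' S) ⊆ Φ '' S := by
  have hclosure : closure (Φ '' S) ⊆ Φ '' K :=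
    closure_minimal (image_mono hP.subset)
      (hP.isCompact.image_of_continuousOn hP.continuousOn_map).isClosed
  rintro y ⟨hy, hyc⟩
  obtain ⟨x, hx, rfl⟩ := hclosure hyc
  exact ⟨x, by_contra fun hxS => hy ⟨x, ⟨hx, hxS⟩, rfl⟩, rfl⟩

theorem ae_eq_piolaGrad {W : Set E3} (hWo : IsOpen W) (hW : MapsTo Φ K W)
    (hνW : ∀ y ∈ W, ContDiffAt ℝ ∞ ν y) (hν : ∀ x ∈ S, ν (Φ x) = n x) (hΨ : LeftInvOn Ψ Φ K)
    (hA : IsH1Tangential S (fun _ => m) v A)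
    (hw : ∀ᵐ y ∂(μHE[2].restrict (Φ '' S)), w y = piolaMat Φ n e₁ e₂ (Ψ y) (v (Ψ y)))
    (hB : IsH1Tangential (Φ '' S) ν w B) :
    ∀ᵐ y ∂(μHE[2].restrict (Φ '' S)), B y = piolaGrad Φ n e₁ e₂ v A (Ψ y) := by
  have hbdry : IsClosed (Φ '' (K \ S)) :=
    (hP.isCompact_diff.image_of_continuousOn (hP.continuousOn_map.mono sdiff_subset)).isClosed
  have hnorm : ∀ y ∈ Φ '' S, ‖ν y‖ = 1 := by
    rintro _ ⟨x, hx, rfl⟩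
    rw [hν x hx, hP.normalAlong.norm_normal x (hP.subset_nhd (hP.subset hx))]
  exact hB.grad_unique (hP.isH1Tangential_piola hΨ hν hA hw)
    ((measure_mono (image_mono hP.subset)).trans_lt hP.measure_image_lt_top).ne
    hP.measurableSet_image (hWo.inter hbdry.isOpen_compl) (hP.image_subset_inter_compl hW)
    (fun _ hy => hP.compl_image_diff_inter_closure_subset ⟨hy.1.2, hy.2⟩)
    (fun y hy => hνW y hy.1) hnorm

theorem eLpNorm_image_le {E F G H : Type*} [NormedAddCommGroup E] [NormedAddCommGroup F]
    [NormedAddCommGroup G] [NormedAddCommGroup H] {f : E3 → E} {g : E3 → F} {h : E3 → G}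
    {u : E3 → H} (hf : AEStronglyMeasurable f (μHE[2].restrict S))
    (hg : AEStronglyMeasurable g (μHE[2].restrict S))
    (hh : AEStronglyMeasurable h (μHE[2].restrict S)) (hΨ : LeftInvOn Ψ Φ K) {J : ℝ}
    (hJ : 1 ≤ J) (hJS : ∀ x ∈ S, areaElement Φ n e₁ e₂ x ≤ J) {c : ℝ} (hc : 0 ≤ c)
    (hu : ∀ᵐ y ∂(μHE[2].restrict (Φ '' S)),
      ‖u y‖ ≤ ‖f (Ψ y)‖ + c * (‖g (Ψ y)‖ + ‖h (Ψ y)‖)) {p : ENNReal} (hp : 1 ≤ p) :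
    eLpNorm u p (μHE[2].restrict (Φ '' S)) ≤
      ENNReal.ofReal J * (eLpNorm f p (μHE[2].restrict S) + ENNReal.ofReal c *
        (eLpNorm g p (μHE[2].restrict S) + eLpNorm h p (μHE[2].restrict S))) := by
  have hexp : (1 / p).toReal ≤ 1 := ENNReal.toReal_le_of_le_ofReal zero_le_one (by
    rw [ENNReal.ofReal_one, one_div]
    exact ENNReal.inv_le_one.2 hp)
  have hpow : ENNReal.ofReal J ^ (1 / p).toReal ≤ ENNReal.ofReal J :=
    (ENNReal.rpow_le_rpow_of_exponent_le (ENNReal.one_le_ofReal.2 hJ) hexp).trans_eq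
      (ENNReal.rpow_one _)
  exact (eLpNorm_mono_ae_real hu).trans ((hP.eLpNorm_comp_inv_le hΨ hJS
    (hf.norm.add ((hg.norm.add hh.norm).const_mul c))).trans
      (mul_le_mul' hpow (eLpNorm_norm_add_mul_norm_add_norm_le hf hg hh hp hc)))

end FlatPiece

namespace FlatPiece

variable {Ω N : Set E3} {e₁ e₂ m q : E3} {S P : Set E3} {K ε : ℝ}
  (hP : FlatPiece (proj Ω) (nu Ω) N e₁ e₂ m q S P) (hN : IsTubeNbhd Ω N)
  (hnear : ∀ x ∈ P, NearFlat Ω N e₁ e₂ m K ε x)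
  {Ψ : E3 → E3} {v w : E3 → E3} {A B : E3 → Mat3} (hΨ : LeftInvOn Ψ (proj Ω) P)
  (hA : IsH1Tangential S (fun _ => m) v A)
  (hw : ∀ᵐ y ∂(μHE[2].restrict (proj Ω '' S)),
    w y = piolaMat (proj Ω) (nu Ω) e₁ e₂ (Ψ y) (v (Ψ y)))
  (hB : IsH1Tangential (proj Ω '' S) (nu Ω) w B)
include hP hN hnear hΨ hA hw hB

theorem ae_norm_deform_sub_le : ∀ᵐ y ∂(μHE[2].restrict (proj Ω '' S)),
    ‖deform (nu Ω) B y - deform (fun _ => m) A (Ψ y)‖ ≤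
      378 * K ^ 12 * ε * (‖covGrad (fun _ => m) A (Ψ y)‖ + ‖v (Ψ y)‖) := by
  have hBeq := hP.ae_eq_piolaGrad hN.isOpen
    (fun x hx => hN.frontier_subset (hN.proj_mem x (hP.subset_nhd hx)))
    (fun y hy => hN.contDiffAt_nu hy)
    (fun x hx => hN.nu_proj x (hP.subset_nhd (hP.subset hx))) hΨ hA hw hB
  filter_upwards [hBeq, hP.ae_inv hΨ (hP.covGrad_ae_eq hA), hP.ae_inv hΨ hA.tangential,
    ae_restrict_mem hP.measurableSet_image] with _ hBy hAy hvy ⟨x, hx, hxy⟩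
  subst hxy
  have hxP := hP.subset hx
  rw [hΨ hxP] at hBy hAy hvy ⊢
  refine (norm_deform_sub_le _ _ _ _ _ _).trans ?_
  rw [hAy, covGrad, hBy, hN.nu_proj x (hP.subset_nhd hxP)]
  exact (hnear x hxP).norm_tangProj_piolaGrad_sub_le (by rw [real_inner_comm]; exact hvy) hAy

theorem eLpNorm_deform_le (hK : 1 ≤ K) (hε : 0 ≤ ε) {p : ENNReal} (hp : 1 ≤ p) :
    eLpNorm (deform (nu Ω) B) p (μHE[2].restrict (proj Ω '' S)) ≤
      ENNReal.ofReal (8 * K ^ 4) * (eLpNorm (deform (fun _ => m) A) p (μHE[2].restrict S) +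
        ENNReal.ofReal (378 * K ^ 12 * ε) * (eLpNorm (covGrad (fun _ => m) A) p
          (μHE[2].restrict S) + eLpNorm v p (μHE[2].restrict S))) := by
  have hAm := hA.memLp_grad.aestronglyMeasurable
  have hK₄ : 1 ≤ K ^ 4 := one_le_pow₀ hK
  refine hP.eLpNorm_image_le (aestronglyMeasurable_deform m hAm)
    (aestronglyMeasurable_covGrad m hAm) hA.memLp.aestronglyMeasurable hΨ (by linarith)
    (fun x hx => (hnear x (hP.subset hx)).areaElement_le) (by positivity) ?_ hp
  filter_upwards [hP.ae_norm_deform_sub_le hN hnear hΨ hA hw hB] with y hy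
  exact (norm_le_norm_add_norm_sub' _ _).trans (add_le_add_right hy _)

end FlatPiece

/-! ### Polyhedral approximations -/

namespace PolyhedralSurface

variable (Γ : PolyhedralSurface) (i : Fin Γ.numFaces)

theorem closedInterior_subset_carrier : (Γ.face i).closedInterior ⊆ Γ.carrier :=
  subset_iUnion (fun i => (Γ.face i).closedInterior) i

theorem isCompact_carrier : IsCompact Γ.carrier :=
  isCompact_iUnion fun i => (Γ.face i).isCompact_closedInterior

theorem inner_normal_sub {x : E3} (hx : x ∈ (Γ.face i).closedInterior) :
    ⟪Γ.normal i, x - (Γ.face i).points 0⟫ = 0 := by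
  have hconvex : Convex ℝ {x : E3 | ⟪Γ.normal i, x⟫ = ⟪Γ.normal i, (Γ.face i).points 0⟫} :=
    convex_hyperplane (innerₛₗ ℝ (Γ.normal i)).isLinear _
  have hvertices : range (Γ.face i).points ⊆
      {x : E3 | ⟪Γ.normal i, x⟫ = ⟪Γ.normal i, (Γ.face i).points 0⟫} := by
    rintro _ ⟨j, rfl⟩
    rw [mem_ofPred_eq, ← sub_eq_zero, ← inner_sub_right, Γ.normal_orth]
  rw [← Affine.Simplex.convexHull_eq_closedInterior] at hx
  rw [inner_sub_right, sub_eq_zero]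
  exact convexHull_min hvertices hconvex hx

theorem measure_carrier_lt_top : μHE[2] Γ.carrier < ⊤ := by
  refine (measure_iUnion_le _).trans_lt ?_
  rw [tsum_fintype]
  refine ENNReal.sum_lt_top.2 fun i _ => ?_
  obtain ⟨e₁, e₂, hf⟩ := exists_isFrame (Γ.norm_normal i)
  exact hf.euclideanHausdorffMeasure_lt_top_of_isCompact (Γ.face i).isCompact_closedInterior
    fun _ => Γ.inner_normal_sub i

theorem meshSize_nonneg : 0 ≤ Γ.meshSize := Real.iSup_nonneg fun _ => Metric.diam_nonneg

include i in
theorem meshSize_le_diam {T : Set E3} (hT : Bornology.IsBounded T) (hΓ : Γ.carrier ⊆ T) :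
    Γ.meshSize ≤ Metric.diam T :=
  have : Nonempty (Fin Γ.numFaces) := ⟨i⟩
  ciSup_le fun j => Metric.diam_mono ((Γ.closedInterior_subset_carrier j).trans hΓ) hT

end PolyhedralSurface

/-- The closest point projection is a bijection of `Γ` onto `frontier Ω`, the distance of `Γ` to
`frontier Ω` is of order `h²`, and its normals are oriented outwards and of order `h` close to those
of `frontier Ω`. -/
structure IsCloseApprox (Ω : Set E3) (δ M c : ℝ) (Γ : PolyhedralSurface) : Prop where
  subset_tube : Γ.carrier ⊆ tube Ω δ
  bijOn_proj : BijOn (proj Ω) Γ.carrier (frontier Ω)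
  abs_sdist_le : ∀ x ∈ Γ.carrier, |sdist Ω x| ≤ M * Γ.meshSize ^ 2
  normal_close : ∀ i, ∀ x ∈ (Γ.face i).closedInterior,
    ‖nu Ω (proj Ω x) - Γ.normal i‖ ≤ M * Γ.meshSize
  le_inner_normal : ∀ i, ∀ x ∈ (Γ.face i).closedInterior, c ≤ ⟪nu Ω x, Γ.normal i⟫

theorem IsPolyhedralApprox.isCloseApprox {Ω : Set E3} {δ M c : ℝ} {Γ : PolyhedralSurface}
    (hΓ : IsPolyhedralApprox Ω δ M c Γ) : IsCloseApprox Ω δ M c Γ :=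
  ⟨hΓ.subset_tube, hΓ.bijOn_proj, hΓ.abs_sdist_le, hΓ.normal_close, hΓ.le_inner_normal⟩

theorem IsTubeNbhd.exists_norm_fderiv_nu_le {Ω N T : Set E3} (hN : IsTubeNbhd Ω N)
    (hT : IsCompact T) (hTN : T ⊆ N) :
    ∃ H, ∀ x ∈ T, ‖fderiv ℝ (nu Ω) x‖ ≤ H ∧ ‖fderiv ℝ (fderiv ℝ (nu Ω)) x‖ ≤ H := by
  obtain ⟨H₁, hH₁⟩ := hT.exists_bound_of_continuousOn (f := fderiv ℝ (nu Ω)) fun x hx =>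
    (hN.contDiffAt_fderiv_nu (hTN hx)).continuousAt.continuousWithinAt
  obtain ⟨H₂, hH₂⟩ := hT.exists_bound_of_continuousOn (f := fderiv ℝ (fderiv ℝ (nu Ω)))
    fun x hx => ((hN.contDiffAt_fderiv_nu (hTN hx)).fderiv_right
      (m := 0) (by simp)).continuousAt.continuousWithinAt
  exact ⟨max H₁ H₂, fun x hx => ⟨le_max_of_le_left (hH₁ x hx), le_max_of_le_right (hH₂ x hx)⟩⟩

namespace IsCloseApprox

variable {Ω N : Set E3} {δ M c : ℝ} {Γ : PolyhedralSurface} {i : Fin Γ.numFaces} {e₁ e₂ : E3}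
  (hΓ : IsCloseApprox Ω δ M c Γ)

section

include hΓ

theorem leftInvOn_projInv : LeftInvOn (projInv Ω Γ) (proj Ω) Γ.carrier :=
  hΓ.bijOn_proj.injOn.leftInvOn_invFunOn

theorem leftInvOn_projInv_face (i : Fin Γ.numFaces) :
    LeftInvOn (projInv Ω Γ) (proj Ω) (Γ.face i).closedInterior :=
  hΓ.leftInvOn_projInv.mono (Γ.closedInterior_subset_carrier i)

end

section Tube

variable (hN : IsTubeNbhd Ω N) (hδ : tube Ω δ ⊆ N) (hdet : ∀ x ∈ N, 1 / 2 < (shapeMap Ω x).det)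
  (hc : 0 < c)
include hΓ hN hδ hdet hc

theorem half_le_areaElement (hf : IsFrame e₁ e₂ (Γ.normal i)) {x : E3}
    (hx : x ∈ (Γ.face i).closedInterior) : c / 2 ≤ areaElement (proj Ω) (nu Ω) e₁ e₂ x := by
  have hxN := hδ (hΓ.subset_tube (Γ.closedInterior_subset_carrier i hx))
  have hinner := hΓ.le_inner_normal i x hx
  rw [real_inner_comm] at hinner
  rw [hN.areaElement_proj hf hxN]
  calc c / 2 = 1 / 2 * c := by ring
    _ ≤ _ := mul_le_mul (hdet x hxN).le hinner hc.le (one_half_pos.trans (hdet x hxN)).le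

theorem flatPiece (hf : IsFrame e₁ e₂ (Γ.normal i)) :
    FlatPiece (proj Ω) (nu Ω) N e₁ e₂ (Γ.normal i) ((Γ.face i).points 0) (Γ.face i).interior
      (Γ.face i).closedInterior where
  frame := hf
  normalAlong := hN.isUnitNormalAlong
  isCompact := (Γ.face i).isCompact_closedInterior
  subset_nhd := (Γ.closedInterior_subset_carrier i).trans (hΓ.subset_tube.trans hδ)
  plane _ hx := Γ.inner_normal_sub i hx
  injOn := hΓ.bijOn_proj.injOn.mono (Γ.closedInterior_subset_carrier i)
  areaElement_pos _ hx := (half_pos hc).trans_le (hΓ.half_le_areaElement hN hδ hdet hc hf hx)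
  subset := (Γ.face i).interior_subset_closedInterior
  isCompact_diff := by
    rw [Affine.Simplex.closedInterior_sdiff_interior]
    exact isCompact_iUnion fun j => ((Γ.face i).faceOpposite j).isCompact_closedInterior

theorem measure_image_carrier_lt_top : μHE[2] (proj Ω '' Γ.carrier) < ⊤ := by
  rw [PolyhedralSurface.carrier, image_iUnion]
  refine (measure_iUnion_le _).trans_lt ?_
  rw [tsum_fintype]
  refine ENNReal.sum_lt_top.2 fun i _ => ?_
  obtain ⟨e₁, e₂, hf⟩ := exists_isFrame (Γ.norm_normal i)
  exact (hΓ.flatPiece hN hδ hdet hc hf).measure_image_lt_top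

theorem liftPiola_ae_eq (hf : IsFrame e₁ e₂ (Γ.normal i)) (v : E3 → E3) :
    ∀ᵐ y ∂(μHE[2].restrict (proj Ω '' (Γ.face i).interior)), liftPiola Ω Γ v y =
      piolaMat (proj Ω) (nu Ω) e₁ e₂ (projInv Ω Γ y) (v (projInv Ω Γ y)) := by
  have hP := hΓ.flatPiece hN hδ hdet hc hf
  have hcont : ContinuousOn (proj Ω) Γ.carrier := fun x hx =>
    (hN.contDiffAt_proj (hδ (hΓ.subset_tube hx))).continuousAt.continuousWithinAt
  have hratio := hP.areaRatio_ae_eq Γ.isCompact_carrier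
    (hP.subset.trans (Γ.closedInterior_subset_carrier i)) hcont hΓ.leftInvOn_projInv
    Γ.measure_carrier_lt_top.ne (hΓ.measure_image_carrier_lt_top hN hδ hdet hc).ne
  rw [hΓ.bijOn_proj.image_eq] at hratio
  filter_upwards [hP.ae_inv (hΓ.leftInvOn_projInv_face i) hratio] with y hy
  rw [liftPiola, piola, hy, piolaMat, smul_apply]

theorem nearFlat (hM : 0 ≤ M) {D K : ℝ} (hD : Γ.meshSize ≤ D) (hK : 1 ≤ K)
    (hH : ∀ x ∈ tube Ω δ, ‖fderiv ℝ (nu Ω) x‖ ≤ K ∧ ‖fderiv ℝ (fderiv ℝ (nu Ω)) x‖ ≤ K)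
    (hKD : M * (1 + D) * D ≤ K) (hKc : 2 / c ≤ K) (hf : IsFrame e₁ e₂ (Γ.normal i)) {x : E3}
    (hx : x ∈ (Γ.face i).closedInterior) :
    NearFlat Ω N e₁ e₂ (Γ.normal i) K (M * (1 + D) * Γ.meshSize) x := by
  have hxΓ := Γ.closedInterior_subset_carrier i hx
  have hxT := hΓ.subset_tube hxΓ
  have hMh : 0 ≤ M * Γ.meshSize := mul_nonneg hM Γ.meshSize_nonneg
  have hD₀ : 0 ≤ D := Γ.meshSize_nonneg.trans hD
  have harea := hΓ.half_le_areaElement hN hδ hdet hc hf hx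
  have hdist : |sdist Ω x| ≤ M * Γ.meshSize * D :=
    (hΓ.abs_sdist_le x hxΓ).trans (by
      rw [sq, ← mul_assoc]
      exact mul_le_mul_of_nonneg_left hD hMh)
  have hnormal := hΓ.normal_close i x hx
  rw [hN.nu_proj x (hδ hxT)] at hnormal
  have hMhD := mul_nonneg hMh hD₀
  exact {
    frame := hf
    tube := hN
    mem := hδ hxT
    one_le := hK
    nonneg := by linarith
    le := (mul_le_mul_of_nonneg_left hD (by positivity)).trans hKD
    norm_fderiv := (hH x hxT).1
    norm_fderiv_fderiv := (hH x hxT).2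
    abs_sdist_le := by linarith
    norm_nu_sub_le := by linarith
    areaElement_pos := (half_pos hc).trans_le harea
    inv_areaElement_le := (inv_anti₀ (half_pos hc) harea).trans (by rwa [inv_div]) }

end Tube

end IsCloseApprox

theorem exists_nearFlat {Ω N : Set E3} {δ M c : ℝ} (hN : IsTubeNbhd Ω N)
    (hT : IsCompact (tube Ω δ)) (hδ : tube Ω δ ⊆ N) (hdet : ∀ x ∈ N, 1 / 2 < (shapeMap Ω x).det)
    (hM : 0 ≤ M) (hc : 0 < c) :
    ∃ K L, 1 ≤ K ∧ 0 ≤ L ∧ ∀ Γ : PolyhedralSurface, IsCloseApprox Ω δ M c Γ →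
      ∀ i e₁ e₂, IsFrame e₁ e₂ (Γ.normal i) → ∀ x ∈ (Γ.face i).closedInterior,
        NearFlat Ω N e₁ e₂ (Γ.normal i) K (L * Γ.meshSize) x := by
  obtain ⟨H, hH⟩ := hN.exists_norm_fderiv_nu_le hT hδ
  set D := Metric.diam (tube Ω δ)
  have hMD : 0 ≤ M * (1 + D) * D := by positivity
  have hc₂ : 0 < 2 / c := by positivity
  have hHK : H ≤ 1 + |H| + M * (1 + D) * D + 2 / c := by linarith [le_abs_self H]
  refine ⟨1 + |H| + M * (1 + D) * D + 2 / c, M * (1 + D), by linarith [abs_nonneg H],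
    by positivity, fun Γ hΓ i e₁ e₂ hf x hx => ?_⟩
  exact hΓ.nearFlat hN hδ hdet hc hM (Γ.meshSize_le_diam i hT.isBounded hΓ.subset_tube)
    (by linarith [abs_nonneg H]) (fun x hx => ⟨(hH x hx).1.trans hHK, (hH x hx).2.trans hHK⟩)
    (by linarith [abs_nonneg H]) (by linarith [abs_nonneg H]) hf hx

theorem ofReal_mul_add_ofReal_mul_le {J C : ℝ} (hJ : 0 ≤ J) (hC : 0 ≤ C) (h : ℝ)
    (a b : ENNReal) :
    ENNReal.ofReal J * (a + ENNReal.ofReal (C * h) * b) ≤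
      ENNReal.ofReal (J * (1 + C)) * (a + ENNReal.ofReal h * b) := by
  rw [ENNReal.ofReal_mul hJ, ENNReal.ofReal_mul hC, mul_assoc, mul_assoc,
    mul_add (ENNReal.ofReal (1 + C))]
  refine mul_le_mul_right (add_le_add ?_ ?_) _
  · exact le_mul_of_one_le_left' (ENNReal.one_le_ofReal.2 (by linarith))
  · exact mul_le_mul_left (ENNReal.ofReal_le_ofReal (by linarith)) _

theorem mainTheorem8_general (Ω : Set E3) (hΩ : BoundsSmoothSurface Ω) :
    ∃ δ : ℝ, IsTubularWidth Ω δ ∧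
      ∀ M c : ℝ, 0 < M → 0 < c →
        ∃ C : ℝ, 0 < C ∧
          ∀ Γ : PolyhedralSurface, IsCloseApprox Ω δ M c Γ →
            ∀ (i : Fin Γ.numFaces) (v : E3 → E3) (A : E3 → Mat3),
              IsH1Tangential (Γ.face i).interior (fun _ => Γ.normal i) v A →
              (∃ B : E3 → Mat3, IsH1Tangential (proj Ω '' (Γ.face i).interior) (nu Ω)
                (liftPiola Ω Γ v) B) ∧
              ∀ B : E3 → Mat3,
                IsH1Tangential (proj Ω '' (Γ.face i).interior) (nu Ω) (liftPiola Ω Γ v) B →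
                (∀ᵐ y ∂(μHE[2].restrict (proj Ω '' (Γ.face i).interior)),
                  ‖deform (nu Ω) B y - deform (fun _ => Γ.normal i) A (projInv Ω Γ y)‖ ≤
                    C * Γ.meshSize *
                      (‖covGrad (fun _ => Γ.normal i) A (projInv Ω Γ y)‖ +
                        ‖v (projInv Ω Γ y)‖)) ∧
                eLpNorm (deform (nu Ω) B) 2
                    (μHE[2].restrict (proj Ω '' (Γ.face i).interior)) ≤
                  ENNReal.ofReal C *
                    (eLpNorm (deform (fun _ => Γ.normal i) A) 2
                        (μHE[2].restrict (Γ.face i).interior) +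
                      ENNReal.ofReal Γ.meshSize *
                        (eLpNorm (covGrad (fun _ => Γ.normal i) A) 2
                            (μHE[2].restrict (Γ.face i).interior) +
                          eLpNorm v 2 (μHE[2].restrict (Γ.face i).interior))) := by
  obtain ⟨N, δ, hN, hδ, hδN, hdet⟩ := exists_isTubeNbhd hΩ
  refine ⟨δ, hN.isTubularWidth hδ hδN, fun M c hM hc => ?_⟩
  obtain ⟨K, L, hK, hL, hnear⟩ := exists_nearFlat hN (isCompact_tube hΩ δ) hδN hdet hM.le hc
  have hK₄ : 1 ≤ K ^ 4 := one_le_pow₀ hK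
  have hC : 0 ≤ 378 * K ^ 12 * L := by positivity
  refine ⟨8 * K ^ 4 * (1 + 378 * K ^ 12 * L), by positivity, fun Γ hΓ i v A hA => ?_⟩
  obtain ⟨e₁, e₂, hf⟩ := exists_isFrame (Γ.norm_normal i)
  have hP := hΓ.flatPiece hN hδN hdet hc hf
  have hΨ := hΓ.leftInvOn_projInv_face i
  have hw := hΓ.liftPiola_ae_eq hN hδN hdet hc hf v
  have hflat := hnear Γ hΓ i e₁ e₂ hf
  have hh := Γ.meshSize_nonneg
  refine ⟨⟨_, hP.isH1Tangential_piola hΨ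
    (fun x hx => hN.nu_proj x (hP.subset_nhd (hP.subset hx))) hA hw⟩, fun B hB => ⟨?_, ?_⟩⟩
  · filter_upwards [hP.ae_norm_deform_sub_le hN hflat hΨ hA hw hB] with y hy
    refine hy.trans (mul_le_mul_of_nonneg_right ?_ (by positivity))
    rw [← mul_assoc]
    exact mul_le_mul_of_nonneg_right (by nlinarith) hh
  · refine (hP.eLpNorm_deform_le hN hflat hΨ hA hw hB hK (by positivity) one_le_two).trans ?_
    rw [← mul_assoc]
    exact ofReal_mul_add_ofReal_mul_le (by positivity) hC _ _ _

theorem mainTheorem8 (Ω : Set E3) (hΩ : BoundsSmoothSurface Ω) :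
    ∃ δ : ℝ, IsTubularWidth Ω δ ∧
      ∀ M c : ℝ, 0 < M → 0 < c →
        ∃ C : ℝ, 0 < C ∧
          ∀ Γ : PolyhedralSurface, IsPolyhedralApprox Ω δ M c Γ →
            ∀ (i : Fin Γ.numFaces) (v : E3 → E3) (A : E3 → Mat3),
              IsH1Tangential (Γ.face i).interior (fun _ => Γ.normal i) v A →
              (∃ B : E3 → Mat3, IsH1Tangential (proj Ω '' (Γ.face i).interior) (nu Ω)
                (liftPiola Ω Γ v) B) ∧
              ∀ B : E3 → Mat3,
                IsH1Tangential (proj Ω '' (Γ.face i).interior) (nu Ω) (liftPiola Ω Γ v) B →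
                (∀ᵐ y ∂(μHE[2].restrict (proj Ω '' (Γ.face i).interior)),
                  ‖deform (nu Ω) B y - deform (fun _ => Γ.normal i) A (projInv Ω Γ y)‖ ≤
                    C * Γ.meshSize *
                      (‖covGrad (fun _ => Γ.normal i) A (projInv Ω Γ y)‖ +
                        ‖v (projInv Ω Γ y)‖)) ∧
                eLpNorm (deform (nu Ω) B) 2
                    (μHE[2].restrict (proj Ω '' (Γ.face i).interior)) ≤
                  ENNReal.ofReal C *
                    (eLpNorm (deform (fun _ => Γ.normal i) A) 2
                        (μHE[2].restrict (Γ.face i).interior) +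
                      ENNReal.ofReal Γ.meshSize *
                        (eLpNorm (covGrad (fun _ => Γ.normal i) A) 2
                            (μHE[2].restrict (Γ.face i).interior) +
                          eLpNorm v 2 (μHE[2].restrict (Γ.face i).interior))) := by
  obtain ⟨δ, hδ, h⟩ := mainTheorem8_general Ω hΩ
  exact ⟨δ, hδ, fun M c hM hc =>
    (h M c hM hc).imp fun _ hC => ⟨hC.1, fun Γ hΓ => hC.2 Γ hΓ.isCloseApprox⟩⟩
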